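/- Notation. For a field $\mathbb F$ and integers $n,s,d\ge 0$ let $\mathcal P(n,s,d)\subset\mathbb F[x_1,\dots,x_n]$ be the set of polynomials that are sums of at most $s$ monomials (with coefficients) and have degree at most $d$ in each variable, and let $\mathcal P_{\mathrm{Factors}}(n,s,d)$ be the set of all (not necessarily irreducible) divisors of nonzero elements of $\mathcal P(n,s,d)$. Model of computation. A deterministic algorithm is a fixed program, the same for all fields and all $n,s,d,\ell$, for a random access machine that has integer registers (with constants, addition, truncated subtraction, indirect addressing and tests for zero) and registers for elements of a field $\mathbb E$ (with $0$, $1$, $+,-,\cdot,/$, indirect addressing and tests for zero). It receives the integers $n,s,d,\ell$, and it can fetch the $j$-th entry of a given list of distinct elements of $\mathbb E$. Blackbox access to $f$ means that it may query the value of $f$ at any point of $\mathbb E^n$ that is held in its registers. Each operation and each test counts as one step, and a query counts as $n+1$ steps; the bit complexity of field elements is not counted. The field $\mathbb E$ is $\mathbb F$ itself if $\mathbb F$ has at least $B$ elements, where $B$ is a bound that is polynomial in the same quantities as the running time; if $\mathbb F$ has fewer elements, $\mathbb E$ is any extension field of $\mathbb F$ with at least $B$ elements, given together with a list of $B$ distinct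 elements, and the cost of constructing it is not counted. We write $\mathrm{poly}(a_1,\dots,a_k)$ for a bound $T(a_1,\dots,a_k)$ with a fixed polynomial $T$ that depends on nothing else, in particular not on the field. Theorem 1.15 (general divisibility testing). 1. There is a deterministic $\mathrm{poly}(n,d!,s^d,\ell)$-time algorithm that, for every field $\mathbb F$ of characteristic $0$ or of characteristic greater than $2d$, given blackbox access to two polynomials $f,g\in\mathbb F[x_1,\dots,x_n]$ each of which is a product of $\ell$ elements of $\mathcal P_{\mathrm{Factors}}(n,s,d)$, decides whether $f\mid g$. 2. There is a deterministic $\mathrm{poly}(n,(d^2)!,s^{d^3},\ell)$-time algorithm that, for every field $\mathbb F$ (of arbitrary characteristic), given blackbox access to two polynomials $f,g\in\mathbb F[x_1,\dots,x_n]$ each of which is a product of $\ell$ elements of $\mathcal P(n,s,d)$, decides whether $f\mid g$. -/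

import Mathlib

open scoped Nat

/-! ## Sparse polynomials of bounded individual degree and their factors -/

/-- `n`-variate polynomials over `F` that are a sum of at most `s` monomials (with coefficients)
and have degree at most `d` in each variable. -/
def SparsePoly (F : Type*) [Field F] (n s d : ℕ) : Set (MvPolynomial (Fin n) F) :=
  {p | p.support.card ≤ s ∧ ∀ i, p.degreeOf i ≤ d}

/-- All factors, not only the irreducible ones, of the nonzero polynomials in `SparsePoly F n s d`.
(Every polynomial divides `0`, so `0` has to be excluded as the multiple.) -/
def SparsePolyFactors (F : Type*) [Field F] (n s d : ℕ) : Set (MvPolynomial (Fin n) F) :=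
  {h | ∃ p ∈ SparsePoly F n s d, p ≠ 0 ∧ h ∣ p}

/-- `f` is a product of `l` (not necessarily distinct) elements of the class `S`. -/
def IsProductOf {R : Type*} [CommMonoid R] (S : Set R) (l : ℕ) (f : R) : Prop :=
  ∃ h : Fin l → R, (∀ i, h i ∈ S) ∧ f = ∏ i, h i

/-! ## Algebraic random access machines with blackboxes

A program is a fixed finite text, independent of the field, of the parameters and of the
polynomials. It works on two memories, one holding natural numbers (used for counting and
addressing) and one holding elements of a field `K`, and it may query two blackboxes. -/

namespace FieldRAM

/-- The memory contents: `nat a` is the number in cell `a` of the integer memory, `fld a` is the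
element in cell `a` of the field memory. -/
structure Store (K : Type*) where
  nat : ℕ → ℕ
  fld : ℕ → K

/-- The instructions. Below `N` is the integer memory and `M` the field memory. There is no
multiplication of natural numbers, so that a unit charge for each integer instruction is honest. -/
inductive Instr where
  /-- `N[a] := c` -/
  | natConst (a c : ℕ)
  /-- `N[a] := N[b] + N[c]` -/
  | natAdd (a b c : ℕ)
  /-- `N[a] := N[b] - N[c]`, truncated at `0` -/
  | natSub (a b c : ℕ)
  /-- `N[a] := N[N[b]]` -/
  | natLoad (a b : ℕ)
  /-- `N[N[a]] := N[b]` -/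
  | natStore (a b : ℕ)
  /-- `M[a] := 0` -/
  | fldZero (a : ℕ)
  /-- `M[a] := 1` -/
  | fldOne (a : ℕ)
  /-- `M[a] :=` element number `N[b]` of the given list of field elements -/
  | fldElem (a b : ℕ)
  /-- `M[a] := M[b] + M[c]` -/
  | fldAdd (a b c : ℕ)
  /-- `M[a] := M[b] - M[c]` -/
  | fldSub (a b c : ℕ)
  /-- `M[a] := M[b] * M[c]` -/
  | fldMul (a b c : ℕ)
  /-- `M[a] := M[b] / M[c]`, where `x / 0 = 0` -/
  | fldDiv (a b c : ℕ)
  /-- `M[a] := M[N[b]]` -/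
  | fldLoad (a b : ℕ)
  /-- `M[N[a]] := M[b]` -/
  | fldStore (a b : ℕ)
  /-- `M[a] :=` the value of blackbox `w` at the point `(M[N[b]], M[N[b]+1], …, M[N[b]+n-1])` -/
  | query (w : Bool) (a b : ℕ)

/-- Programs: instructions, sequencing, branching on whether an integer cell or a field cell is
zero, and loops. -/
inductive Prog where
  | skip
  | instr (i : Instr)
  | seq (p q : Prog)
  /-- if `N[a] = 0` then `p` else `q` -/
  | natBranch (a : ℕ) (p q : Prog)
  /-- if `M[a] = 0` then `p` else `q` -/
  | fldBranch (a : ℕ) (p q : Prog)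
  /-- as long as `N[a] ≠ 0`, do `p` -/
  | loop (a : ℕ) (p : Prog)

section Semantics

variable {K : Type*} [Field K] {n : ℕ}

/-- Overwrite one cell of the integer memory. -/
def Store.setNat (σ : Store K) (a v : ℕ) : Store K := ⟨Function.update σ.nat a v, σ.fld⟩

/-- Overwrite one cell of the field memory. -/
def Store.setFld (σ : Store K) (a : ℕ) (v : K) : Store K := ⟨σ.nat, Function.update σ.fld a v⟩

/-- The effect of an instruction, where `e` is the given list of field elements and `O` is the pair
of blackboxes. -/
def Instr.apply (e : ℕ → K) (O : Bool → (Fin n → K) → K) (σ : Store K) : Instr → Store K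
  | natConst a c => σ.setNat a c
  | natAdd a b c => σ.setNat a (σ.nat b + σ.nat c)
  | natSub a b c => σ.setNat a (σ.nat b - σ.nat c)
  | natLoad a b => σ.setNat a (σ.nat (σ.nat b))
  | natStore a b => σ.setNat (σ.nat a) (σ.nat b)
  | fldZero a => σ.setFld a 0
  | fldOne a => σ.setFld a 1
  | fldElem a b => σ.setFld a (e (σ.nat b))
  | fldAdd a b c => σ.setFld a (σ.fld b + σ.fld c)
  | fldSub a b c => σ.setFld a (σ.fld b - σ.fld c)
  | fldMul a b c => σ.setFld a (σ.fld b * σ.fld c)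
  | fldDiv a b c => σ.setFld a (σ.fld b / σ.fld c)
  | fldLoad a b => σ.setFld a (σ.fld (σ.nat b))
  | fldStore a b => σ.setFld (σ.nat a) (σ.fld b)
  | query w a b => σ.setFld a (O w fun j => σ.fld (σ.nat b + j))

/-- Every instruction takes one step, except that a query also takes one step for each of the `n`
coordinates of its point. -/
def Instr.cost (n : ℕ) : Instr → ℕ
  | query _ _ _ => n + 1
  | _ => 1

/-- `Exec e O p σ t τ`: started on the memory `σ`, the program `p` halts after exactly `t` steps
with the memory `τ`. Every test of a branch or of a loop takes one step. -/
inductive Exec (e : ℕ → K) (O : Bool → (Fin n → K) → K) :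
    Prog → Store K → ℕ → Store K → Prop
  | skip (σ : Store K) : Exec e O .skip σ 1 σ
  | instr (i : Instr) (σ : Store K) : Exec e O (.instr i) σ (i.cost n) (i.apply e O σ)
  | seq {p q : Prog} {σ σ' τ : Store K} {t t' : ℕ} :
      Exec e O p σ t σ' → Exec e O q σ' t' τ → Exec e O (.seq p q) σ (t + t') τ
  | natBranch_zero {a : ℕ} {p : Prog} (q : Prog) {σ τ : Store K} {t : ℕ} :
      σ.nat a = 0 → Exec e O p σ t τ → Exec e O (.natBranch a p q) σ (t + 1) τ
  | natBranch_ne {a : ℕ} (p : Prog) {q : Prog} {σ τ : Store K} {t : ℕ} :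
      σ.nat a ≠ 0 → Exec e O q σ t τ → Exec e O (.natBranch a p q) σ (t + 1) τ
  | fldBranch_zero {a : ℕ} {p : Prog} (q : Prog) {σ τ : Store K} {t : ℕ} :
      σ.fld a = 0 → Exec e O p σ t τ → Exec e O (.fldBranch a p q) σ (t + 1) τ
  | fldBranch_ne {a : ℕ} (p : Prog) {q : Prog} {σ τ : Store K} {t : ℕ} :
      σ.fld a ≠ 0 → Exec e O q σ t τ → Exec e O (.fldBranch a p q) σ (t + 1) τ
  | loop_done {a : ℕ} (p : Prog) {σ : Store K} :
      σ.nat a = 0 → Exec e O (.loop a p) σ 1 σ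
  | loop_more {a : ℕ} {p : Prog} {σ σ' τ : Store K} {t t' : ℕ} :
      σ.nat a ≠ 0 → Exec e O p σ t σ' → Exec e O (.loop a p) σ' t' τ →
      Exec e O (.loop a p) σ (t + t' + 1) τ

/-- Programs are deterministic: the number of steps and the final memory are determined by the
initial memory. -/
theorem Exec.deterministic {e : ℕ → K} {O : Bool → (Fin n → K) → K} {p : Prog} {σ τ : Store K}
    {t : ℕ} (h : Exec e O p σ t τ) :
    ∀ {t' : ℕ} {τ' : Store K}, Exec e O p σ t' τ' → t = t' ∧ τ = τ' := by
  induction h with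
  | skip σ => intro t' τ' h'; cases h'; exact ⟨rfl, rfl⟩
  | instr i σ => intro t' τ' h'; cases h'; exact ⟨rfl, rfl⟩
  | seq _ _ ih₁ ih₂ =>
    intro t' τ' h'
    cases h' with
    | seq h₁ h₂ =>
      obtain ⟨rfl, rfl⟩ := ih₁ h₁
      obtain ⟨rfl, rfl⟩ := ih₂ h₂
      exact ⟨rfl, rfl⟩
  | natBranch_zero q h0 _ ih =>
    intro t' τ' h'
    cases h' with
    | natBranch_zero _ _ h₁ => obtain ⟨rfl, rfl⟩ := ih h₁; exact ⟨rfl, rfl⟩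
    | natBranch_ne _ hne _ => exact absurd h0 hne
  | natBranch_ne p hne _ ih =>
    intro t' τ' h'
    cases h' with
    | natBranch_zero _ h0 _ => exact absurd h0 hne
    | natBranch_ne _ _ h₁ => obtain ⟨rfl, rfl⟩ := ih h₁; exact ⟨rfl, rfl⟩
  | fldBranch_zero q h0 _ ih =>
    intro t' τ' h'
    cases h' with
    | fldBranch_zero _ _ h₁ => obtain ⟨rfl, rfl⟩ := ih h₁; exact ⟨rfl, rfl⟩
    | fldBranch_ne _ hne _ => exact absurd h0 hne
  | fldBranch_ne p hne _ ih =>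
    intro t' τ' h'
    cases h' with
    | fldBranch_zero _ h0 _ => exact absurd h0 hne
    | fldBranch_ne _ _ h₁ => obtain ⟨rfl, rfl⟩ := ih h₁; exact ⟨rfl, rfl⟩
  | loop_done p h0 =>
    intro t' τ' h'
    cases h' with
    | loop_done _ _ => exact ⟨rfl, rfl⟩
    | loop_more hne _ _ => exact absurd h0 hne
  | loop_more hne _ _ ih₁ ih₂ =>
    intro t' τ' h'
    cases h' with
    | loop_done _ h0 => exact absurd h0 hne
    | loop_more _ h₁ h₂ =>
      obtain ⟨rfl, rfl⟩ := ih₁ h₁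
      obtain ⟨rfl, rfl⟩ := ih₂ h₂
      exact ⟨rfl, rfl⟩

/-- The initial memory: the four parameters are in the integer cells `0, 1, 2, 3`, and all other
cells are zero. -/
def initStore (K : Type*) [Field K] (n s d l : ℕ) : Store K :=
  ⟨fun a => if a = 0 then n else if a = 1 then s else if a = 2 then d else if a = 3 then l else 0,
   fun _ => 0⟩

end Semantics

/-- Blackbox access to the two polynomials `f` (blackbox `false`) and `g` (blackbox `true`) over
`F`: the value at any point with coordinates in the extension field `K`. -/
noncomputable def blackboxes {F K : Type*} [Field F] [Field K] [Algebra F K] {n : ℕ}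
    (f g : MvPolynomial (Fin n) F) : Bool → (Fin n → K) → K :=
  fun w x => if w then MvPolynomial.aeval x g else MvPolynomial.aeval x f

/-- Computing in the extension field `K` of `F` with the list `e` of field elements, the program
`p`, given the parameters `n, s, d, l` and blackbox access to `f` and `g`, halts within `T` steps
and answers correctly whether `f` divides `g` over `F`: the integer cell `0` ends up as `1` if it
does, and as `0` if it does not. -/
def DecidesDvdWithin {F K : Type*} [Field F] [Field K] [Algebra F K] (e : ℕ → K) (p : Prog)
    (n s d l : ℕ) (f g : MvPolynomial (Fin n) F) (T : ℕ) : Prop :=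
  ∃ (t : ℕ) (τ : Store K), t ≤ T ∧
    Exec e (blackboxes f g) p (initStore K n s d l) t τ ∧
    (f ∣ g → τ.nat 0 = 1) ∧ (¬ f ∣ g → τ.nat 0 = 0)

end FieldRAM

/-!
Suppose that `f ∤ g`. The idea is that this can be seen on a line in direction of one of the axes,
based at any point outside the zeros of a few sparse polynomials. Let `h` be a prime factor of
`f / gcd(f, g)` that does not divide `g / gcd(f, g)`, and regard everything as polynomials in a
variable `x` of `h` over the ring `D` of polynomials in the other variables. After a specialization
`ρ` of `D` in a field, `h` has a root `β` in an algebraic closure, and one has to make sure that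
`β` is a root of `f` more often than of `g`.

The tool is a certificate for coprimality (`Polynomial.exists_minor_no_common_root`): if
`A = G * A₁` and `B = G * B₁` with `G = gcd(A, B)`, some minor of the Sylvester-like matrix of
`(u, v) ↦ u * A + v * B` is nonzero, and as long as `ρ` kills neither it nor the leading coefficient
of `A`, the specializations of `A₁` and `B₁` have no common root. For sparse `A` and `B` the minor
is sparse (`MvPolynomial.exists_sparse_certificate`).

* In characteristic zero or larger than `2d`, take for `A` the products of a sparse multiple of a
  factor of `f` with a sparse multiple of a factor of `g`, and `B = A'`. Then `β` is not a root of
  any prime factor of `g` other than `h` (`Polynomial.primes_no_common_root`): two primes with a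
  common root would make the multiplicity of this root in `A'` too large.
* In arbitrary characteristic, take for `A` and `B` the powers `P ^ a` and `Q ^ b`, with
  `a, b ≤ 2d`, of the sparse factors of `f` and `g`. The certificates show that the multiplicities
  of `β` in the factors compare with all such weights as the multiplicities of `h` do
  (`Polynomial.multiplicity_root_le`), and by the choice of mediants for `a / b` they are
  proportional to them (`Polynomial.proportional_of_mediants`). So `β`, like `h`, has larger
  multiplicity in `f` than in `g`.

In both cases this yields a `MvPolynomial.HasTestFamily` of polynomially bounded size. A point where
none of its members vanishes is found among the points with the coordinates `e t ^ (k ^ j mod p)`,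
by the hitting set of Klivans and Spielman for sparse polynomials
(`MvPolynomial.exists_common_nonroot`). On the lines through these points, divisibility of
univariate polynomials that are given by their values is tested by interpolation of the quotient
(`Polynomial.PassesAt`). The program runs these tests for all values of the parameters in a range
that it computes from `n`, `s`, `d` and `l`; its answer is `1` if all tests are passed.

With `X = n + Y! + s ^ Z + l + 2`, where `Y = Z = d` in the first part and `Y = d ^ 2`, `Z = d ^ 3`
in the second, the range is `X ^ 64`, and `X ^ 2` nodes are used for the interpolation. The bound on
the size of the test families is polynomial in `X` because `(4 * Y)! ≤ 2 ^ 8 * Y! ^ 12`.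
-/

/-! ### Certificates for the absence of common roots -/

/-- A matrix over a domain with trivial kernel has a nonzero maximal minor. -/
theorem Matrix.exists_submatrix_det_ne_zero {D r c : Type*} [CommRing D] [IsDomain D]
    [Fintype r] [Fintype c] [DecidableEq c] (M : Matrix r c D)
    (h : ∀ v, M.mulVec v = 0 → v = 0) : ∃ e : c → r, (M.submatrix e id).det ≠ 0 := by
  classical
  set L := FractionRing D
  set M' : Matrix r c L := M.map (algebraMap D L) with hM'
  -- Over the fraction field the columns stay independent, so that some rows form a basis.
  have hcol : LinearIndependent L M'.transpose.row := by
    rw [← LinearIndependent.iff_fractionRing D L, Fintype.linearIndependent_iff]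
    intro g hg
    have : g = 0 := by
      apply h
      funext k
      have h1 := congrFun hg k
      have h2 : algebraMap D L (M.mulVec g k) = 0 := by
        refine Eq.trans ?_ h1
        simp [Matrix.mulVec, dotProduct, hM', Matrix.row, Algebra.smul_def, mul_comm]
      exact (map_eq_zero_iff _ (IsFractionRing.injective D L)).1 h2
    intro i; rw [this]; rfl
  have hrank : M'.rank = Fintype.card c := by
    rw [← Matrix.rank_transpose]; exact hcol.rank_matrix
  rw [Matrix.rank_eq_finrank_span_row] at hrank
  have htop : Submodule.span L (Set.range M'.row) = ⊤ :=
    Submodule.eq_top_of_finrank_eq (by rw [hrank, Module.finrank_fintype_fun_eq_card])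
  obtain ⟨κ, a, ha, hspan, hli⟩ := exists_linearIndependent' L M'.row
  rw [htop] at hspan
  have : Finite κ := Finite.of_injective a ha
  have := Fintype.ofFinite κ
  let b := Module.Basis.mk hli hspan.ge
  have hcard : Fintype.card c = Fintype.card κ := by
    rw [← Module.finrank_eq_card_basis b, Module.finrank_fintype_fun_eq_card]
  let ε := Fintype.equivOfCardEq hcard
  refine ⟨a ∘ ε, fun hdet => ?_⟩
  have h1 : LinearIndependent L (M'.submatrix (a ∘ ε) id).row := hli.comp ε ε.injective
  rw [Matrix.linearIndependent_rows_iff_isUnit, Matrix.isUnit_iff_isUnit_det] at h1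
  apply h1.ne_zero
  have : M'.submatrix (a ∘ ε) id = (algebraMap D L).mapMatrix (M.submatrix (a ∘ ε) id) := rfl
  rw [this, ← RingHom.map_det, hdet, map_zero]

namespace Polynomial

/-- Columns of the matrix of `(u, v) ↦ u * A + v * B` on pairs of polynomials with `deg u < p`
and `deg v < q`, in the monomial bases. -/
noncomputable def combMatrix {D : Type*} [CommRing D] (A B : D[X]) (p q N : ℕ) :
    Matrix (Fin N) (Fin p ⊕ Fin q) D :=
  fun k j => (Sum.elim (fun j : Fin p => X ^ (j : ℕ) * A) (fun j : Fin q => X ^ (j : ℕ) * B)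
    j).coeff k

theorem combMatrix_mulVec {D : Type*} [CommRing D] (A B : D[X]) (p q N : ℕ)
    (w : Fin p ⊕ Fin q → D) (k : Fin N) :
    (combMatrix A B p q N).mulVec w k =
      ((∑ j : Fin p, C (w (.inl j)) * X ^ (j : ℕ)) * A +
        (∑ j : Fin q, C (w (.inr j)) * X ^ (j : ℕ)) * B).coeff k := by
  simp only [Matrix.mulVec, dotProduct, combMatrix, Fintype.sum_sum_type, Sum.elim_inl,
    Sum.elim_inr, coeff_add, Finset.sum_mul, finsetSum_coeff]
  congr 1 <;> refine Finset.sum_congr rfl fun j _ => ?_ <;> rw [mul_assoc, coeff_C_mul, mul_comm]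

theorem degree_sum_C_mul_X_pow_lt {D : Type*} [CommRing D] {p : ℕ} (w : Fin p → D) :
    (∑ j : Fin p, C (w j) * X ^ (j : ℕ)).degree < (p : WithBot ℕ) := by
  refine (degree_sum_le _ _).trans_lt ((Finset.sup_lt_iff (WithBot.bot_lt_coe p)).2 fun j _ => ?_)
  exact (degree_C_mul_X_pow_le _ _).trans_lt (Nat.cast_lt.2 j.2)

theorem coeff_sum_fin {D : Type*} [CommRing D] {p : ℕ} (w : Fin p → D) (i : Fin p) :
    (∑ j : Fin p, C (w j) * X ^ (j : ℕ)).coeff i = w i := by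
  simp [finsetSum_coeff, coeff_C_mul, coeff_X_pow, Fin.val_inj]

theorem sum_coeff_fin {D : Type*} [CommRing D] {p : ℕ} (f : D[X])
    (hf : f.degree < (p : WithBot ℕ)) :
    (∑ j : Fin p, C (f.coeff j) * X ^ (j : ℕ)) = f := by
  ext k
  by_cases hk : k < p
  · exact coeff_sum_fin (fun j : Fin p => f.coeff j) ⟨k, hk⟩
  · have hk' : (p : WithBot ℕ) ≤ (k : WithBot ℕ) := by exact_mod_cast not_lt.1 hk
    rw [coeff_eq_zero_of_degree_lt ((degree_sum_C_mul_X_pow_lt _).trans_le hk'),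
      coeff_eq_zero_of_degree_lt (hf.trans_le hk')]

/-- If `A = G * A₁` and `B = G * B₁` with `A₁`, `B₁` relatively prime, then a suitable minor of the
matrix of `(u, v) ↦ u * A + v * B` (with `deg u < deg B₁` and `deg v < deg A₁`) is nonzero, and if
neither this minor nor the leading coefficient of `A` vanishes under a specialization `ρ`, then the
specializations of `A₁` and `B₁` have no common root. -/
theorem exists_minor_no_common_root {D E : Type*} [CommRing D] [IsDomain D]
    [UniqueFactorizationMonoid D] [Field E] {A B G A₁ B₁ : D[X]} (hA0 : A ≠ 0) (hA : A = G * A₁)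
    (hB : B = G * B₁) (hrel : IsRelPrime A₁ B₁) :
    ∃ e : Fin B₁.natDegree ⊕ Fin A₁.natDegree → Fin (A.natDegree + B.natDegree + 1),
      ((combMatrix A B _ _ _).submatrix e id).det ≠ 0 ∧
      ∀ (ρ : D →+* E) (β : E), ρ A.leadingCoeff ≠ 0 →
        ρ ((combMatrix A B _ _ _).submatrix e id).det ≠ 0 →
        eval₂ ρ β A₁ = 0 → eval₂ ρ β B₁ ≠ 0 := by
  have hG0 : G ≠ 0 := fun h => hA0 (by rw [hA, h, zero_mul])
  have hA10 : A₁ ≠ 0 := fun h => hA0 (by rw [hA, h, mul_zero])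
  obtain ⟨e, he⟩ := Matrix.exists_submatrix_det_ne_zero
    (combMatrix A B B₁.natDegree A₁.natDegree (A.natDegree + B.natDegree + 1)) (by
      intro w hw
      set u := ∑ j : Fin B₁.natDegree, C (w (.inl j)) * X ^ (j : ℕ) with hu
      set v := ∑ j : Fin A₁.natDegree, C (w (.inr j)) * X ^ (j : ℕ) with hv
      have hud := degree_sum_C_mul_X_pow_lt fun j => w (.inl j)
      have hvd := degree_sum_C_mul_X_pow_lt fun j => w (.inr j)
      rw [← hu] at hud
      rw [← hv] at hvd
      have hz : u * A + v * B = 0 := by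
        ext k
        by_cases hk : k < A.natDegree + B.natDegree + 1
        · rw [← combMatrix_mulVec A B _ _ _ w ⟨k, hk⟩, hw]; rfl
        · have h1 : B₁.natDegree ≤ B.natDegree := by
            rcases eq_or_ne B₁ 0 with h | h
            · simp [h]
            · rw [hB, natDegree_mul hG0 h]; omega
          have h2 : A₁.natDegree ≤ A.natDegree := by rw [hA, natDegree_mul hG0 hA10]; omega
          have hu1 := natDegree_le_of_degree_le hud.le
          have hv1 := natDegree_le_of_degree_le hvd.le
          rw [coeff_zero]
          refine coeff_eq_zero_of_natDegree_lt ((natDegree_add_le _ _).trans_lt (max_lt ?_ ?_))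
          · exact natDegree_mul_le.trans_lt (by omega)
          · exact natDegree_mul_le.trans_lt (by omega)
      -- Since `A₁` is prime to `B₁`, it divides `v`, whose degree is too small for that.
      have hz1 : u * A₁ + v * B₁ = 0 := by
        have : G * (u * A₁ + v * B₁) = 0 := by rw [← hz, hA, hB]; ring
        exact (mul_eq_zero.1 this).resolve_left hG0
      have hv0 : v = 0 := by
        by_contra hv0
        have : A₁ ∣ v * B₁ := ⟨-u, by linear_combination hz1⟩
        have := natDegree_le_of_dvd (hrel.dvd_of_dvd_mul_right this) hv0
        rw [degree_eq_natDegree hv0] at hvd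
        exact absurd (by exact_mod_cast hvd) this.not_gt
      have hu0 : u = 0 := by
        rw [hv0, zero_mul, add_zero] at hz1
        exact (mul_eq_zero.1 hz1).resolve_right hA10
      funext j
      rcases j with j | j
      · rw [← coeff_sum_fin (fun j => w (.inl j)) j, ← hu, hu0]; simp
      · rw [← coeff_sum_fin (fun j => w (.inr j)) j, ← hv, hv0]; simp)
  refine ⟨e, he, fun ρ β hlc hdet ha hb => ?_⟩
  -- From a common root `β`, the pair `(B₁ / (X - β), -A₁ / (X - β))` is in the kernel of the
  -- specialized minor.
  obtain ⟨a, ha⟩ := dvd_iff_isRoot.2 (show (A₁.map ρ).IsRoot β by rwa [IsRoot.def, eval_map])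
  obtain ⟨b, hb⟩ := dvd_iff_isRoot.2 (show (B₁.map ρ).IsRoot β by rwa [IsRoot.def, eval_map])
  have hlc1 : ρ A₁.leadingCoeff ≠ 0 := by
    intro h; apply hlc; rw [hA, leadingCoeff_mul, map_mul, h, mul_zero]
  have hdeg := natDegree_map_of_leadingCoeff_ne_zero ρ hlc1
  have hA1ρ : A₁.map ρ ≠ 0 := fun h => hlc1 (by
    have := leadingCoeff_map_of_leadingCoeff_ne_zero ρ hlc1
    rw [← this, h, leadingCoeff_zero])
  have ha0 : a ≠ 0 := by rintro rfl; simp [ha] at hA1ρ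
  have had : a.degree < (A₁.natDegree : WithBot ℕ) := by
    rw [degree_eq_natDegree ha0, ← hdeg, ha, natDegree_mul (X_sub_C_ne_zero β) ha0,
      natDegree_X_sub_C]
    exact_mod_cast (by omega)
  have hbd : b.degree < (B₁.natDegree : WithBot ℕ) := by
    rcases eq_or_ne b 0 with rfl | hb0
    · rw [degree_zero]; exact WithBot.bot_lt_coe _
    · have := natDegree_map_le (f := ρ) (p := B₁)
      rw [hb, natDegree_mul (X_sub_C_ne_zero β) hb0, natDegree_X_sub_C] at this
      rw [degree_eq_natDegree hb0]
      exact_mod_cast (by omega)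
  set w : Fin B₁.natDegree ⊕ Fin A₁.natDegree → E :=
    Sum.elim (fun j => b.coeff j) (fun j => (-a).coeff j) with hw
  have hcomb : combMatrix (A.map ρ) (B.map ρ) B₁.natDegree A₁.natDegree
      (A.natDegree + B.natDegree + 1) = (combMatrix A B _ _ _).map ρ := by
    ext k j
    rcases j with j | j <;> simp [combMatrix, coeff_X_pow_mul', apply_ite ρ]
  have hker : ((combMatrix (A.map ρ) (B.map ρ) B₁.natDegree A₁.natDegree
      (A.natDegree + B.natDegree + 1)).submatrix e id).mulVec w = 0 := by
    funext k
    have := combMatrix_mulVec (A.map ρ) (B.map ρ) _ _ _ w (e k)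
    simp only [hw, Sum.elim_inl, Sum.elim_inr] at this
    rw [sum_coeff_fin b hbd, sum_coeff_fin (-a) (by rwa [degree_neg])] at this
    refine Eq.trans ?_ (this.trans ?_)
    · rfl
    · have hz : b * A.map ρ + -a * B.map ρ = 0 := by
        rw [hA, hB, Polynomial.map_mul, Polynomial.map_mul, ha, hb]; ring
      rw [hz]; rfl
  have hdet' : ((combMatrix (A.map ρ) (B.map ρ) B₁.natDegree A₁.natDegree
      (A.natDegree + B.natDegree + 1)).submatrix e id).det ≠ 0 := by
    rw [hcomb]
    rw [RingHom.map_det] at hdet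
    exact hdet
  have hw0 := Matrix.eq_zero_of_mulVec_eq_zero hdet' hker
  apply ha0
  have : -a = 0 := by
    rw [← sum_coeff_fin (-a) (p := A₁.natDegree) (by rwa [degree_neg])]
    refine Finset.sum_eq_zero fun j _ => ?_
    have := congrFun hw0 (.inr j)
    simp only [hw, Sum.elim_inr] at this
    rw [this]; simp
  exact neg_eq_zero.1 this

end Polynomial

/-! ### Roots of prime factors after specialization -/

namespace Polynomial

variable {D E : Type*} [CommRing D] [IsDomain D] [Field E]

theorem derivative_ne_zero_of_cast_ne_zero {h : D[X]} (h0 : 0 < h.natDegree)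
    (hc : (h.natDegree : D) ≠ 0) : derivative h ≠ 0 := by
  intro hd
  have h1 := congrArg (fun f => coeff f (h.natDegree - 1)) hd
  simp only [coeff_derivative, coeff_zero] at h1
  rw [show h.natDegree - 1 + 1 = h.natDegree by omega, coeff_natDegree] at h1
  rcases mul_eq_zero.1 h1 with h2 | h2
  · rw [leadingCoeff_eq_zero] at h2
    rw [h2] at h0; simp at h0
  · apply hc
    rw [← h2]
    have : ((h.natDegree - 1 + 1 : ℕ) : D) = h.natDegree := by congr 1; omega
    rw [← this]; push_cast; rfl

/-- In large characteristic the quotient of `A` by a common factor of `A` and `A'` is still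
divisible by every prime factor of `A` of positive degree. -/
theorem prime_dvd_cofactor_of_derivative [UniqueFactorizationMonoid D] {A G A₁ B₁ h : D[X]}
    (hA0 : A ≠ 0) (hchar : ∀ k : ℕ, 0 < k → k ≤ A.natDegree → (k : D) ≠ 0) (hA : A = G * A₁)
    (hB : derivative A = G * B₁) (hh : Prime h) (hdeg : 0 < h.natDegree) (hhA : h ∣ A) :
    h ∣ A₁ := by
  by_contra hn
  -- Otherwise `G`, and with it `A'`, is divisible by the full power of `h` in `A`.
  obtain ⟨C', hC, hhC⟩ :=
    (FiniteMultiplicity.of_prime_left hh hA0).exists_eq_pow_mul_and_not_dvd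
  set n := multiplicity h A with hn'
  have hn0 : 0 < n := multiplicity_pos_of_dvd hhA
  have hC0 : C' ≠ 0 := by rintro rfl; simp at hhC
  have hnat : A.natDegree = n * h.natDegree + C'.natDegree := by
    conv_lhs => rw [hC]
    rw [natDegree_mul (pow_ne_zero _ hh.ne_zero) hC0, natDegree_pow]
  have hnA : n ≤ A.natDegree := by nlinarith
  have hhdA : h.natDegree ≤ A.natDegree := by nlinarith
  have hG : h ^ n ∣ G :=
    hh.pow_dvd_of_dvd_mul_right n hn (by rw [← hA]; exact ⟨C', hC⟩)
  have hd : h ^ n ∣ derivative A := hG.trans ⟨B₁, hB⟩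
  rw [hC, derivative_mul, derivative_pow] at hd
  have hd2 := (dvd_add_left (dvd_mul_right (h ^ n) _)).1 hd
  have hpow : h ^ n = h ^ (n - 1) * h := by rw [← pow_succ, Nat.sub_add_cancel hn0]
  have hd3 : h ∣ C (n : D) * derivative h * C' := by
    have h5 : h ^ (n - 1) * h ∣ h ^ (n - 1) * (C (n : D) * derivative h * C') := by
      rw [← hpow]; refine hd2.trans (dvd_of_eq ?_); ring
    exact (mul_dvd_mul_iff_left (pow_ne_zero _ hh.ne_zero)).1 h5
  rcases hh.dvd_or_dvd hd3 with h1 | h1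
  · rcases hh.dvd_or_dvd h1 with h2 | h2
    · have := natDegree_le_of_dvd h2 (C_ne_zero.2 (hchar n hn0 hnA))
      rw [natDegree_C] at this; omega
    · have := natDegree_le_of_dvd h2
        (derivative_ne_zero_of_cast_ne_zero hdeg (hchar _ hdeg hhdA))
      have := natDegree_derivative_lt hdeg.ne'
      omega
  · exact hhC h1

theorem eval₂_ne_zero_of_dvd_of_natDegree_eq_zero {A q : D[X]} (hq : q.natDegree = 0) (hqA : q ∣ A)
    {ρ : D →+* E} {β : E} (hlc : ρ A.leadingCoeff ≠ 0) : eval₂ ρ β q ≠ 0 := by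
  obtain ⟨z, rfl⟩ := hqA
  rw [eq_C_of_natDegree_eq_zero hq, eval₂_C]
  intro h
  apply hlc
  rw [leadingCoeff_mul, map_mul, leadingCoeff, hq, h, zero_mul]

/-- Two different prime factors of `A` have no common root after a specialization that preserves
the degree of `A` and the coprimality of the cofactors of `gcd(A, A')`. -/
theorem primes_no_common_root [UniqueFactorizationMonoid D] {A G A₁ B₁ h q : D[X]}
    (hchar : ∀ k : ℕ, 0 < k → k ≤ A.natDegree → (k : D) ≠ 0) (hA : A = G * A₁)
    (hB : derivative A = G * B₁) (hh : Prime h) (hq : Prime q) (hhq : ¬ h ∣ q) (hhA : h ∣ A)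
    (hqA : q ∣ A) {ρ : D →+* E} {β : E} (hlc : ρ A.leadingCoeff ≠ 0)
    (hno : eval₂ ρ β A₁ = 0 → eval₂ ρ β B₁ ≠ 0) (hβ : eval₂ ρ β h = 0) : eval₂ ρ β q ≠ 0 := by
  intro hβq
  have hA0 : A ≠ 0 := by rintro rfl; simp at hlc
  have hdh : 0 < h.natDegree := Nat.pos_of_ne_zero fun h0 =>
    eval₂_ne_zero_of_dvd_of_natDegree_eq_zero h0 hhA hlc hβ
  have hdq : 0 < q.natDegree := Nat.pos_of_ne_zero fun h0 =>
    eval₂_ne_zero_of_dvd_of_natDegree_eq_zero h0 hqA hlc hβq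
  obtain ⟨z, hz⟩ := prime_dvd_cofactor_of_derivative hA0 hchar hA hB hh hdh hhA
  have hqh : ¬ q ∣ h := fun hd =>
    hhq (hq.irreducible.associated_of_dvd hh.irreducible hd).symm.dvd
  have hqz : q ∣ z := by
    have := prime_dvd_cofactor_of_derivative hA0 hchar hA hB hq hdq hqA
    rw [hz] at this
    exact (hq.dvd_or_dvd this).resolve_left hqh
  obtain ⟨y, hy⟩ := hqz
  have hXh : X - C β ∣ h.map ρ := dvd_iff_isRoot.2 (by rwa [IsRoot.def, eval_map])
  have hXq : X - C β ∣ q.map ρ := dvd_iff_isRoot.2 (by rwa [IsRoot.def, eval_map])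
  have hAρ : A.map ρ ≠ 0 := fun h0 => hlc (by
    rw [← leadingCoeff_map_of_leadingCoeff_ne_zero ρ hlc, h0, leadingCoeff_zero])
  have hp : Prime (X - C β) := prime_X_sub_C β
  have hGρ : G.map ρ ≠ 0 := by
    intro h0; rw [hA, Polynomial.map_mul, h0, zero_mul] at hAρ; exact hAρ rfl
  obtain ⟨v, hv⟩ : ∃ v, v = multiplicity (X - C β) (G.map ρ) := ⟨_, rfl⟩
  have hvd : (X - C β) ^ v ∣ G.map ρ := hv ▸ pow_multiplicity_dvd _ _
  have hvn : ¬ (X - C β) ^ (v + 1) ∣ G.map ρ :=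
    (FiniteMultiplicity.of_prime_left hp hGρ).not_pow_dvd_of_multiplicity_lt (by omega)
  -- Both `h` and `q` divide `A₁`, so that `β` has two more multiplicities in `A` than in `G`,
  -- hence at least one more in `A'`, which `B₁` cannot account for.
  have hA2 : (X - C β) ^ (v + 2) ∣ A.map ρ := by
    rw [hA, hz, hy, Polynomial.map_mul, Polynomial.map_mul, Polynomial.map_mul, pow_add, sq]
    exact mul_dvd_mul hvd (mul_dvd_mul hXh (dvd_mul_of_dvd_left hXq _))
  have hA3 : (X - C β) ^ (v + 1) ∣ G.map ρ * B₁.map ρ := by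
    rw [← Polynomial.map_mul, ← hB, ← derivative_map]
    have h1 := pow_sub_one_dvd_derivative_of_pow_dvd hA2
    rwa [show v + 2 - 1 = v + 1 from rfl] at h1
  have hB1 : eval₂ ρ β B₁ ≠ 0 := hno (by rw [hz, eval₂_mul, hβ, zero_mul])
  refine hvn (hp.pow_dvd_of_dvd_mul_right _ (fun hd => hB1 ?_) hA3)
  rw [← eval_map]
  exact dvd_iff_isRoot.1 hd

/-- If `h` divides `A` more often than it divides `B`, then a root of `h` is a root of `A` at least
as often as of `B`, after a specialization that preserves the degree of `A` and the coprimality of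
the cofactors of `gcd(A, B)`. -/
theorem multiplicity_root_le [UniqueFactorizationMonoid D] {A B G A₁ B₁ h : D[X]}
    (hA : A = G * A₁) (hB : B = G * B₁) (hh : Prime h) (hB0 : B ≠ 0)
    (hlt : multiplicity h B < multiplicity h A)
    {ρ : D →+* E} {β : E} (hlc : ρ A.leadingCoeff ≠ 0)
    (hno : eval₂ ρ β A₁ = 0 → eval₂ ρ β B₁ ≠ 0) (hβ : eval₂ ρ β h = 0) :
    multiplicity (X - C β) (B.map ρ) ≤ multiplicity (X - C β) (A.map ρ) := by
  have hA0 : A ≠ 0 := by rintro rfl; simp at hlc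
  have hhA1 : h ∣ A₁ := by
    by_contra hn
    have hd : h ^ multiplicity h A ∣ B := (hh.pow_dvd_of_dvd_mul_right _ hn
      (by rw [← hA]; exact pow_multiplicity_dvd _ _)).trans ⟨B₁, hB⟩
    exact hlt.not_ge ((FiniteMultiplicity.of_prime_left hh hB0).le_multiplicity_of_pow_dvd hd)
  have hAρ : A.map ρ ≠ 0 := fun h0 => hlc (by
    rw [← leadingCoeff_map_of_leadingCoeff_ne_zero ρ hlc, h0, leadingCoeff_zero])
  have hp : Prime (X - C β) := prime_X_sub_C β
  have hB1 : eval₂ ρ β B₁ ≠ 0 := hno (by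
    obtain ⟨z, rfl⟩ := hhA1; rw [eval₂_mul, hβ, zero_mul])
  refine (FiniteMultiplicity.of_prime_left hp hAρ).le_multiplicity_of_pow_dvd ?_
  have h1 : (X - C β) ^ multiplicity (X - C β) (B.map ρ) ∣ G.map ρ * B₁.map ρ := by
    rw [← Polynomial.map_mul, ← hB]; exact pow_multiplicity_dvd _ _
  refine (hp.pow_dvd_of_dvd_mul_right _ (fun hd => hB1 ?_) h1).trans ?_
  · rw [← eval_map]; exact dvd_iff_isRoot.1 hd
  · rw [hA, Polynomial.map_mul]; exact dvd_mul_right _ _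

end Polynomial

/-! ### Non-divisibility after specialization -/

namespace Polynomial

variable {D E : Type*} [CommRing D] [IsDomain D] [UniqueFactorizationMonoid D] [Field E]

/-- If a ring homomorphism to a field kills a nonzero element of a unique factorization domain but
no unit, it kills a prime factor of that element. -/
theorem exists_prime_dvd_map_eq_zero {R : Type*} [CommRing R] [IsDomain R]
    [UniqueFactorizationMonoid R] (ψ : R →+* E) {a : R} (ha : a ≠ 0) (h : ψ a = 0) :
    ∃ q, Prime q ∧ q ∣ a ∧ ψ q = 0 := by
  induction a using UniqueFactorizationMonoid.induction_on_prime with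
  | h₁ => exact absurd rfl ha
  | h₂ x hx => exact absurd h (hx.map ψ).ne_zero
  | h₃ a p ha0 hp ih =>
    rw [map_mul] at h
    rcases mul_eq_zero.1 h with h | h
    · exact ⟨p, hp, dvd_mul_right _ _, h⟩
    · obtain ⟨q, hq, hqa, h0⟩ := ih ha0 h
      exact ⟨q, hq, dvd_mul_of_dvd_right hqa _, h0⟩

/-- A prime `h` that divides `f / gcd(f, g)` but not `g / gcd(f, g)` witnesses `¬ f ∣ g` after
every specialization under which `h` has a root that is not a root of the other primes dividing
`g`. -/
theorem not_map_dvd_of_separated {f g c f' g' h : D[X]} (hf : f = c * f') (hg : g = c * g')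
    (hhf : h ∣ f') (hhg : ¬ h ∣ g') {ρ : D →+* E} {β : E} (hβ : eval₂ ρ β h = 0)
    (hg0 : g.map ρ ≠ 0) (hsep : ∀ q, Prime q → q ∣ g → ¬ h ∣ q → eval₂ ρ β q ≠ 0) :
    ¬ f.map ρ ∣ g.map ρ := by
  intro hd
  rw [hf, hg, Polynomial.map_mul, Polynomial.map_mul] at hd
  have hc : c.map ρ ≠ 0 := by
    intro h0; rw [hg, Polynomial.map_mul, h0, zero_mul] at hg0; exact hg0 rfl
  have hd' := (mul_dvd_mul_iff_left hc).1 hd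
  have hg'0 : g' ≠ 0 := by rintro rfl; simp at hhg
  have hroot : eval₂RingHom ρ β g' = 0 := by
    obtain ⟨y, hy⟩ := hhf
    obtain ⟨z, hz⟩ := hd'
    rw [coe_eval₂RingHom, ← eval_map, hz, hy, Polynomial.map_mul, eval_mul, eval_mul, eval_map, hβ]
    ring
  obtain ⟨q, hq, hqg, h0⟩ := exists_prime_dvd_map_eq_zero (eval₂RingHom ρ β) hg'0 hroot
  exact hsep q hq (by rw [hg]; exact dvd_mul_of_dvd_right hqg _)
    (fun hhq => hhg (hhq.trans hqg)) h0

/-- If the ratios of two families `u`, `v` of natural numbers bounded by `d` compare in the same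
way with all fractions `a / b` with `a, b ≤ 2 * d`, the families are proportional: a fraction
separating two different ratios would be their mediant. -/
theorem proportional_of_mediants {κ : Type*} {d : ℕ} {u v : κ → ℕ} (hu : ∀ k, u k ≤ d)
    (hv : ∀ k, v k ≤ d)
    (hab : ∀ k k' a b, a ≤ 2 * d → b ≤ 2 * d → b * u k' < a * u k → b * v k' ≤ a * v k)
    (k k' : κ) : u k * v k' = u k' * v k := by
  have key : ∀ k k' : κ, u k * v k' ≤ u k' * v k := by
    intro k k'
    by_contra! hlt
    have := hab k k' (u k' + v k') (u k + v k) (by linarith [hu k', hv k'])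
      (by linarith [hu k, hv k]) (by nlinarith)
    nlinarith
  exact le_antisymm (key k k') (key k' k)

theorem multiplicity_le_natDegree {R : Type*} [CommRing R] [IsDomain R] {h p : R[X]}
    (hd : 0 < h.natDegree) (hp : p ≠ 0) : multiplicity h p ≤ p.natDegree := by
  have h1 := natDegree_le_of_dvd (pow_multiplicity_dvd h p) hp
  rw [natDegree_pow] at h1
  nlinarith

theorem multiplicity_prod {R ι : Type*} [CommRing R] [IsDomain R] [WfDvdMonoid R] {h : R}
    (hh : Prime h) (s : Finset ι) (P : ι → R) (hP : ∀ i ∈ s, P i ≠ 0) :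
    multiplicity h (∏ i ∈ s, P i) = ∑ i ∈ s, multiplicity h (P i) := by
  classical
  have h1 := Finset.emultiplicity_prod hh s P
  have h2 : ∀ i ∈ s, emultiplicity h (P i) = multiplicity h (P i) := fun i hi =>
    (FiniteMultiplicity.of_prime_left hh (hP i hi)).emultiplicity_eq_multiplicity
  rw [(FiniteMultiplicity.of_prime_left hh
    (Finset.prod_ne_zero_iff.2 hP)).emultiplicity_eq_multiplicity, Finset.sum_congr rfl h2] at h1
  exact_mod_cast h1

/-- Products of polynomials of degree at most `d`: if the multiplicities of `h` and those of a root
`β` of the specialization of `h` compare in the same way for all powers of the factors up to `2d`,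
then non-divisibility of the products, witnessed by `h`, is preserved. -/
theorem not_map_prod_dvd_of_powers {ι : Type*} [Fintype ι] {d : ℕ} {P Q : ι → D[X]} {h : D[X]}
    (hP : ∀ i, (P i).natDegree ≤ d) (hQ : ∀ i, (Q i).natDegree ≤ d)
    (hh : Prime h) (hd : 0 < h.natDegree) (hQ0 : ∀ i, Q i ≠ 0)
    (hP0 : ∀ i, P i ≠ 0) (hlt : multiplicity h (∏ i, Q i) < multiplicity h (∏ i, P i))
    {ρ : D →+* E} {β : E} (hβ : eval₂ ρ β h = 0)
    (hPρ : ∀ i, (P i).map ρ ≠ 0) (hQρ : ∀ i, (Q i).map ρ ≠ 0)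
    (hab : ∀ k k' : ι ⊕ ι, ∀ a b, a ≤ 2 * d → b ≤ 2 * d →
      multiplicity h (Sum.elim P Q k' ^ b) < multiplicity h (Sum.elim P Q k ^ a) →
      multiplicity (X - C β) ((Sum.elim P Q k' ^ b).map ρ) ≤
        multiplicity (X - C β) ((Sum.elim P Q k ^ a).map ρ)) :
    ¬ (∏ i, P i).map ρ ∣ (∏ i, Q i).map ρ := by
  have hp : Prime (X - C β) := prime_X_sub_C β
  have hR0 : ∀ k, Sum.elim P Q k ≠ 0 := by rintro (k | k); exacts [hP0 k, hQ0 k]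
  have hRρ : ∀ k, (Sum.elim P Q k).map ρ ≠ 0 := by rintro (k | k); exacts [hPρ k, hQρ k]
  have hRd : ∀ k, (Sum.elim P Q k).natDegree ≤ d := by rintro (k | k); exacts [hP k, hQ k]
  have hprop := proportional_of_mediants (d := d)
    (u := fun k => multiplicity h (Sum.elim P Q k))
    (v := fun k => multiplicity (X - C β) ((Sum.elim P Q k).map ρ))
    (fun k => (multiplicity_le_natDegree hd (hR0 k)).trans (hRd k))
    (fun k => (multiplicity_le_natDegree (by simp) (hRρ k)).trans
      (natDegree_map_le.trans (hRd k)))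
    (fun k k' a b ha hb => by
      have := hab k k' a b ha hb
      rw [Polynomial.map_pow, Polynomial.map_pow,
        FiniteMultiplicity.multiplicity_pow hh (FiniteMultiplicity.of_prime_left hh (hR0 k')),
        FiniteMultiplicity.multiplicity_pow hh (FiniteMultiplicity.of_prime_left hh (hR0 k)),
        FiniteMultiplicity.multiplicity_pow hp (FiniteMultiplicity.of_prime_left hp (hRρ k')),
        FiniteMultiplicity.multiplicity_pow hp (FiniteMultiplicity.of_prime_left hp (hRρ k))]
        at this
      exact this)
  rw [multiplicity_prod hh _ _ fun i _ => hP0 i, multiplicity_prod hh _ _ fun i _ => hQ0 i] at hlt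
  obtain ⟨i₀, -, hi₀⟩ : ∃ i ∈ Finset.univ, multiplicity h (P i) ≠ 0 := by
    apply Finset.exists_ne_zero_of_sum_ne_zero; omega
  have hv₀ : 0 < multiplicity (X - C β) ((P i₀).map ρ) := by
    apply multiplicity_pos_of_dvd
    obtain ⟨z, hz⟩ := dvd_of_multiplicity_pos (Nat.pos_of_ne_zero hi₀)
    rw [dvd_iff_isRoot, IsRoot.def, eval_map, hz, eval₂_mul, hβ, zero_mul]
  have hQprod : (∏ i, (Q i).map ρ) ≠ 0 := Finset.prod_ne_zero_iff.2 fun i _ => hQρ i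
  intro hdvd
  rw [Polynomial.map_prod, Polynomial.map_prod] at hdvd
  have hle := (FiniteMultiplicity.of_prime_left hp hQprod).le_multiplicity_of_pow_dvd
    ((pow_multiplicity_dvd (X - C β) _).trans hdvd)
  rw [multiplicity_prod hp _ _ fun i _ => hPρ i, multiplicity_prod hp _ _ fun i _ => hQρ i] at hle
  -- By proportionality, `h` and `β` weigh the two products in the same ratio.
  have h1 : multiplicity h (P i₀) * ∑ i, multiplicity (X - C β) ((P i).map ρ) =
      (∑ i, multiplicity h (P i)) * multiplicity (X - C β) ((P i₀).map ρ) := by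
    rw [Finset.mul_sum, Finset.sum_mul]
    exact Finset.sum_congr rfl fun i _ => hprop (.inl i₀) (.inl i)
  have h2 : multiplicity h (P i₀) * ∑ i, multiplicity (X - C β) ((Q i).map ρ) =
      (∑ i, multiplicity h (Q i)) * multiplicity (X - C β) ((P i₀).map ρ) := by
    rw [Finset.mul_sum, Finset.sum_mul]
    exact Finset.sum_congr rfl fun i _ => hprop (.inl i₀) (.inr i)
  have h3 := Nat.mul_le_mul_left (multiplicity h (P i₀)) hle
  rw [h1, h2] at h3
  exact hlt.not_ge (Nat.le_of_mul_le_mul_right h3 hv₀)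

end Polynomial

/-! ### Sparse polynomials and restriction to lines -/

namespace MvPolynomial

variable {F σ : Type*} [Field F]

/-- At most `M` monomials and degree at most `Δ` in each variable. -/
def SparseBound (p : MvPolynomial σ F) (M Δ : ℕ) : Prop :=
  p.support.card ≤ M ∧ ∀ i, p.degreeOf i ≤ Δ

namespace SparseBound

theorem mono {p : MvPolynomial σ F} {M Δ M' Δ' : ℕ} (h : SparseBound p M Δ) (hM : M ≤ M')
    (hΔ : Δ ≤ Δ') : SparseBound p M' Δ' :=
  ⟨h.1.trans hM, fun i => (h.2 i).trans hΔ⟩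

theorem zero (M Δ : ℕ) : SparseBound (0 : MvPolynomial σ F) M Δ := by
  simp [SparseBound]

theorem one (Δ : ℕ) : SparseBound (1 : MvPolynomial σ F) 1 Δ := by
  classical
  refine ⟨?_, fun i => ?_⟩
  · rw [← C_1, ← monomial_zero']
    exact (Finset.card_le_card support_monomial_subset).trans (by simp)
  · rw [← C_1, degreeOf_C]; exact Nat.zero_le _

theorem mul {p q : MvPolynomial σ F} {M Δ M' Δ' : ℕ} (hp : SparseBound p M Δ)
    (hq : SparseBound q M' Δ') : SparseBound (p * q) (M * M') (Δ + Δ') := by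
  classical
  refine ⟨?_, fun i => (degreeOf_mul_le i p q).trans (add_le_add (hp.2 i) (hq.2 i))⟩
  exact (Finset.card_le_card (support_mul p q)).trans
    (Finset.card_add_le.trans (Nat.mul_le_mul hp.1 hq.1))

theorem prod {ι : Type*} (s : Finset ι) {p : ι → MvPolynomial σ F} {M Δ : ℕ}
    (h : ∀ i ∈ s, SparseBound (p i) M Δ) :
    SparseBound (∏ i ∈ s, p i) (M ^ s.card) (s.card * Δ) := by
  classical
  induction s using Finset.induction_on with
  | empty => simpa using one 0
  | insert a s ha ih =>
    rw [Finset.prod_insert ha, Finset.card_insert_of_notMem ha, pow_succ', add_mul, one_mul,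
      add_comm (s.card * Δ)]
    exact (h a (by simp)).mul (ih fun i hi => h i (by simp [hi]))

theorem pow {p : MvPolynomial σ F} {M Δ : ℕ} (h : SparseBound p M Δ) (a : ℕ) :
    SparseBound (p ^ a) (M ^ a) (a * Δ) := by
  simpa using prod (Finset.range a) (p := fun _ => p) fun _ _ => h

theorem sum {ι : Type*} (s : Finset ι) {p : ι → MvPolynomial σ F} {M Δ : ℕ}
    (h : ∀ i ∈ s, SparseBound (p i) M Δ) : SparseBound (∑ i ∈ s, p i) (s.card * M) Δ := by
  classical
  refine ⟨?_, fun i => (degreeOf_sum_le i s p).trans (Finset.sup_le fun j hj => (h j hj).2 i)⟩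
  refine (Finset.card_le_card support_sum).trans (Finset.card_biUnion_le.trans ?_)
  rw [← smul_eq_mul]
  exact Finset.sum_le_card_nsmul _ _ _ fun i hi => (h i hi).1

theorem neg {p : MvPolynomial σ F} {M Δ : ℕ} (h : SparseBound p M Δ) : SparseBound (-p) M Δ := by
  refine ⟨by rw [support_neg]; exact h.1, fun i => ?_⟩
  rw [degreeOf_neg]; exact h.2 i

theorem det {c : Type*} [Fintype c] [DecidableEq c] {A : Matrix c c (MvPolynomial σ F)} {M Δ : ℕ}
    (h : ∀ i j, SparseBound (A i j) M Δ) :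
    SparseBound A.det ((Fintype.card c)! * M ^ Fintype.card c) (Fintype.card c * Δ) := by
  rw [Matrix.det_apply, ← Fintype.card_perm, ← Finset.card_univ (α := Equiv.Perm c)]
  refine sum _ fun τ _ => ?_
  have hτ : SparseBound (∏ i, A (τ i) i) (M ^ Fintype.card c) (Fintype.card c * Δ) :=
    prod Finset.univ fun i _ => h (τ i) i
  rcases Int.units_eq_one_or (Equiv.Perm.sign τ) with h1 | h1 <;> rw [h1]
  · simpa using hτ
  · simpa using hτ.neg

theorem mul_natCast {p : MvPolynomial σ F} {M Δ : ℕ} (h : SparseBound p M Δ) (k : ℕ) :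
    SparseBound (p * (k : MvPolynomial σ F)) M Δ := by
  have hk : SparseBound ((k : MvPolynomial σ F)) 1 0 := by
    refine ⟨?_, fun i => ?_⟩
    · rw [← map_natCast (C : F →+* MvPolynomial σ F), ← monomial_zero']
      exact (Finset.card_le_card support_monomial_subset).trans (by simp)
    · rw [← map_natCast (C : F →+* MvPolynomial σ F), degreeOf_C]
  simpa using h.mul hk

theorem rename_injective {τ : Type*} {p : MvPolynomial σ F} {M Δ : ℕ} (h : SparseBound p M Δ)
    {ε : σ → τ} (hε : Function.Injective ε) : SparseBound (rename ε p) M Δ := by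
  classical
  refine ⟨?_, fun i => ?_⟩
  · rw [support_rename_of_injective hε]; exact Finset.card_image_le.trans h.1
  · by_cases hi : i ∈ Set.range ε
    · obtain ⟨j, rfl⟩ := hi
      rw [degreeOf_rename_of_injective hε]; exact h.2 j
    · rw [degreeOf_eq_sup]
      refine Finset.sup_le fun m hm => ?_
      rw [support_rename_of_injective hε, Finset.mem_image] at hm
      obtain ⟨m', -, rfl⟩ := hm
      rw [Finsupp.mapDomain_of_notMem_range _ _ hi]; exact Nat.zero_le _

theorem coeff_optionEquivLeft {p : MvPolynomial (Option σ) F} {M Δ : ℕ} (h : SparseBound p M Δ)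
    (k : ℕ) : SparseBound ((optionEquivLeft F σ p).coeff k) M Δ := by
  classical
  refine ⟨le_trans ?_ h.1, fun i => ?_⟩
  · refine Finset.card_le_card_of_injOn (fun m => m.optionElim k) (fun m hm => ?_) ?_
    · exact (mem_support_coeff_optionEquivLeft F).1 hm
    · intro m _ m' _ hmm
      ext j
      simpa using DFunLike.congr_fun hmm (some j)
  · rw [degreeOf_eq_sup]
    refine Finset.sup_le fun m hm => ?_
    have := Finset.le_sup (f := fun m : Option σ →₀ ℕ => m (some i))
      ((mem_support_coeff_optionEquivLeft F).1 hm)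
    rw [← degreeOf_eq_sup] at this
    simpa using this.trans (h.2 (some i))

end SparseBound

section Isolate

variable [DecidableEq σ]

/-- View a multivariate polynomial as a polynomial in the variable `i` whose coefficients are
polynomials in the other variables. -/
noncomputable def isolate (F : Type*) [Field F] (i : σ) :
    MvPolynomial σ F ≃ₐ[F] Polynomial (MvPolynomial {j // j ≠ i} F) :=
  (renameEquiv F (Equiv.optionSubtypeNe i).symm).trans (optionEquivLeft F {j // j ≠ i})

theorem natDegree_isolate (i : σ) (p : MvPolynomial σ F) :
    (isolate F i p).natDegree = p.degreeOf i :=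
  (degreeOf_eq_natDegree i p).symm

theorem SparseBound.coeff_isolate {p : MvPolynomial σ F} {M Δ : ℕ} (h : SparseBound p M Δ) (i : σ)
    (k : ℕ) : SparseBound ((isolate F i p).coeff k) M Δ :=
  (h.rename_injective (Equiv.optionSubtypeNe i).symm.injective).coeff_optionEquivLeft k

variable {K : Type*} [Field K] [Algebra F K]

/-- The restriction of a polynomial to the line through `α` on which the coordinate with number `i`
varies. If there is no such coordinate, this is the constant value at `α`. -/
noncomputable def lineRestrict {n : ℕ} (α : Fin n → K) (i : ℕ) :
    MvPolynomial (Fin n) F →ₐ[F] Polynomial K :=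
  aeval fun j => if (j : ℕ) = i then Polynomial.X else Polynomial.C (α j)

theorem eval_lineRestrict {n : ℕ} (α : Fin n → K) (i : ℕ) (u : K) (p : MvPolynomial (Fin n) F) :
    (lineRestrict α i p).eval u = aeval (fun j : Fin n => if (j : ℕ) = i then u else α j) p := by
  induction p using MvPolynomial.induction_on with
  | C a => simp [lineRestrict, Polynomial.algebraMap_apply]
  | add p q hp hq => simp only [map_add, Polynomial.eval_add, hp, hq]
  | mul_X p j hp =>
    rw [map_mul, map_mul, Polynomial.eval_mul, hp]
    congr 1
    simp only [lineRestrict, aeval_X]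
    split_ifs <;> simp

theorem map_isolate {n : ℕ} (α : Fin n → K) (i : Fin n) (p : MvPolynomial (Fin n) F) :
    (isolate F i p).map (aeval fun j : {j // j ≠ i} => α j).toRingHom = lineRestrict α i p := by
  induction p using MvPolynomial.induction_on with
  | C a =>
    simp [isolate, lineRestrict, optionEquivLeft_C, Polynomial.algebraMap_apply]
  | add p q hp hq => simp only [map_add, Polynomial.map_add, hp, hq]
  | mul_X p j hp =>
    rw [map_mul, map_mul, Polynomial.map_mul, hp]
    congr 1
    by_cases hj : j = i
    · subst hj
      simp [isolate, lineRestrict, optionEquivLeft_X_none]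
    · have hj' : (j : ℕ) ≠ i := fun h => hj (Fin.ext h)
      simp [isolate, lineRestrict, hj', Equiv.optionSubtypeNe_symm_of_ne hj,
        optionEquivLeft_X_some]

end Isolate

end MvPolynomial

/-! ### Families of polynomials whose non-roots witness non-divisibility -/

namespace MvPolynomial

variable {F : Type*} [Field F]

theorem sparseBound_combMatrix {τ : Type*} {A B : Polynomial (MvPolynomial τ F)} {S Δ : ℕ}
    (hA : ∀ k, SparseBound (A.coeff k) S Δ) (hB : ∀ k, SparseBound (B.coeff k) S Δ) {p q N : ℕ}
    (k : Fin N) (j : Fin p ⊕ Fin q) : SparseBound (Polynomial.combMatrix A B p q N k j) S Δ := by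
  rcases j with j | j <;> simp only [Polynomial.combMatrix, Sum.elim_inl, Sum.elim_inr,
    Polynomial.coeff_X_pow_mul'] <;> split_ifs
  exacts [hA _, .zero _ _, hB _, .zero _ _]

/-- For polynomials `A`, `B` with sparse coefficients there is a sparse nonzero polynomial whose
nonvanishing under a specialization guarantees, together with that of the leading coefficient of
`A`, that the cofactors of `gcd(A, B)` do not acquire a common root. -/
theorem exists_sparse_certificate {τ : Type*} (E : Type*) [Field E]
    {A B : Polynomial (MvPolynomial τ F)} (hA0 : A ≠ 0) {Y S Δ : ℕ} (hS : 1 ≤ S)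
    (hAd : A.natDegree ≤ 2 * Y) (hBd : B.natDegree ≤ 2 * Y)
    (hA : ∀ k, SparseBound (A.coeff k) S Δ) (hB : ∀ k, SparseBound (B.coeff k) S Δ) :
    ∃ R : MvPolynomial τ F, R ≠ 0 ∧ SparseBound R ((4 * Y)! * S ^ (4 * Y)) (4 * Y * Δ) ∧
      ∃ G A₁ B₁, A = G * A₁ ∧ B = G * B₁ ∧ ∀ (ρ : MvPolynomial τ F →+* E) (β : E),
        ρ A.leadingCoeff ≠ 0 → ρ R ≠ 0 → A₁.eval₂ ρ β = 0 → B₁.eval₂ ρ β ≠ 0 := by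
  obtain ⟨A₁, B₁, G, hrel, hGA, hGB⟩ := UniqueFactorizationMonoid.exists_reduced_factors A hA0 B
  obtain ⟨e, he, hcert⟩ :=
    Polynomial.exists_minor_no_common_root (E := E) hA0 hGA.symm hGB.symm hrel
  refine ⟨_, he, ?_, G, A₁, B₁, hGA.symm, hGB.symm, hcert⟩
  have hG0 : G ≠ 0 := by rintro rfl; exact hA0 (by rw [← hGA, zero_mul])
  have hA1 : A₁.natDegree ≤ 2 * Y :=
    (Polynomial.natDegree_le_of_dvd ⟨G, by rw [← hGA, mul_comm]⟩ hA0).trans hAd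
  have hB1 : B₁.natDegree ≤ 2 * Y := by
    rcases eq_or_ne B₁ 0 with h | h
    · simp [h]
    · exact (Polynomial.natDegree_le_of_dvd ⟨G, by rw [← hGB, mul_comm]⟩
        (by rw [← hGB]; exact mul_ne_zero hG0 h)).trans hBd
  have hcard : Fintype.card (Fin B₁.natDegree ⊕ Fin A₁.natDegree) ≤ 4 * Y := by
    simp; omega
  exact (SparseBound.det fun i j => sparseBound_combMatrix hA hB (e i) j).mono
    (Nat.mul_le_mul (Nat.factorial_le hcard) (Nat.pow_le_pow_right hS hcard))
    (Nat.mul_le_mul_right _ hcard)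

theorem eq_zero_of_mem_support_of_degreeOf {σ : Type*} {p : MvPolynomial σ F}
    (h : ∀ i, p.degreeOf i = 0) {m : σ →₀ ℕ} (hm : m ∈ p.support) : m = 0 := by
  ext i
  have := Finset.le_sup (f := fun m : σ →₀ ℕ => m i) hm
  rw [← degreeOf_eq_sup, h i] at this
  exact Nat.le_zero.1 this

/-- The number of monomials of a polynomial of degree at most `d` in each variable is bounded by
a power of the given bound `s`, also if `d = 0`. -/
theorem SparseBound.max_pow {σ : Type*} {p : MvPolynomial σ F} {s d : ℕ} (h : SparseBound p s d)
    {z : ℕ} (hz : d ≤ z) : SparseBound p (max s 1 ^ z) d := by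
  refine ⟨?_, h.2⟩
  rcases Nat.eq_zero_or_pos z with rfl | hz0
  · rw [pow_zero]
    have h0 : ∀ i, p.degreeOf i = 0 := fun i => by have := h.2 i; omega
    refine Finset.card_le_one.2 fun m hm m' hm' => ?_
    rw [eq_zero_of_mem_support_of_degreeOf h0 hm, eq_zero_of_mem_support_of_degreeOf h0 hm']
  · exact h.1.trans ((le_max_left s 1).trans (Nat.le_self_pow hz0.ne' _))

/-- A family of at most `L` nonzero polynomials, with at most `M` monomials and degree at most `Δ`
in each variable, such that at each point where none of them vanishes, `f ∤ g` can be observed on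
a line in direction of one of the axes (or, if `i = n`, at the point itself). -/
def HasTestFamily (K : Type*) [Field K] [Algebra F K] {n : ℕ} (f g : MvPolynomial (Fin n) F)
    (L M Δ : ℕ) : Prop :=
  ∃ i ≤ n, ∃ (ι : Type) (_ : Fintype ι) (R : ι → MvPolynomial (Fin n) F), Fintype.card ι ≤ L ∧
    (∀ k, R k ≠ 0 ∧ SparseBound (R k) M Δ) ∧
    ∀ α : Fin n → K, (∀ k, aeval α (R k) ≠ 0) → ¬ lineRestrict α i f ∣ lineRestrict α i g

variable {K : Type*} [Field K] [Algebra F K] {n : ℕ}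

/-- The specialization of the coefficients of `isolate F i p` at a point, with values in an
algebraic closure. -/
noncomputable def closureEval (α : Fin n → K) (i : Fin n) :
    MvPolynomial {j // j ≠ i} F →+* AlgebraicClosure K :=
  (algebraMap K (AlgebraicClosure K)).comp (aeval fun j : {j // j ≠ i} => α j).toRingHom

theorem map_closureEval_isolate (α : Fin n → K) (i : Fin n) (p : MvPolynomial (Fin n) F) :
    (isolate F i p).map (closureEval α i) =
      (lineRestrict α i p).map (algebraMap K (AlgebraicClosure K)) := by
  rw [closureEval, ← Polynomial.map_map, map_isolate]

/-- Test families may be constructed after one variable has been isolated. -/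
theorem hasTestFamily_of_isolate {f g : MvPolynomial (Fin n) F} {L M Δ : ℕ} (i : Fin n)
    {ι : Type} [Fintype ι] (R : ι → MvPolynomial {j // j ≠ i} F) (hι : Fintype.card ι ≤ L)
    (hR : ∀ k, R k ≠ 0 ∧ SparseBound (R k) M Δ)
    (h : ∀ α : Fin n → K, (∀ k, closureEval α i (R k) ≠ 0) →
      ¬ (isolate F i f).map (closureEval α i) ∣ (isolate F i g).map (closureEval α i)) :
    HasTestFamily K f g L M Δ := by
  refine ⟨i, i.2.le, ι, inferInstance, fun k => rename Subtype.val (R k), hι, fun k =>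
    ⟨fun h0 => (hR k).1 ?_, (hR k).2.rename_injective Subtype.val_injective⟩, fun α hα hd => ?_⟩
  · exact rename_injective _ Subtype.val_injective (h0.trans (map_zero _).symm)
  · refine h α (fun k h0 => hα k ?_) ?_
    · rw [aeval_rename]
      simpa only [closureEval, RingHom.coe_comp, Function.comp_apply,
        map_eq_zero_iff _ (algebraMap K (AlgebraicClosure K)).injective] using! h0
    · rw [map_closureEval_isolate, map_closureEval_isolate]
      exact Polynomial.map_dvd _ hd

/-- Two polynomials with `f ∤ g` and `f ≠ 0` are told apart by a prime that involves a variable. -/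
theorem exists_prime_of_not_dvd {f g : MvPolynomial (Fin n) F} (hf : f ≠ 0) (hfg : ¬ f ∣ g) :
    ∃ (i : Fin n) (c f' g' h : Polynomial (MvPolynomial {j // j ≠ i} F)),
      isolate F i f = c * f' ∧ isolate F i g = c * g' ∧ Prime h ∧ 0 < h.natDegree ∧
      h ∣ f' ∧ ¬ h ∣ g' := by
  obtain ⟨f', g', c, hrel, hf', hg'⟩ := UniqueFactorizationMonoid.exists_reduced_factors f hf g
  have hf'0 : f' ≠ 0 := by rintro rfl; exact hf (by rw [← hf', mul_zero])
  have hu : ¬ IsUnit f' := fun hu => hfg (by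
    rw [← hf', ← hg']; exact mul_dvd_mul_left _ hu.dvd)
  obtain ⟨h, hirr, hhf⟩ := WfDvdMonoid.exists_irreducible_factor hu hf'0
  -- A polynomial in which no variable occurs is a unit or zero.
  obtain ⟨i, hi⟩ : ∃ i, 0 < degreeOf i h := by
    by_contra! hall
    have hC : h = C (coeff 0 h) := by
      ext m
      rw [coeff_C]
      split_ifs with hm
      · rw [hm]
      · by_contra h0
        exact hm (eq_zero_of_mem_support_of_degreeOf (fun i => Nat.le_zero.1 (hall i))
          (mem_support_iff.2 h0)).symm
    exact hirr.not_isUnit (by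
      rw [hC]
      refine IsUnit.map C (IsUnit.mk0 _ fun h0 => hirr.ne_zero (by rw [hC, h0, map_zero])))
  refine ⟨i, isolate F i c, isolate F i f', isolate F i g', isolate F i h, ?_, ?_, ?_, ?_, ?_, ?_⟩
  · rw [← hf', map_mul]
  · rw [← hg', map_mul]
  · exact (MulEquiv.prime_iff (isolate F i)).2 hirr.prime
  · rwa [natDegree_isolate]
  · exact map_dvd _ hhf
  · intro hd
    exact hirr.not_isUnit (hrel hhf ((map_dvd_iff (isolate F i)).1 hd))

end MvPolynomial

/-! ### Test families for the two classes of products -/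

namespace MvPolynomial

variable {F : Type*} [Field F] {K : Type*} [Field K] [Algebra F K] {n : ℕ}

theorem exists_root_of_leadingCoeff_ne_zero {D E : Type*} [CommRing D] [IsDomain D] [Field E]
    [IsAlgClosed E] {A h : Polynomial D} (hhA : h ∣ A) (hd : 0 < h.natDegree) (ρ : D →+* E)
    (hlc : ρ A.leadingCoeff ≠ 0) : ∃ β, h.eval₂ ρ β = 0 := by
  obtain ⟨z, rfl⟩ := hhA
  have h1 : ρ h.leadingCoeff ≠ 0 := fun h0 => hlc (by
    rw [Polynomial.leadingCoeff_mul, map_mul, h0, zero_mul])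
  have h2 := Polynomial.natDegree_map_of_leadingCoeff_ne_zero ρ h1
  obtain ⟨β, hβ⟩ := IsAlgClosed.exists_root (h.map ρ) (by
    intro h0
    have := Polynomial.natDegree_eq_zero_iff_degree_le_zero.2 h0.le
    omega)
  exact ⟨β, by rwa [Polynomial.IsRoot.def, Polynomial.eval_map] at hβ⟩

theorem map_ne_zero_of_leadingCoeff {D E : Type*} [CommRing D] [Field E] {A : Polynomial D}
    {ρ : D →+* E} (hlc : ρ A.leadingCoeff ≠ 0) : A.map ρ ≠ 0 := fun h0 => hlc (by
  rw [← Polynomial.leadingCoeff_map_of_leadingCoeff_ne_zero ρ hlc, h0,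
    Polynomial.leadingCoeff_zero])

theorem natCast_ne_zero_of_char {d k : ℕ} (h : ringChar F = 0 ∨ d < ringChar F) (hk : 0 < k)
    (hkd : k ≤ d) : (k : F) ≠ 0 := by
  intro h0
  have hdvd := (ringChar.spec F k).1 h0
  rcases h with h | h
  · rw [h, zero_dvd_iff] at hdvd; omega
  · have := Nat.le_of_dvd hk hdvd; omega

theorem natCast_ne_zero_mvPolynomial {τ : Type*} {k : ℕ} (h : (k : F) ≠ 0) :
    (k : MvPolynomial τ F) ≠ 0 := by
  rw [← map_natCast (C : F →+* MvPolynomial τ F)]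
  exact fun h0 => h (C_injective _ _ (h0.trans (map_zero _).symm))

/-- Test families for products of factors of sparse polynomials in large characteristic. -/
theorem hasTestFamily_of_factors {s d l : ℕ} (hchar : ringChar F = 0 ∨ 2 * d < ringChar F)
    {f g : MvPolynomial (Fin n) F} (hf : IsProductOf (SparsePolyFactors F n s d) l f)
    (hg : IsProductOf (SparsePolyFactors F n s d) l g) (hfg : ¬ f ∣ g) :
    HasTestFamily K f g (2 * l) ((4 * d)! * max s 1 ^ (8 * d)) (8 * d ^ 2) := by
  obtain ⟨f₁, hf₁, hfprod⟩ := hf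
  obtain ⟨g₁, hg₁, hgprod⟩ := hg
  choose P hP hP0 hfP using hf₁
  choose Q hQ hQ0 hgQ using hg₁
  have hf0 : f ≠ 0 := by
    rw [hfprod]
    exact Finset.prod_ne_zero_iff.2 fun i _ h0 => hP0 i (zero_dvd_iff.1 (h0 ▸ hfP i))
  obtain ⟨x, c, f', g', h, hf', hg', hh, hhd, hhf, hhg⟩ := exists_prime_of_not_dvd hf0 hfg
  obtain ⟨i₀, hi₀⟩ : ∃ i, h ∣ isolate F x (P i) := by
    have h1 : h ∣ ∏ i, isolate F x (f₁ i) := by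
      rw [← map_prod, ← hfprod, hf']; exact dvd_mul_of_dvd_right hhf _
    obtain ⟨i, -, hi⟩ := hh.exists_mem_finset_dvd h1
    exact ⟨i, hi.trans (map_dvd _ (hfP i))⟩
  -- The product `P i₀ * Q j` contains `h` and the primes of the `j`-th factor of `g`, so that its
  -- certificate keeps their roots apart.
  have hsparse : ∀ j, SparseBound (P i₀ * Q j) (max s 1 ^ 2) (2 * d) := fun j => by
    have h1 : SparseBound (P i₀) (max s 1) d := SparseBound.mono (hP i₀) (le_max_left _ _) le_rfl
    have h2 : SparseBound (Q j) (max s 1) d := SparseBound.mono (hQ j) (le_max_left _ _) le_rfl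
    simpa [sq, two_mul] using h1.mul h2
  set A := fun j => isolate F x (P i₀ * Q j) with hA
  have hA0 : ∀ j, A j ≠ 0 := fun j => by
    rw [hA, Ne, EmbeddingLike.map_eq_zero_iff]; exact mul_ne_zero (hP0 _) (hQ0 _)
  have hAd : ∀ j, (A j).natDegree ≤ 2 * d := fun j => by
    rw [hA, natDegree_isolate]; exact (hsparse j).2 x
  have hd0 : 0 < d := by
    have h1 := (Polynomial.natDegree_le_of_dvd hi₀ (by
      rw [Ne, EmbeddingLike.map_eq_zero_iff]; exact hP0 _))
    rw [natDegree_isolate] at h1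
    have := (hP i₀).2 x
    omega
  have hS : 1 ≤ max s 1 ^ 2 := Nat.one_le_pow _ _ (by simp)
  have hcert := fun j => exists_sparse_certificate (AlgebraicClosure K) (hA0 j) (Y := d)
    (S := max s 1 ^ 2) (Δ := 2 * d) hS (hAd j) ((Polynomial.natDegree_derivative_le _).trans
      ((Nat.sub_le _ _).trans (hAd j))) (fun k => (hsparse j).coeff_isolate x k)
    (fun k => by
      rw [Polynomial.coeff_derivative]
      exact_mod_cast ((hsparse j).coeff_isolate x (k + 1)).mul_natCast (k + 1))
  choose R hR0 hR G A₁ B₁ hGA hGB hno using hcert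
  have hpow : (max s 1 ^ 2) ^ (4 * d) = max s 1 ^ (8 * d) := by rw [← pow_mul]; congr 1; ring
  have hΔ : 4 * d * (2 * d) = 8 * d ^ 2 := by ring
  rw [hpow, hΔ] at hR
  refine hasTestFamily_of_isolate x (ι := Fin l ⊕ Fin l)
    (Sum.elim (fun j => (A j).leadingCoeff) R) (by simp; omega) ?_ ?_
  · rintro (j | j)
    · refine ⟨Polynomial.leadingCoeff_ne_zero.2 (hA0 j),
        ((hsparse j).coeff_isolate x _).mono ?_ (by nlinarith)⟩
      exact (Nat.pow_le_pow_right (by simp) (by omega)).trans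
        (Nat.le_mul_of_pos_left _ (Nat.factorial_pos _))
    · exact ⟨hR0 j, hR j⟩
  · intro α hα
    set ρ := closureEval (F := F) α x with hρ
    have hlc : ∀ j, ρ (A j).leadingCoeff ≠ 0 := fun j => hα (.inl j)
    have hdet : ∀ j, ρ (R j) ≠ 0 := fun j => hα (.inr j)
    obtain ⟨β, hβ⟩ := exists_root_of_leadingCoeff_ne_zero (A := A i₀)
      (by rw [hA]; simp only [map_mul]; exact dvd_mul_of_dvd_left hi₀ _) hhd ρ (hlc i₀)
    refine Polynomial.not_map_dvd_of_separated hf' hg' hhf hhg hβ ?_ ?_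
    · rw [hgprod, map_prod, Polynomial.map_prod]
      refine Finset.prod_ne_zero_iff.2 fun j _ h0 => map_ne_zero_of_leadingCoeff (hlc j) ?_
      have h1 := Polynomial.map_dvd ρ (map_dvd (isolate F x) (hgQ j))
      rw [h0, zero_dvd_iff] at h1
      rw [hA]; simp only [map_mul, Polynomial.map_mul]; rw [h1, mul_zero]
    · intro q hq hqg hhq
      rw [hgprod, map_prod] at hqg
      obtain ⟨j, -, hj⟩ := hq.exists_mem_finset_dvd hqg
      refine Polynomial.primes_no_common_root (A := A j) (fun k hk hk' =>
        natCast_ne_zero_mvPolynomial (natCast_ne_zero_of_char hchar hk (hk'.trans (hAd j))))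
        (hGA j) (hGB j) hh hq hhq ?_ ?_ (hlc j) (hno j ρ β (hlc j) (hdet j)) hβ
      · rw [hA]; simp only [map_mul]; exact dvd_mul_of_dvd_left hi₀ _
      · rw [hA]; simp only [map_mul]
        exact dvd_mul_of_dvd_right (hj.trans (map_dvd _ (hgQ j))) _

/-- Test families for products of sparse polynomials in arbitrary characteristic. -/
theorem hasTestFamily_of_sparse {s d l : ℕ}
    {f g : MvPolynomial (Fin n) F} (hf : IsProductOf (SparsePoly F n s d) l f)
    (hg : IsProductOf (SparsePoly F n s d) l g) (hfg : ¬ f ∣ g) :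
    HasTestFamily K f g (2 * l + (2 * l) ^ 2 * (2 * d + 1) ^ 2)
      ((4 * d ^ 2)! * max s 1 ^ (8 * d ^ 3)) (8 * (d ^ 2) ^ 2) := by
  obtain ⟨P, hP, hfprod⟩ := hf
  obtain ⟨Q, hQ, hgprod⟩ := hg
  have hg0 : g ≠ 0 := by rintro rfl; exact hfg (dvd_zero _)
  have hQ0 : ∀ j, Q j ≠ 0 := fun j => by
    rw [hgprod] at hg0; exact Finset.prod_ne_zero_iff.1 hg0 j (Finset.mem_univ j)
  rcases eq_or_ne f 0 with hf0 | hf0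
  -- For `f = 0`, any point with `g ≠ 0` shows `f ∤ g`.
  · refine ⟨n, le_rfl, Fin l, inferInstance, Q, by simp; omega, fun k => ⟨hQ0 k, ?_⟩, ?_⟩
    · refine (SparseBound.max_pow (hQ k) (z := 8 * d ^ 3) ?_).mono
        (Nat.le_mul_of_pos_left _ (Nat.factorial_pos _)) ?_
      · nlinarith [Nat.le_self_pow (n := 3) (by norm_num) d]
      · rw [← pow_mul]; nlinarith [Nat.le_self_pow (n := 2 * 2) (by norm_num) d]
    · intro α hα hd
      rw [hf0, map_zero, zero_dvd_iff, hgprod, map_prod, Finset.prod_eq_zero_iff] at hd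
      obtain ⟨j, -, hj⟩ := hd
      apply hα j
      have h1 := congrArg (Polynomial.eval 0) hj
      rw [eval_lineRestrict, Polynomial.eval_zero] at h1
      simpa [fun j : Fin n => j.2.ne] using h1
  have hP0 : ∀ j, P j ≠ 0 := fun j => by
    rw [hfprod] at hf0; exact Finset.prod_ne_zero_iff.1 hf0 j (Finset.mem_univ j)
  obtain ⟨x, c, f', g', h, hf', hg', hh, hhd, hhf, hhg⟩ := exists_prime_of_not_dvd hf0 hfg
  have hcf : c * f' ≠ 0 := by
    rw [← hf', Ne, EmbeddingLike.map_eq_zero_iff]; exact hf0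
  have hcg : c * g' ≠ 0 := by
    rw [← hg', Ne, EmbeddingLike.map_eq_zero_iff]; exact hg0
  set T : Fin l ⊕ Fin l → MvPolynomial (Fin n) F := Sum.elim P Q with hT
  have hT0 : ∀ k, T k ≠ 0 := by rintro (k | k); exacts [hP0 k, hQ0 k]
  have hTs : ∀ k, SparseBound (T k) (max s 1) d := by
    rintro (k | k)
    exacts [SparseBound.mono (hP k) (le_max_left _ _) le_rfl,
      SparseBound.mono (hQ k) (le_max_left _ _) le_rfl]
  have hI0 : ∀ k a, isolate F x (T k ^ a) ≠ 0 := fun k a => by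
    rw [Ne, EmbeddingLike.map_eq_zero_iff]; exact pow_ne_zero _ (hT0 k)
  have hpowS : ∀ k a, a ≤ 2 * d → SparseBound (T k ^ a) (max s 1 ^ (2 * d)) (2 * d ^ 2) :=
    fun k a ha => ((hTs k).pow a).mono (Nat.pow_le_pow_right (by simp) ha) (by nlinarith)
  have hId : ∀ k a, a ≤ 2 * d → (isolate F x (T k ^ a)).natDegree ≤ 2 * d ^ 2 :=
    fun k a ha => by rw [natDegree_isolate]; exact (hpowS k a ha).2 x
  have hle : ∀ a : Fin (2 * d + 1), (a : ℕ) ≤ 2 * d := fun a => Nat.lt_succ_iff.1 a.2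
  have hcert := fun (y : (Fin l ⊕ Fin l) × (Fin l ⊕ Fin l))
      (z : Fin (2 * d + 1) × Fin (2 * d + 1)) =>
    exists_sparse_certificate (AlgebraicClosure K) (hI0 y.1 z.1)
      (B := isolate F x (T y.2 ^ (z.2 : ℕ))) (Y := d ^ 2) (S := max s 1 ^ (2 * d))
      (Δ := 2 * d ^ 2) (Nat.one_le_pow _ _ (by simp))
      (hId _ _ (hle _)) (hId _ _ (hle _)) (fun k => (hpowS _ _ (hle _)).coeff_isolate x k)
      (fun k => (hpowS _ _ (hle _)).coeff_isolate x k)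
  choose R hR0 hR G A₁ B₁ hGA hGB hno using hcert
  have hpow : (max s 1 ^ (2 * d)) ^ (4 * d ^ 2) = max s 1 ^ (8 * d ^ 3) := by
    rw [← pow_mul]; congr 1; ring
  have hΔ : 4 * d ^ 2 * (2 * d ^ 2) = 8 * (d ^ 2) ^ 2 := by ring
  rw [hpow, hΔ] at hR
  obtain ⟨i₀, hi₀⟩ : ∃ i, h ∣ isolate F x (P i) := by
    have h1 : h ∣ ∏ i, isolate F x (P i) := by
      rw [← map_prod, ← hfprod, hf']; exact dvd_mul_of_dvd_right hhf _
    obtain ⟨i, -, hi⟩ := hh.exists_mem_finset_dvd h1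
    exact ⟨i, hi⟩
  have hd0 : 0 < d := by
    have h1 := (Polynomial.natDegree_le_of_dvd hi₀ (by
      rw [Ne, EmbeddingLike.map_eq_zero_iff]; exact hP0 _))
    rw [natDegree_isolate] at h1
    have := (hP i₀).2 x
    omega
  refine hasTestFamily_of_isolate x (ι := (Fin l ⊕ Fin l) ⊕
    ((Fin l ⊕ Fin l) × (Fin l ⊕ Fin l)) × (Fin (2 * d + 1) × Fin (2 * d + 1)))
    (Sum.elim (fun k => (isolate F x (T k)).leadingCoeff) fun y => R y.1 y.2) ?_ ?_ ?_
  · simp only [Fintype.card_sum, Fintype.card_prod, Fintype.card_fin]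
    apply le_of_eq; ring
  · rintro (k | k)
    · refine ⟨Polynomial.leadingCoeff_ne_zero.2 (by simpa using hI0 k 1),
        ((hTs k).coeff_isolate x _).mono ?_ ?_⟩
      · refine (Nat.le_self_pow (by positivity) _).trans
          (Nat.le_mul_of_pos_left _ (Nat.factorial_pos _))
      · rw [← pow_mul]; nlinarith [Nat.le_self_pow (n := 2 * 2) (by norm_num) d]
    · exact ⟨hR0 _ _, hR _ _⟩
  · intro α hα
    set ρ := closureEval (F := F) α x with hρ
    have hlc : ∀ k, ρ (isolate F x (T k)).leadingCoeff ≠ 0 := fun j => hα (.inl j)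
    have hdet : ∀ y z, ρ (R y z) ≠ 0 := fun y z => hα (.inr (y, z))
    obtain ⟨β, hβ⟩ := exists_root_of_leadingCoeff_ne_zero hi₀ hhd ρ (hlc (.inl i₀))
    rw [hfprod, hgprod, map_prod, map_prod]
    refine Polynomial.not_map_prod_dvd_of_powers (d := d) (h := h) (β := β) ?_ ?_ hh hhd ?_ ?_ ?_ hβ
      ?_ ?_ ?_
    · intro i; rw [natDegree_isolate]; exact (hP i).2 x
    · intro i; rw [natDegree_isolate]; exact (hQ i).2 x
    · intro i; rw [Ne, EmbeddingLike.map_eq_zero_iff]; exact hQ0 i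
    · intro i; rw [Ne, EmbeddingLike.map_eq_zero_iff]; exact hP0 i
    · rw [← map_prod, ← map_prod, ← hfprod, ← hgprod, hf', hg',
        multiplicity_mul hh (FiniteMultiplicity.of_prime_left hh hcf),
        multiplicity_mul hh (FiniteMultiplicity.of_prime_left hh hcg),
        multiplicity_eq_zero.2 hhg]
      exact Nat.add_lt_add_left (multiplicity_pos_of_dvd hhf) _
    · exact fun i => map_ne_zero_of_leadingCoeff (hlc (.inl i))
    · exact fun i => map_ne_zero_of_leadingCoeff (hlc (.inr i))
    · intro k k' a b ha hb hlt
      have hsum : ∀ k, Sum.elim (fun i => isolate F x (P i)) (fun i => isolate F x (Q i)) k =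
          isolate F x (T k) := by rintro (k | k) <;> rfl
      have hlcpow : ρ (isolate F x (T k ^ a)).leadingCoeff ≠ 0 := by
        rw [map_pow, Polynomial.leadingCoeff_pow, map_pow]; exact pow_ne_zero _ (hlc k)
      rw [hsum, hsum, ← map_pow, ← map_pow] at hlt ⊢
      let y := (⟨a, by omega⟩ : Fin (2 * d + 1))
      let z := (⟨b, by omega⟩ : Fin (2 * d + 1))
      exact Polynomial.multiplicity_root_le (hGA (k, k') (y, z)) (hGB (k, k') (y, z)) hh
        (hI0 _ _) hlt hlcpow (hno (k, k') (y, z) ρ β hlcpow (hdet _ _)) hβ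

end MvPolynomial

/-! ### Hitting sets for sparse polynomials -/

theorem Polynomial.exists_eval_ne_zero_of_injOn {K : Type*} [Field K] {U : Polynomial K}
    (hU : U ≠ 0) {e : ℕ → K} {s : Finset ℕ} (he : Set.InjOn e s) (hs : U.natDegree < s.card) :
    ∃ t ∈ s, U.eval (e t) ≠ 0 := by
  classical
  by_contra! h
  refine hU (Polynomial.eq_zero_of_natDegree_lt_card_of_eval_eq_zero' U (s.image e) ?_ ?_)
  · intro x hx
    obtain ⟨t, ht, rfl⟩ := Finset.mem_image.1 hx
    exact h t ht
  · rwa [Finset.card_image_of_injOn he]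

namespace MvPolynomial

variable {F : Type*} [Field F] {K : Type*} [Field K] [Algebra F K] {n : ℕ}

/-- The weight of a monomial under the substitution of `X ^ w j` for the variable `j`. -/
def expWeight (w : Fin n → ℕ) (m : Fin n →₀ ℕ) : ℕ := ∑ j, m j * w j

/-- The univariate polynomial that arises from the substitution of `X ^ w j` for the variable
`j`. -/
noncomputable def powSubst (K : Type*) [Field K] [Algebra F K] (w : Fin n → ℕ)
    (R : MvPolynomial (Fin n) F) : Polynomial K :=
  ∑ m ∈ R.support, Polynomial.C (algebraMap F K (R.coeff m)) * Polynomial.X ^ expWeight w m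

theorem eval_powSubst (w : Fin n → ℕ) (R : MvPolynomial (Fin n) F) (x : K) :
    (powSubst K w R).eval x = aeval (fun j => x ^ w j) R := by
  rw [aeval_def, eval₂_eq', powSubst, Polynomial.eval_finsetSum]
  refine Finset.sum_congr rfl fun m _ => ?_
  rw [Polynomial.eval_mul, Polynomial.eval_C, Polynomial.eval_pow, Polynomial.eval_X, expWeight,
    ← Finset.prod_pow_eq_pow_sum]
  congr 1
  exact Finset.prod_congr rfl fun j _ => by rw [← pow_mul, mul_comm]

theorem powSubst_ne_zero {w : Fin n → ℕ} {R : MvPolynomial (Fin n) F} {m₀ : Fin n →₀ ℕ}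
    (hm₀ : m₀ ∈ R.support) (h : ∀ m ∈ R.support, m ≠ m₀ → expWeight w m ≠ expWeight w m₀) :
    powSubst K w R ≠ 0 := by
  intro h0
  have h1 := congrArg (fun U => Polynomial.coeff U (expWeight w m₀)) h0
  simp only [powSubst, Polynomial.finsetSum_coeff, Polynomial.coeff_C_mul_X_pow,
    Polynomial.coeff_zero] at h1
  rw [Finset.sum_eq_single m₀ (fun m hm hne => if_neg fun heq => h m hm hne heq.symm)
    (fun hn => absurd hm₀ hn), if_pos rfl, map_eq_zero] at h1
  exact mem_support_iff.1 hm₀ h1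

theorem natDegree_powSubst_le {w : Fin n → ℕ} {R : MvPolynomial (Fin n) F} {Δ p : ℕ}
    (hR : ∀ i, R.degreeOf i ≤ Δ) (hw : ∀ j, w j ≤ p) :
    (powSubst K w R).natDegree ≤ n * (Δ * p) := by
  refine Polynomial.natDegree_sum_le_of_forall_le _ _ fun m hm =>
    (Polynomial.natDegree_C_mul_X_pow_le _ _).trans ?_
  calc expWeight w m ≤ ∑ _j : Fin n, Δ * p := Finset.sum_le_sum fun j _ => by
        refine Nat.mul_le_mul (le_trans ?_ (hR j)) (hw j)
        rw [degreeOf_eq_sup]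
        exact Finset.le_sup (f := fun m : Fin n →₀ ℕ => m j) hm
    _ = n * (Δ * p) := by simp

/-- Modulo a large prime `p`, two different exponent vectors have the same weight for at most `n`
of the weight systems `j ↦ k ^ τ j`. -/
theorem exists_roots_of_weight_collision {p : ℕ} [Fact p.Prime] {τ : Fin n → ℕ}
    (hτ : Function.Injective τ) (hτn : ∀ j, τ j < n) {m m₀ : Fin n →₀ ℕ} (hne : m ≠ m₀)
    (hm : ∀ j, m j < p) (hm₀ : ∀ j, m₀ j < p) :
    ∃ s : Finset (ZMod p), s.card ≤ n ∧ ∀ k : ZMod p,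
      expWeight (fun j => k.val ^ τ j % p) m = expWeight (fun j => k.val ^ τ j % p) m₀ → k ∈ s := by
  classical
  set c : Polynomial (ZMod p) :=
    ∑ j, Polynomial.C ((m j : ZMod p) - m₀ j) * Polynomial.X ^ τ j with hc
  have hc0 : c ≠ 0 := by
    intro h0
    apply hne
    ext j
    have h1 := congrArg (fun U => Polynomial.coeff U (τ j)) h0
    simp only [hc, Polynomial.finsetSum_coeff, Polynomial.coeff_C_mul_X_pow,
      Polynomial.coeff_zero] at h1
    rw [Finset.sum_eq_single j (fun i _ hij => if_neg fun h => hij (hτ h).symm)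
      (fun hn => absurd (Finset.mem_univ j) hn), if_pos rfl, sub_eq_zero,
      ZMod.natCast_eq_natCast_iff'] at h1
    rwa [Nat.mod_eq_of_lt (hm j), Nat.mod_eq_of_lt (hm₀ j)] at h1
  have hdeg : c.natDegree ≤ n := Polynomial.natDegree_sum_le_of_forall_le _ _ fun j _ =>
    (Polynomial.natDegree_C_mul_X_pow_le _ _).trans (hτn j).le
  refine ⟨c.roots.toFinset, (Multiset.toFinset_card_le _).trans
    ((Polynomial.card_roots' c).trans hdeg), fun k hk => ?_⟩
  rw [Multiset.mem_toFinset, Polynomial.mem_roots hc0, Polynomial.IsRoot.def, hc,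
    Polynomial.eval_finsetSum]
  have h1 := congrArg (Nat.cast : ℕ → ZMod p) hk
  simp only [expWeight, Nat.cast_sum, Nat.cast_mul, ZMod.natCast_mod, Nat.cast_pow,
    ZMod.natCast_zmod_val] at h1
  simp only [Polynomial.eval_mul, Polynomial.eval_C, Polynomial.eval_pow, Polynomial.eval_X,
    sub_mul, Finset.sum_sub_distrib, h1, sub_self]

/-- A hitting set for sparse polynomials (Klivans and Spielman): some point of the form
`j ↦ x ^ (k ^ τ j mod p)`, with `p`, `k` and the number of `x` polynomially bounded, is a common
non-root of the given nonzero sparse polynomials. -/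
theorem exists_common_nonroot {ι : Type*} [Fintype ι] {R : ι → MvPolynomial (Fin n) F}
    {L M Δ : ℕ} (hι : Fintype.card ι ≤ L) (hR : ∀ k, R k ≠ 0 ∧ SparseBound (R k) M Δ)
    {τ : Fin n → ℕ} (hτ : Function.Injective τ) (hτn : ∀ j, τ j < n) {N : ℕ}
    (hN : L * n * Δ * (2 * (L * M * n + Δ + 1)) + 2 * (L * M * n + Δ + 1) < N) {e : ℕ → K}
    (he : Set.InjOn e (Set.Iic N)) :
    ∃ p k t, p.Prime ∧ p ≤ N ∧ 0 < k ∧ k < p ∧ 0 < t ∧ t ≤ N ∧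
      ∀ i, aeval (fun j => e t ^ (k ^ τ j % p)) (R i) ≠ 0 := by
  classical
  obtain ⟨p, hp, hlt, hle⟩ := Nat.exists_prime_lt_and_le_two_mul (L * M * n + Δ + 1) (by omega)
  have : Fact p.Prime := ⟨hp⟩
  choose m₀ hm₀ using fun i => support_nonempty.2 (hR i).1
  have hmp : ∀ i, ∀ m ∈ (R i).support, ∀ j, m j < p := fun i m hm j => by
    have h1 := Finset.le_sup (f := fun m : Fin n →₀ ℕ => m j) hm
    rw [← degreeOf_eq_sup] at h1
    have := h1.trans ((hR i).2.2 j)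
    omega
  choose! s hs hs' using fun (y : ι × (Fin n →₀ ℕ))
    (hy : y.2 ≠ m₀ y.1 ∧ y.2 ∈ (R y.1).support) =>
    exists_roots_of_weight_collision (p := p) hτ hτn hy.1 (hmp _ _ hy.2) (hmp _ _ (hm₀ y.1))
  -- Exclude the `k` for which a monomial of some `R i` gets the weight of the chosen one `m₀ i`.
  set bad : Finset (ZMod p) := insert 0 (Finset.univ.biUnion fun i =>
    ((R i).support.erase (m₀ i)).biUnion fun m => s (i, m)) with hbad
  have hcard : bad.card ≤ L * M * n + 1 := by
    refine (Finset.card_insert_le _ _).trans (Nat.add_le_add_right ?_ 1)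
    refine (Finset.card_biUnion_le_card_mul _ _ (M * n) fun i _ => ?_).trans ?_
    · refine (Finset.card_biUnion_le_card_mul _ _ n fun m hm => ?_).trans
        (Nat.mul_le_mul_right _ ((Finset.card_erase_le).trans (hR i).2.1))
      rw [Finset.mem_erase] at hm
      exact hs (i, m) hm
    · rw [Finset.card_univ, mul_assoc]
      exact Nat.mul_le_mul_right _ hι
  obtain ⟨k, hk⟩ : ∃ k, k ∉ bad := by
    by_contra! hall
    have h1 : Fintype.card (ZMod p) ≤ bad.card := by
      rw [← Finset.card_univ]; exact Finset.card_le_card fun x _ => hall x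
    rw [ZMod.card] at h1
    omega
  rw [hbad, Finset.mem_insert, not_or] at hk
  set w : Fin n → ℕ := fun j => k.val ^ τ j % p with hw
  have hU0 : ∀ i, powSubst K w (R i) ≠ 0 := fun i =>
    powSubst_ne_zero (hm₀ i) fun m hm hne heq => hk.2 (by
      refine Finset.mem_biUnion.2 ⟨i, Finset.mem_univ i, Finset.mem_biUnion.2
        ⟨m, Finset.mem_erase.2 ⟨hne, hm⟩, hs' (i, m) ⟨hne, hm⟩ k heq⟩⟩)
  have hU : ∏ i, powSubst K w (R i) ≠ 0 := Finset.prod_ne_zero_iff.2 fun i _ => hU0 i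
  have hdeg : (∏ i, powSubst K w (R i)).natDegree ≤ L * n * Δ * p := by
    refine (Polynomial.natDegree_prod_le _ _).trans ?_
    calc ∑ i, (powSubst K w (R i)).natDegree ≤ ∑ _i : ι, n * (Δ * p) :=
          Finset.sum_le_sum fun i _ => natDegree_powSubst_le (hR i).2.2
            fun j => (Nat.mod_lt _ hp.pos).le
      _ = Fintype.card ι * (n * (Δ * p)) := by simp
      _ ≤ L * (n * (Δ * p)) := Nat.mul_le_mul_right _ hι
      _ = L * n * Δ * p := by ring
  have hp2 : L * n * Δ * p ≤ L * n * Δ * (2 * (L * M * n + Δ + 1)) := Nat.mul_le_mul_left _ hle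
  obtain ⟨t, ht, hne⟩ := Polynomial.exists_eval_ne_zero_of_injOn hU (e := e) (s := Finset.Icc 1 N)
    (he.mono fun t ht => (Finset.mem_Icc.1 ht).2) (by rw [Nat.card_Icc]; omega)
  rw [Finset.mem_Icc] at ht
  refine ⟨p, k.val, t, hp, by omega, Nat.pos_of_ne_zero fun h => hk.1 ((ZMod.val_eq_zero k).1 h),
    ZMod.val_lt k, ht.1, ht.2, fun i => ?_⟩
  rw [Polynomial.eval_prod, Finset.prod_ne_zero_iff] at hne
  rw [← eval_powSubst]
  exact hne i (Finset.mem_univ i)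

end MvPolynomial

/-! ### Univariate divisibility testing by interpolation -/

namespace Polynomial

variable {K : Type*} [Field K]

open Classical in
/-- The value at `x` of the interpolation polynomial through the nodes `e (c + 1), …, e (c + D)`
with the values `a (c + 1), …, a (c + D)`. -/
noncomputable def interpValue (e : ℕ → K) (D c : ℕ) (a : ℕ → K) (x : K) : K :=
  ∑ j ∈ Finset.Icc 1 D, a (c + j) * ∏ m ∈ Finset.Icc 1 D,
    if e (c + j) - e (c + m) = 0 then 1 else (x - e (c + m)) / (e (c + j) - e (c + m))

/-- The divisibility test with the functions `a` and `b` at the point `e u`: a zero of `a` has to be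
a zero of `b`, and at other points `b` has to agree with `a` times the interpolation of `b / a`,
unless `a` vanishes at one of the interpolation nodes. -/
def PassesAt (e : ℕ → K) (D : ℕ) (a b : K → K) (c u : ℕ) : Prop :=
  (a (e u) = 0 → b (e u) = 0) ∧ (a (e u) ≠ 0 →
    (interpValue e D c (fun j => b (e j) / a (e j)) (e u) * a (e u) - b (e u)) *
      ∏ j ∈ Finset.Icc 1 D, a (e (c + j)) = 0)

theorem eval_interpolate_shift {e : ℕ → K} {D c : ℕ} (he : Set.InjOn e (Set.Iic (c + D)))
    (a : ℕ → K) (x : K) :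
    (Lagrange.interpolate (Finset.Icc 1 D) (fun j => e (c + j)) fun j => a (c + j)).eval x =
      interpValue e D c a x := by
  classical
  have hinj : ∀ i ∈ Finset.Icc 1 D, ∀ j ∈ Finset.Icc 1 D, e (c + i) - e (c + j) = 0 → i = j := by
    intro i hi j hj h
    rw [Finset.mem_Icc] at hi hj
    have := he (Set.mem_Iic.2 (by omega)) (Set.mem_Iic.2 (by omega)) (sub_eq_zero.1 h)
    omega
  rw [Lagrange.interpolate_apply, eval_finsetSum, interpValue]
  refine Finset.sum_congr rfl fun i hi => ?_
  rw [eval_mul, eval_C, Lagrange.basis, eval_prod, ← Finset.mul_prod_erase _ _ hi]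
  rw [sub_self, if_pos rfl, one_mul]
  congr 1
  refine Finset.prod_congr rfl fun j hj => ?_
  rw [Finset.mem_erase] at hj
  rw [if_neg fun h => hj.1 (hinj i hi j hj.2 h).symm]
  simp [Lagrange.basisDivisor, div_eq_mul_inv, mul_comm]

/-- If `f ∣ g`, all tests are passed, since the interpolation of `g / f` recovers the quotient. -/
theorem PassesAt.of_dvd {e : ℕ → K} {D c : ℕ} (he : Set.InjOn e (Set.Iic (c + D))) {f g : K[X]}
    (hfg : f ∣ g) (hg : g.natDegree < D) (u : ℕ) :
    PassesAt e D (fun x => f.eval x) (fun x => g.eval x) c u := by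
  classical
  obtain ⟨q, rfl⟩ := hfg
  refine ⟨fun h => by simp [h], fun h => ?_⟩
  by_cases hprod : ∏ j ∈ Finset.Icc 1 D, f.eval (e (c + j)) = 0
  · rw [hprod, mul_zero]
  have hne := Finset.prod_ne_zero_iff.1 hprod
  have hf0 : f ≠ 0 := by rintro rfl; simp at h
  have hq : q.degree < (Finset.Icc 1 D).card := by
    rcases eq_or_ne q 0 with rfl | hq0
    · rw [degree_zero]; exact WithBot.bot_lt_coe _
    · rw [natDegree_mul hf0 hq0] at hg
      rw [degree_eq_natDegree hq0, Nat.card_Icc]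
      exact_mod_cast (by omega)
  have hinj : Set.InjOn (fun j => e (c + j)) (Finset.Icc 1 D) := by
    intro i hi j hj h
    rw [Finset.mem_coe, Finset.mem_Icc] at hi hj
    have := he (Set.mem_Iic.2 (by omega)) (Set.mem_Iic.2 (by omega)) h
    omega
  have hQ := Lagrange.eq_interpolate_of_eval_eq
    (fun j => (f * q).eval (e (c + j)) / f.eval (e (c + j))) hinj hq fun j hj => by
      rw [eval_mul, mul_div_cancel_left₀ _ (hne j hj)]
  rw [← eval_interpolate_shift he (fun j => (f * q).eval (e j) / f.eval (e j)), ← hQ]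
  simp only [eval_mul]
  ring

/-- Some window of `D` consecutive nodes avoids the roots of a polynomial of small degree. -/
theorem exists_window_of_natDegree_le {e : ℕ → K} {D d N : ℕ} {f : K[X]} (hf : f ≠ 0)
    (hfd : f.natDegree ≤ d) (hD : 0 < D) (hN : d * D + 1 ≤ N)
    (he : Set.InjOn e (Set.Iic (N + D))) :
    ∃ c, 1 ≤ c ∧ c ≤ N ∧ ∀ j ∈ Finset.Icc 1 D, f.eval (e (c + j)) ≠ 0 := by
  classical
  by_contra! hall
  have hr : ∀ r ∈ Finset.range (d + 1), r * D + 1 ≤ N := fun r hr => by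
    rw [Finset.mem_range] at hr
    have := Nat.mul_le_mul_right D (Nat.lt_succ_iff.1 hr)
    omega
  -- Otherwise `d + 1` disjoint windows contain a root each.
  choose! j hj hj0 using fun r (h : r ∈ Finset.range (d + 1)) =>
    hall (r * D + 1) (by omega) (hr r h)
  have hinj : Set.InjOn (fun r => r * D + 1 + j r) (Finset.range (d + 1)) := by
    intro r h r' h' heq
    have h1 := Finset.mem_Icc.1 (hj r h)
    have h2 := Finset.mem_Icc.1 (hj r' h')
    have h3 : r * D + (j r - 1) = r' * D + (j r' - 1) := by
      simp only at heq; omega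
    have h4 := congrArg (· / D) h3
    simpa [Nat.add_div_of_dvd_right, Nat.mul_div_cancel _ hD, hD, Nat.mul_add_div,
      Nat.div_eq_of_lt (show j r - 1 < D by omega), Nat.div_eq_of_lt (show j r' - 1 < D by omega),
      mul_comm _ D] using h4
  obtain ⟨t, ht, hne⟩ := exists_eval_ne_zero_of_injOn hf (e := e)
    (s := (Finset.range (d + 1)).image fun r => r * D + 1 + j r) (he.mono fun t ht => by
      obtain ⟨r, hr', rfl⟩ := Finset.mem_image.1 ht
      have h1 := Finset.mem_Icc.1 (hj r hr')
      have h2 := hr r hr'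
      rw [Set.mem_Iic]; omega)
    (by rw [Finset.card_image_of_injOn hinj, Finset.card_range]; omega)
  obtain ⟨r, hr', rfl⟩ := Finset.mem_image.1 ht
  exact hne (hj0 r hr')

/-- If `f ∤ g`, some test fails: with nodes that avoid the roots of `f`, the interpolation `Q` of
`g / f` satisfies `Q * f ≠ g`, and a point where these differ is among sufficiently many. -/
theorem exists_not_passesAt {e : ℕ → K} {D d N : ℕ} {f g : K[X]} (hfg : ¬ f ∣ g)
    (hf : f.natDegree ≤ d) (hg : g.natDegree ≤ d) (hD : d < D) (hN : d * D + d + D + 1 ≤ N)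
    (he : Set.InjOn e (Set.Iic (N + D))) :
    ∃ c u, 1 ≤ c ∧ c ≤ N ∧ 1 ≤ u ∧ u ≤ N ∧
      ¬ PassesAt e D (fun x => f.eval x) (fun x => g.eval x) c u := by
  classical
  have hIcc : Set.InjOn e (Finset.Icc 1 N) := he.mono fun t ht => by
    have := (Finset.mem_Icc.1 ht).2
    rw [Set.mem_Iic]; omega
  rcases eq_or_ne f 0 with rfl | hf0
  · have hg0 : g ≠ 0 := fun h => hfg (h ▸ dvd_rfl)
    obtain ⟨u, hu, hne⟩ := exists_eval_ne_zero_of_injOn hg0 hIcc (by rw [Nat.card_Icc]; omega)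
    rw [Finset.mem_Icc] at hu
    exact ⟨1, u, le_rfl, by omega, hu.1, hu.2, fun h => hne (h.1 (by simp))⟩
  obtain ⟨c, hc1, hcN, hc⟩ := exists_window_of_natDegree_le hf0 hf (by omega) (by omega) he
  have hec : Set.InjOn e (Set.Iic (c + D)) := he.mono (Set.Iic_subset_Iic.2 (by omega))
  set Q := Lagrange.interpolate (Finset.Icc 1 D) (fun j => e (c + j))
    (fun j => g.eval (e (c + j)) / f.eval (e (c + j))) with hQ
  have hQd : Q.natDegree ≤ D := by
    refine natDegree_le_of_degree_le ((Lagrange.degree_interpolate_lt _ ?_).le.trans ?_)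
    · intro i hi j hj h
      rw [Finset.mem_coe, Finset.mem_Icc] at hi hj
      have := hec (Set.mem_Iic.2 (by omega)) (Set.mem_Iic.2 (by omega)) h
      omega
    · simp
  have hW : Q * f - g ≠ 0 := fun h => hfg ⟨Q, by rw [mul_comm]; exact (sub_eq_zero.1 h).symm⟩
  have hWd : (Q * f - g).natDegree < (Finset.Icc 1 N).card := by
    rw [Nat.card_Icc]
    refine (natDegree_sub_le _ _).trans_lt (max_lt (natDegree_mul_le.trans_lt ?_) ?_) <;> omega
  obtain ⟨u, hu, hne⟩ := exists_eval_ne_zero_of_injOn hW hIcc hWd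
  rw [Finset.mem_Icc] at hu
  refine ⟨c, u, hc1, hcN, hu.1, hu.2, fun h => ?_⟩
  rw [eval_sub, eval_mul] at hne
  by_cases hfu : f.eval (e u) = 0
  · have h1 : g.eval (e u) = 0 := h.1 hfu
    rw [hfu, h1] at hne; simp at hne
  · have h2 := h.2 hfu
    rw [← eval_interpolate_shift hec (fun j => g.eval (e j) / f.eval (e j))] at h2
    exact (mul_eq_zero.1 h2).elim hne (Finset.prod_ne_zero_iff.2 hc)

end Polynomial

/-! ### Total correctness of programs with time bounds

The programs below use the memory as follows. The integer cells `4` and `5` hold `1` and `0`, the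
cells `6`, `7` and `8` the range `N` of the loops, the number `D` of interpolation nodes and
`n + 1`, the cell `9` the verdict, the cells `10` to `15` the parameters of the current test, and
the cells `24` and `25` the numbers `40` and `41`. The other cells up to `31` are for intermediate
results. The point at which the blackboxes are queried is in the field cells from `41` on, and a
coordinate with the number `i`, counted from `1`, is replaced by writing to the field cell
`40 + i`. -/

namespace FieldRAM

variable {K : Type*}

@[simp] theorem Store.setNat_nat (σ : Store K) (a v b : ℕ) :
    (σ.setNat a v).nat b = if b = a then v else σ.nat b := by
  simp [Store.setNat, Function.update_apply]

@[simp] theorem Store.setNat_fld (σ : Store K) (a v : ℕ) : (σ.setNat a v).fld = σ.fld := rfl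

@[simp] theorem Store.setFld_nat (σ : Store K) (a : ℕ) (v : K) : (σ.setFld a v).nat = σ.nat := rfl

@[simp] theorem Store.setFld_fld (σ : Store K) (a : ℕ) (v : K) (b : ℕ) :
    (σ.setFld a v).fld b = if b = a then v else σ.fld b := by
  simp [Store.setFld, Function.update_apply]

variable [Field K] {n : ℕ}

/-- Total correctness with a time bound: started on `σ`, the program `p` halts within `T` steps with
a memory that satisfies `Q`. -/
def Halts (e : ℕ → K) (O : Bool → (Fin n → K) → K) (p : Prog) (σ : Store K) (T : ℕ)
    (Q : Store K → Prop) : Prop :=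
  ∃ t τ, t ≤ T ∧ Exec e O p σ t τ ∧ Q τ

/-- Straight-line code. -/
def block : List Instr → Prog
  | [] => .skip
  | i :: is => .seq (.instr i) (block is)

/-- `forDown a b p` executes `p` with the integer cell `a` counting from the value of cell `b` down
to `1`. It relies on the cells `4` and `5` holding `1` and `0`. -/
def forDown (a b : ℕ) (p : Prog) : Prog :=
  .seq (.instr (.natAdd a b 5)) (.loop a (.seq p (.instr (.natSub a a 4))))

/-- A syntactic guarantee that a program does not change the integer cell `a`. -/
def Prog.keepsNat (a : ℕ) : Prog → Bool
  | .skip => true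
  | .instr (.natConst b _) => a != b
  | .instr (.natAdd b _ _) => a != b
  | .instr (.natSub b _ _) => a != b
  | .instr (.natLoad b _) => a != b
  | .instr (.natStore _ _) => false
  | .instr _ => true
  | .seq p q => p.keepsNat a && q.keepsNat a
  | .natBranch _ p q => p.keepsNat a && q.keepsNat a
  | .fldBranch _ p q => p.keepsNat a && q.keepsNat a
  | .loop _ p => p.keepsNat a

/-- A syntactic guarantee that a program does not change the field cell `a`. -/
def Prog.keepsFld (a : ℕ) : Prog → Bool
  | .skip => true
  | .instr (.fldZero b) => a != b
  | .instr (.fldOne b) => a != b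
  | .instr (.fldElem b _) => a != b
  | .instr (.fldAdd b _ _) => a != b
  | .instr (.fldSub b _ _) => a != b
  | .instr (.fldMul b _ _) => a != b
  | .instr (.fldDiv b _ _) => a != b
  | .instr (.fldLoad b _) => a != b
  | .instr (.fldStore _ _) => false
  | .instr (.query _ b _) => a != b
  | .instr _ => true
  | .seq p q => p.keepsFld a && q.keepsFld a
  | .natBranch _ p q => p.keepsFld a && q.keepsFld a
  | .fldBranch _ p q => p.keepsFld a && q.keepsFld a
  | .loop _ p => p.keepsFld a

variable {e : ℕ → K} {O : Bool → (Fin n → K) → K}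

theorem Exec.nat_eq {p : Prog} {σ τ : Store K} {t : ℕ} (h : Exec e O p σ t τ) {a : ℕ}
    (ha : p.keepsNat a = true) : τ.nat a = σ.nat a := by
  induction h with
  | skip => rfl
  | instr i σ => cases i <;> simp_all [Prog.keepsNat, Instr.apply]
  | seq _ _ ih₁ ih₂ =>
    rw [Prog.keepsNat, Bool.and_eq_true] at ha
    rw [ih₂ ha.2, ih₁ ha.1]
  | natBranch_zero q h0 _ ih => rw [Prog.keepsNat, Bool.and_eq_true] at ha; exact ih ha.1
  | natBranch_ne q h0 _ ih => rw [Prog.keepsNat, Bool.and_eq_true] at ha; exact ih ha.2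
  | fldBranch_zero q h0 _ ih => rw [Prog.keepsNat, Bool.and_eq_true] at ha; exact ih ha.1
  | fldBranch_ne q h0 _ ih => rw [Prog.keepsNat, Bool.and_eq_true] at ha; exact ih ha.2
  | loop_done => rfl
  | loop_more _ _ _ ih₁ ih₂ =>
    rw [ih₂ ha]; exact ih₁ (by rwa [Prog.keepsNat] at ha)

theorem Exec.fld_eq {p : Prog} {σ τ : Store K} {t : ℕ} (h : Exec e O p σ t τ) {a : ℕ}
    (ha : p.keepsFld a = true) : τ.fld a = σ.fld a := by
  induction h with
  | skip => rfl
  | instr i σ => cases i <;> simp_all [Prog.keepsFld, Instr.apply]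
  | seq _ _ ih₁ ih₂ =>
    rw [Prog.keepsFld, Bool.and_eq_true] at ha
    rw [ih₂ ha.2, ih₁ ha.1]
  | natBranch_zero q h0 _ ih => rw [Prog.keepsFld, Bool.and_eq_true] at ha; exact ih ha.1
  | natBranch_ne q h0 _ ih => rw [Prog.keepsFld, Bool.and_eq_true] at ha; exact ih ha.2
  | fldBranch_zero q h0 _ ih => rw [Prog.keepsFld, Bool.and_eq_true] at ha; exact ih ha.1
  | fldBranch_ne q h0 _ ih => rw [Prog.keepsFld, Bool.and_eq_true] at ha; exact ih ha.2
  | loop_done => rfl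
  | loop_more _ _ _ ih₁ ih₂ =>
    rw [ih₂ ha]; exact ih₁ (by rwa [Prog.keepsFld] at ha)

namespace Halts

variable {p q : Prog} {σ : Store K} {T T' : ℕ} {Q Q' : Store K → Prop}

theorem mono (h : Halts e O p σ T Q) (hT : T ≤ T') (hQ : ∀ τ, Q τ → Q' τ) :
    Halts e O p σ T' Q' := by
  obtain ⟨t, τ, ht, hex, hτ⟩ := h
  exact ⟨t, τ, ht.trans hT, hex, hQ τ hτ⟩

theorem time_le (h : Halts e O p σ T Q) (hT : T ≤ T') : Halts e O p σ T' Q :=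
  h.mono hT fun _ => id

/-- The cells that a program does not touch may be used in its postcondition. -/
theorem frame (h : Halts e O p σ T Q)
    (hQ : ∀ τ, Q τ → (∀ a, p.keepsNat a = true → τ.nat a = σ.nat a) →
      (∀ a, p.keepsFld a = true → τ.fld a = σ.fld a) → Q' τ) : Halts e O p σ T Q' := by
  obtain ⟨t, τ, ht, hex, hτ⟩ := h
  exact ⟨t, τ, ht, hex, hQ τ hτ (fun _ => hex.nat_eq) (fun _ => hex.fld_eq)⟩

theorem seq (h : Halts e O p σ T fun σ' => Halts e O q σ' T' Q) :
    Halts e O (.seq p q) σ (T + T') Q := by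
  obtain ⟨t, σ', ht, hex, t', τ, ht', hex', hτ⟩ := h
  exact ⟨t + t', τ, add_le_add ht ht', .seq hex hex', hτ⟩

theorem skip (h : Q σ) : Halts e O .skip σ 1 Q := ⟨1, σ, le_rfl, .skip σ, h⟩

theorem instr {i : Instr} (h : Q (i.apply e O σ)) : Halts e O (.instr i) σ (i.cost n) Q :=
  ⟨_, _, le_rfl, .instr i σ, h⟩

theorem block {is : List Instr} (h : Q (is.foldl (Instr.apply e O) σ)) :
    Halts e O (block is) σ ((is.map (Instr.cost n)).sum + 1) Q := by
  induction is generalizing σ with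
  | nil => exact skip h
  | cons i is ih =>
    rw [List.map_cons, List.sum_cons, add_assoc]
    exact seq (instr (ih h))

theorem natBranch {a : ℕ} (h0 : σ.nat a = 0 → Halts e O p σ T Q)
    (h1 : σ.nat a ≠ 0 → Halts e O q σ T Q) : Halts e O (.natBranch a p q) σ (T + 1) Q := by
  by_cases h : σ.nat a = 0
  · obtain ⟨t, τ, ht, hex, hτ⟩ := h0 h
    exact ⟨t + 1, τ, by omega, .natBranch_zero q h hex, hτ⟩
  · obtain ⟨t, τ, ht, hex, hτ⟩ := h1 h
    exact ⟨t + 1, τ, by omega, .natBranch_ne p h hex, hτ⟩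

theorem fldBranch {a : ℕ} (h0 : σ.fld a = 0 → Halts e O p σ T Q)
    (h1 : σ.fld a ≠ 0 → Halts e O q σ T Q) : Halts e O (.fldBranch a p q) σ (T + 1) Q := by
  by_cases h : σ.fld a = 0
  · obtain ⟨t, τ, ht, hex, hτ⟩ := h0 h
    exact ⟨t + 1, τ, by omega, .fldBranch_zero q h hex, hτ⟩
  · obtain ⟨t, τ, ht, hex, hτ⟩ := h1 h
    exact ⟨t + 1, τ, by omega, .fldBranch_ne p h hex, hτ⟩

/-- The rule for counting loops, with an invariant `I j` that holds when the counter has the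
value `j`. -/
theorem forDown {a b v : ℕ} (I : ℕ → Store K → Prop) (hb : σ.nat b = v) (h5 : σ.nat 5 = 0)
    (hI : I v (σ.setNat a v))
    (hbody : ∀ j, 1 ≤ j → j ≤ v → ∀ σ', σ'.nat a = j → I j σ' →
      Halts e O p σ' T fun τ => τ.nat a = j ∧ τ.nat 4 = 1 ∧ I (j - 1) (τ.setNat a (j - 1))) :
    Halts e O (forDown a b p) σ (v * (T + 2) + 2) fun τ => τ.nat a = 0 ∧ I 0 τ := by
  have key : ∀ j, j ≤ v → ∀ σ', σ'.nat a = j → I j σ' →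
      Halts e O (.loop a (.seq p (.instr (.natSub a a 4)))) σ' (j * (T + 2) + 1)
        fun τ => τ.nat a = 0 ∧ I 0 τ := by
    intro j
    induction j with
    | zero =>
      intro _ σ' hσ' hI'
      exact ⟨1, σ', by omega, .loop_done _ hσ', hσ', hI'⟩
    | succ j ih =>
      intro hj σ' hσ' hI'
      obtain ⟨t, τ, ht, hex, hτa, hτ4, hIτ⟩ := hbody (j + 1) (by omega) hj σ' hσ' hI'
      have happ : (Instr.natSub a a 4).apply e O τ = τ.setNat a j := by
        simp [Instr.apply, hτa, hτ4]
      obtain ⟨t', τ', ht', hex', hτ'⟩ := ih (by omega) (τ.setNat a j) (by simp) hIτ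
      refine ⟨(t + 1) + t' + 1, τ', ?_, .loop_more (by omega) (.seq hex ?_) hex', hτ'⟩
      · nlinarith
      · rw [← happ]; exact .instr _ τ
  refine (seq (T := 1) (T' := v * (T + 2) + 1) ?_).time_le (by omega)
  refine ⟨1, _, le_rfl, .instr _ σ, ?_⟩
  have happ : (Instr.natAdd a b 5).apply e O σ = σ.setNat a v := by
    simp [Instr.apply, hb, h5]
  rw [happ]
  exact key v le_rfl _ (by simp) hI

/-- The counting loop with time bounds of the form `C * N ^ r`. -/
theorem forDown_pow {a b v N C r : ℕ} (I : ℕ → Store K → Prop) (hb : σ.nat b = v) (hN : 1 ≤ N)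
    (hv : v ≤ N) (h5 : σ.nat 5 = 0) (hI : I v (σ.setNat a v))
    (hbody : ∀ j, 1 ≤ j → j ≤ v → ∀ σ', σ'.nat a = j → I j σ' →
      Halts e O p σ' (C * N ^ r)
        fun τ => τ.nat a = j ∧ τ.nat 4 = 1 ∧ I (j - 1) (τ.setNat a (j - 1))) :
    Halts e O (FieldRAM.forDown a b p) σ ((C + 4) * N ^ (r + 1))
      fun τ => τ.nat a = 0 ∧ I 0 τ := by
  refine (forDown I hb h5 hI hbody).time_le ?_
  have h1 : 1 ≤ N ^ r := Nat.one_le_pow _ _ hN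
  calc v * (C * N ^ r + 2) + 2 ≤ N * (C * N ^ r + 2 * N ^ r) + 2 * (N ^ r * N) := by
        gcongr
        · omega
        · nlinarith
    _ = (C + 4) * N ^ (r + 1) := by ring

theorem seq_pow {N C C' r : ℕ} (h : Halts e O p σ (C * N ^ r) fun σ' =>
    Halts e O q σ' (C' * N ^ r) Q) : Halts e O (.seq p q) σ ((C + C') * N ^ r) Q := by
  rw [add_mul]; exact seq h

theorem raise {N C r : ℕ} (h : Halts e O p σ (C * N ^ r) Q) (hN : 1 ≤ N) {C' r' : ℕ} (hC : C ≤ C')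
    (hr : r ≤ r') : Halts e O p σ (C' * N ^ r') Q :=
  h.time_le (Nat.mul_le_mul hC (Nat.pow_le_pow_right hN hr))

end Halts

end FieldRAM

/-! ### Computation of the ranges of the tests -/

namespace FieldRAM

variable {K : Type*} [Field K] {n : ℕ} {e : ℕ → K} {O : Bool → (Fin n → K) → K}

/-- `N[a] := N[x] * N[y]`, with the loop counter `c`. -/
def mulProg (a x y c : ℕ) : Prog :=
  .seq (.instr (.natConst a 0)) (forDown c y (.instr (.natAdd a a x)))

theorem mulProg_halts {a x y c : ℕ} {σ : Store K} {N : ℕ} (h4 : σ.nat 4 = 1) (h5 : σ.nat 5 = 0)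
    (ha : a ≠ x ∧ a ≠ y ∧ a ≠ c ∧ a ≠ 4 ∧ a ≠ 5) (hc : c ≠ x ∧ c ≠ y ∧ c ≠ 4 ∧ c ≠ 5) (hN : 1 ≤ N)
    (hy : σ.nat y ≤ N) :
    Halts e O (mulProg a x y c) σ (6 * N ^ 1) fun τ => τ.nat a = σ.nat x * σ.nat y ∧
      ∀ b, b ≠ a → b ≠ c → τ.nat b = σ.nat b := by
  obtain ⟨hax, hay, hac, ha4, ha5⟩ := ha
  obtain ⟨hcx, hcy, hc4, hc5⟩ := hc
  refine (Halts.seq_pow (C := 1) (C' := 5) ?_)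
  refine ((Halts.instr (i := .natConst a 0) ?_).time_le (by simpa [Instr.cost] using hN))
  refine (Halts.forDown_pow (C := 1) (r := 0) (v := σ.nat y)
    (fun j τ => τ.nat a + σ.nat x * j = σ.nat x * σ.nat y ∧
      ∀ b, b ≠ a → b ≠ c → τ.nat b = σ.nat b) ?_ hN hy ?_ ?_ ?_).mono le_rfl ?_
  · simp [Instr.apply, hay.symm]
  · simp [Instr.apply, ha5.symm, h5]
  · simp only [Instr.apply, Store.setNat_nat, if_neg hac, if_true, zero_add, true_and]
    intro b hb hbc
    rw [if_neg hbc, if_neg hb]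
  · intro j hj1 hjv σ' hσ' ⟨hI, hfr⟩
    refine (Halts.instr ?_).time_le (by simp [Instr.cost])
    simp only [Instr.apply, Store.setNat_nat, if_neg hac.symm, if_neg ha4.symm, if_neg hac, if_true]
    refine ⟨hσ', by rw [hfr 4 ha4.symm hc4.symm, h4], ?_, fun b hb hbc => ?_⟩
    · rw [hfr x hax.symm hcx.symm, ← hI]
      obtain ⟨i, rfl⟩ := Nat.exists_eq_add_of_le' hj1
      simp; ring
    · rw [if_neg hbc, if_neg hb, hfr b hb hbc]
  · rintro τ ⟨-, hI, hfr⟩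
    exact ⟨by simpa using hI, hfr⟩

/-- `N[28] := N[26]!` -/
def factorialProg : Prog :=
  .seq (.instr (.natConst 28 1))
    (forDown 16 26 (.seq (mulProg 29 28 16 19) (.instr (.natAdd 28 29 5))))

theorem factorialProg_halts {σ : Store K} {N Y : ℕ} (h4 : σ.nat 4 = 1) (h5 : σ.nat 5 = 0)
    (hN : 1 ≤ N) (hY : σ.nat 26 = Y) (hYN : Y ≤ N) :
    Halts e O factorialProg σ (12 * N ^ 2) fun τ => τ.nat 28 = Y ! ∧
      ∀ a, factorialProg.keepsNat a = true → τ.nat a = σ.nat a := by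
  have hN2 : 1 ≤ N ^ 2 := Nat.one_le_pow _ _ hN
  refine Halts.frame (Q := fun τ => τ.nat 28 = Y !) ?_ fun τ h1 h2 _ => ⟨h1, h2⟩
  refine (Halts.seq_pow (C := 1) (C' := 11) ?_)
  refine ((Halts.instr ?_).time_le (by simpa [Instr.cost] using hN2))
  refine (Halts.forDown_pow (C := 7) (r := 1) (v := Y)
    (fun j τ => τ.nat 28 * j ! = Y ! ∧ τ.nat 4 = 1 ∧ τ.nat 5 = 0) ?_ hN hYN ?_ ?_ ?_).mono le_rfl ?_
  · simp [Instr.apply, hY]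
  · simp [Instr.apply, h5]
  · simp [Instr.apply, h4, h5]
  · intro j hj1 hjv σ' hσ' ⟨hI, h4', h5'⟩
    refine (Halts.seq_pow (C := 6) (C' := 1) ?_)
    refine (mulProg_halts h4' h5' (by decide) (by decide) hN (by omega)).mono le_rfl ?_
    rintro τ ⟨hτ, hfr⟩
    refine ((Halts.instr ?_).time_le (by simpa [Instr.cost] using hN))
    have h16 := hfr 16 (by decide) (by decide)
    have h4 := hfr 4 (by decide) (by decide)
    have h5 := hfr 5 (by decide) (by decide)
    simp only [Instr.apply, Store.setNat_nat]
    simp only [hτ, h16, h4, h5, hσ', h4', h5']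
    refine ⟨by simp, by simp, ?_, by simp, by simp⟩
    rw [← hI]
    obtain ⟨i, rfl⟩ := Nat.exists_eq_add_of_le' hj1
    simp [Nat.factorial_succ, mul_assoc]
  · rintro τ ⟨-, hI, -⟩
    simpa using hI

/-- `N[30] := N[1] ^ N[27]` -/
def powProg : Prog :=
  .seq (.instr (.natConst 30 1))
    (forDown 16 27 (.seq (mulProg 29 30 1 19) (.instr (.natAdd 30 29 5))))

theorem powProg_halts {σ : Store K} {N s Z : ℕ} (h4 : σ.nat 4 = 1) (h5 : σ.nat 5 = 0)
    (hN : 1 ≤ N) (hs : σ.nat 1 = s) (hZ : σ.nat 27 = Z) (hZN : Z ≤ N) (hsN : 1 ≤ Z → s ≤ N) :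
    Halts e O powProg σ (12 * N ^ 2) fun τ => τ.nat 30 = s ^ Z ∧
      ∀ a, powProg.keepsNat a = true → τ.nat a = σ.nat a := by
  have hN2 : 1 ≤ N ^ 2 := Nat.one_le_pow _ _ hN
  refine Halts.frame (Q := fun τ => τ.nat 30 = s ^ Z) ?_ fun τ h1 h2 _ => ⟨h1, h2⟩
  refine (Halts.seq_pow (C := 1) (C' := 11) ?_)
  refine ((Halts.instr ?_).time_le (by simpa [Instr.cost] using hN2))
  refine (Halts.forDown_pow (C := 7) (r := 1) (v := Z)
    (fun j τ => τ.nat 30 = s ^ (Z - j) ∧ τ.nat 4 = 1 ∧ τ.nat 5 = 0 ∧ τ.nat 1 = s)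
    ?_ hN hZN ?_ ?_ ?_).mono le_rfl ?_
  · simp [Instr.apply, hZ]
  · simp [Instr.apply, h5]
  · simp [Instr.apply, h4, h5, hs]
  · intro j hj1 hjv σ' hσ' ⟨hI, h4', h5', h1'⟩
    refine (Halts.seq_pow (C := 6) (C' := 1) ?_)
    refine (mulProg_halts h4' h5' (by decide) (by decide) hN
      (by rw [h1']; exact hsN (by omega))).mono le_rfl ?_
    rintro τ ⟨hτ, hfr⟩
    refine ((Halts.instr ?_).time_le (by simpa [Instr.cost] using hN))
    have h16 := hfr 16 (by decide) (by decide)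
    have h4 := hfr 4 (by decide) (by decide)
    have h5 := hfr 5 (by decide) (by decide)
    have h1 := hfr 1 (by decide) (by decide)
    simp only [Instr.apply, Store.setNat_nat]
    simp only [hτ, h16, h4, h5, h1, hσ', h4', h5', h1', hI]
    refine ⟨by simp, by simp, ?_, by simp, by simp, by simp⟩
    rw [show Z - (j - 1) = Z - j + 1 by omega, pow_succ]
    simp
  · rintro τ ⟨-, hI, -⟩
    simpa using hI

/-- `N[6] := N[6] ^ (2 ^ k)`, by repeated squaring. -/
def squareProg : ℕ → Prog
  | 0 => .skip
  | k + 1 => .seq (mulProg 29 6 6 19) (.seq (.instr (.natAdd 6 29 5)) (squareProg k))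

theorem squareProg_halts (k : ℕ) {σ : Store K} {N x : ℕ} (h4 : σ.nat 4 = 1) (h5 : σ.nat 5 = 0)
    (hN : 1 ≤ N) (hx : σ.nat 6 = x) (hxN : x ^ (2 ^ k) ≤ N) :
    Halts e O (squareProg k) σ ((7 * k + 1) * N ^ 1) fun τ => τ.nat 6 = x ^ (2 ^ k) ∧
      ∀ b, b ≠ 6 → b ≠ 19 → b ≠ 29 → τ.nat b = σ.nat b := by
  induction k generalizing σ x with
  | zero =>
    exact (Halts.skip ⟨by simpa using hx, fun _ _ _ _ => rfl⟩).time_le (by simpa using hN)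
  | succ k ih =>
    rw [show 7 * (k + 1) + 1 = 6 + (1 + (7 * k + 1)) by ring]
    have hxle : x ≤ N := le_trans (Nat.le_self_pow (by positivity) x) hxN
    refine Halts.seq_pow ?_
    refine (mulProg_halts h4 h5 (by decide) (by decide) hN (by omega)).mono le_rfl ?_
    rintro τ ⟨hτ, hfr⟩
    refine Halts.seq_pow ((Halts.instr ?_).time_le (by simpa [Instr.cost] using hN))
    have hfr4 := hfr 4 (by decide) (by decide)
    have hfr5 := hfr 5 (by decide) (by decide)
    refine (ih (x := x ^ 2) ?_ ?_ ?_ ?_).mono le_rfl ?_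
    · simp [Instr.apply, hfr4, h4]
    · simp [Instr.apply, hfr5, h5]
    · simp [Instr.apply, hτ, hfr5, h5, hx, sq]
    · rwa [← pow_mul, ← pow_succ']
    · rintro υ ⟨hυ, hfrυ⟩
      refine ⟨by rw [hυ, ← pow_mul, ← pow_succ'], fun b hb hb' hb'' => ?_⟩
      rw [hfrυ b hb hb' hb'']
      simp [Instr.apply, hb, hfr b hb'' hb']

/-- The constants that the test loops use: the numbers `1` and `0`, the range `N` of the loops, the
number `D` of interpolation nodes, the number of loops over coordinates, and the address of the
point at which the blackboxes are queried. -/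
structure Ready (n N D : ℕ) (σ : Store K) : Prop where
  c0 : σ.nat 0 = n
  c4 : σ.nat 4 = 1
  c5 : σ.nat 5 = 0
  c6 : σ.nat 6 = N
  c7 : σ.nat 7 = D
  c8 : σ.nat 8 = n + 1
  c24 : σ.nat 24 = 40
  c25 : σ.nat 25 = 41

/-- With `Y` and `Z` in the cells `26` and `27`, compute `X = n + Y! + s ^ Z + l + 2`, the number
`X ^ 2` of interpolation nodes and the range `X ^ 64` of the test loops. -/
def setupProg : Prog :=
  .seq factorialProg (.seq powProg
    (.seq (block [.natAdd 31 0 28, .natAdd 31 31 30, .natAdd 31 31 3, .natAdd 31 31 4,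
      .natAdd 31 31 4, .natAdd 8 0 4, .natConst 9 1, .natConst 24 40, .natConst 25 41])
      (.seq (mulProg 7 31 31 19) (.seq (.instr (.natAdd 6 7 5)) (squareProg 5)))))

theorem setupProg_halts {σ : Store K} {s l Y Z X : ℕ} (hX : X = n + Y ! + s ^ Z + l + 2)
    (h0 : σ.nat 0 = n) (h1 : σ.nat 1 = s) (h3 : σ.nat 3 = l) (h4 : σ.nat 4 = 1) (h5 : σ.nat 5 = 0)
    (hY : σ.nat 26 = Y) (hZ : σ.nat 27 = Z) (hZX : Z ≤ X ^ 64) :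
    Halts e O setupProg σ (100 * (X ^ 64) ^ 2)
      fun τ => Ready n (X ^ 64) (X ^ 2) τ ∧ τ.nat 9 = 1 := by
  have hXpos : 1 ≤ X := by omega
  have hXN : X ≤ X ^ 64 := Nat.le_self_pow (by norm_num) X
  have hN : 1 ≤ X ^ 64 := Nat.one_le_pow _ _ hXpos
  have hYX : Y ≤ X ^ 64 := by
    have := Nat.self_le_factorial Y
    omega
  have hsX : 1 ≤ Z → s ≤ X ^ 64 := fun h => by
    have := Nat.le_self_pow (n := Z) (by omega) s
    omega
  generalize hNdef : X ^ 64 = N at *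
  have hN2 : 1 ≤ N ^ 2 := Nat.one_le_pow _ _ hN
  refine Halts.raise (C := 12 + (12 + (10 + (6 + (1 + 36))))) (r := 2) ?_ hN (by norm_num) le_rfl
  refine Halts.seq_pow ((factorialProg_halts h4 h5 hN hY hYX).mono le_rfl ?_)
  rintro σ₁ ⟨hfac, hfr₁⟩
  refine Halts.seq_pow ((powProg_halts (by rw [hfr₁ 4 rfl, h4]) (by rw [hfr₁ 5 rfl, h5]) hN
    (by rw [hfr₁ 1 rfl, h1]) (by rw [hfr₁ 27 rfl, hZ]) hZX hsX).mono le_rfl ?_)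
  rintro σ₂ ⟨hpow, hfr₂⟩
  refine Halts.seq_pow ((Halts.block ?_).time_le ?_)
  swap
  · simp only [List.map_cons, List.map_nil, Instr.cost, List.sum_cons, List.sum_nil]
    omega
  have e0 : σ₂.nat 0 = n := by rw [hfr₂ 0 rfl, hfr₁ 0 rfl, h0]
  have e3 : σ₂.nat 3 = l := by rw [hfr₂ 3 rfl, hfr₁ 3 rfl, h3]
  have e4 : σ₂.nat 4 = 1 := by rw [hfr₂ 4 rfl, hfr₁ 4 rfl, h4]
  have e5 : σ₂.nat 5 = 0 := by rw [hfr₂ 5 rfl, hfr₁ 5 rfl, h5]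
  have e28 : σ₂.nat 28 = Y ! := by rw [hfr₂ 28 rfl, hfac]
  obtain ⟨σ₃, hσ₃⟩ : ∃ σ₃, σ₃ = List.foldl (Instr.apply e O) σ₂
    [.natAdd 31 0 28, .natAdd 31 31 30, .natAdd 31 31 3, .natAdd 31 31 4,
      .natAdd 31 31 4, .natAdd 8 0 4, .natConst 9 1, .natConst 24 40, .natConst 25 41] := ⟨_, rfl⟩
  rw [← hσ₃]
  simp only [List.foldl_cons, List.foldl_nil, Instr.apply] at hσ₃
  have g0 : σ₃.nat 0 = n := by simp [hσ₃, e0]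
  have g4 : σ₃.nat 4 = 1 := by simp [hσ₃, e4]
  have g5 : σ₃.nat 5 = 0 := by simp [hσ₃, e5]
  have g8 : σ₃.nat 8 = n + 1 := by simp [hσ₃, e0, e4]
  have g9 : σ₃.nat 9 = 1 := by simp [hσ₃]
  have g24 : σ₃.nat 24 = 40 := by simp [hσ₃]
  have g25 : σ₃.nat 25 = 41 := by simp [hσ₃]
  have g31 : σ₃.nat 31 = X := by simp [hσ₃, e0, e3, e4, e28, hpow, hX]
  clear hσ₃
  refine Halts.seq_pow (((mulProg_halts g4 g5 (by decide) (by decide) hN (by omega)).raise hN le_rfl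
    (by norm_num)).mono le_rfl ?_)
  rintro σ₄ ⟨hmul, hfr₄⟩
  refine Halts.seq_pow ((Halts.instr ?_).time_le (by simpa [Instr.cost] using hN2))
  refine ((squareProg_halts 5 (x := X ^ 2) (N := N) ?_ ?_ hN ?_ ?_).raise hN le_rfl
    (by norm_num)).mono le_rfl ?_
  · simp [Instr.apply, hfr₄ 4, g4]
  · simp [Instr.apply, hfr₄ 5, g5]
  · simp [Instr.apply, hfr₄ 5, g5, hmul, g31, sq]
  · rw [← pow_mul, ← hNdef]; exact le_of_eq (by norm_num)
  · rintro τ ⟨h6, hfr⟩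
    rw [← pow_mul, show 2 * 2 ^ 5 = 64 by norm_num, hNdef] at h6
    refine ⟨⟨?_, ?_, ?_, h6, ?_, ?_, ?_, ?_⟩, ?_⟩
    all_goals rw [hfr _ (by decide) (by decide) (by decide)]
    all_goals simp [Instr.apply, hfr₄, g0, g4, g5, g8, g9, g24, g25, hmul, g31, sq]

end FieldRAM

/-! ### Computation of the points of the hitting set -/

namespace FieldRAM

variable {K : Type*} [Field K] {n : ℕ} {e : ℕ → K} {O : Bool → (Fin n → K) → K}

/-- `M[0] := M[1] ^ N[17]` -/
def fldPowProg : Prog :=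
  .seq (.instr (.fldOne 0)) (forDown 19 17 (.instr (.fldMul 0 0 1)))

theorem fldPowProg_halts {σ : Store K} {N w : ℕ} {x : K} (h4 : σ.nat 4 = 1) (h5 : σ.nat 5 = 0)
    (hN : 1 ≤ N) (hw : σ.nat 17 = w) (hwN : w ≤ N) (hx : σ.fld 1 = x) :
    Halts e O fldPowProg σ (6 * N ^ 1) fun τ => τ.fld 0 = x ^ w ∧
      (∀ a, fldPowProg.keepsNat a = true → τ.nat a = σ.nat a) ∧
      ∀ a, fldPowProg.keepsFld a = true → τ.fld a = σ.fld a := by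
  refine Halts.frame (Q := fun τ => τ.fld 0 = x ^ w) ?_ fun τ h1 h2 h3 => ⟨h1, h2, h3⟩
  refine (Halts.seq_pow (C := 1) (C' := 5) ?_)
  refine ((Halts.instr ?_).time_le (by simpa [Instr.cost] using hN))
  refine (Halts.forDown_pow (C := 1) (r := 0) (v := w)
    (fun j τ => τ.fld 0 = x ^ (w - j) ∧ τ.fld 1 = x ∧ τ.nat 4 = 1)
    (by simpa [Instr.apply] using hw) hN hwN (by simpa [Instr.apply] using h5) ?_ ?_).mono le_rfl ?_
  · simp [Instr.apply, h4, hx]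
  · intro j hj1 hjv σ' hσ' ⟨hI, h1', h4'⟩
    refine ((Halts.instr ?_).time_le (by simp [Instr.cost]))
    simp only [Instr.apply, Store.setFld_nat, Store.setFld_fld, Store.setNat_fld, Store.setNat_nat]
    refine ⟨hσ', h4', ?_, by simpa using h1', by simpa using h4'⟩
    rw [show w - (j - 1) = w - j + 1 by omega, pow_succ, if_pos trivial, hI, h1']
  · rintro τ ⟨-, hI, -⟩
    simpa using hI

/-- `N[17] := N[17] * N[11] mod N[10]` -/
def mulModProg : Prog :=
  .seq (.instr (.natConst 18 0)) (.seq
    (forDown 19 17 (.seq (block [.natAdd 18 18 11, .natSub 22 10 18])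
      (.natBranch 22 (.instr (.natSub 18 18 10)) .skip)))
    (.instr (.natAdd 17 18 5)))

theorem mulModProg_halts {σ : Store K} {N w p k : ℕ} (h4 : σ.nat 4 = 1) (h5 : σ.nat 5 = 0)
    (hN : 1 ≤ N) (hw : σ.nat 17 = w) (hwN : w ≤ N) (hp : σ.nat 10 = p) (hk : σ.nat 11 = k)
    (hkp : k < p) :
    Halts e O mulModProg σ (11 * N ^ 1) fun τ => τ.nat 17 = w * k % p ∧
      (∀ a, mulModProg.keepsNat a = true → τ.nat a = σ.nat a) ∧
      ∀ a, mulModProg.keepsFld a = true → τ.fld a = σ.fld a := by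
  refine Halts.frame (Q := fun τ => τ.nat 17 = w * k % p) ?_ fun τ h1 h2 h3 => ⟨h1, h2, h3⟩
  refine (Halts.seq_pow (C := 1) (C' := 9 + 1) ?_)
  refine ((Halts.instr ?_).time_le (by simpa [Instr.cost] using hN))
  refine (Halts.seq_pow ?_)
  refine (Halts.forDown_pow (C := 5) (r := 0) (v := w)
    (fun j τ => τ.nat 18 = (w - j) * k % p ∧ τ.nat 4 = 1 ∧ τ.nat 5 = 0 ∧ τ.nat 10 = p ∧
      τ.nat 11 = k)
    (by simpa [Instr.apply] using hw) hN hwN (by simpa [Instr.apply] using h5) ?_ ?_).mono le_rfl ?_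
  · simp [Instr.apply, h4, h5, hp, hk]
  · intro j hj1 hjv σ' hσ' ⟨hI, h4', h5', h10', h11'⟩
    have hstep : (w - (j - 1)) * k % p =
        if p ≤ (w - j) * k % p + k then (w - j) * k % p + k - p else (w - j) * k % p + k := by
      have hlt : (w - j) * k % p < p := Nat.mod_lt _ (by omega)
      rw [show w - (j - 1) = w - j + 1 by omega, add_mul, one_mul, Nat.add_mod,
        Nat.mod_eq_of_lt hkp]
      split_ifs with h
      · rw [Nat.mod_eq_sub_mod h, Nat.mod_eq_of_lt (by omega)]
      · rw [Nat.mod_eq_of_lt (by omega)]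
    refine (Halts.seq (T := 3) (T' := 2) ((Halts.block ?_).time_le (by simp [Instr.cost]))).time_le
      (by simp)
    refine Halts.natBranch (fun h0 => ?_) (fun h0 => ?_)
    · refine ((Halts.instr ?_).time_le (by simp [Instr.cost]))
      simp [Instr.apply, h10', h11', hI] at h0
      have hle : p ≤ (w - j) * k % p + k := by omega
      rw [if_pos hle] at hstep
      simp [Instr.apply, h4', h5', h10', h11', hI, hσ', hstep]
    · refine ((Halts.skip ?_).time_le (by simp))
      simp [Instr.apply, h10', h11', hI] at h0
      have hle : ¬ p ≤ (w - j) * k % p + k := by omega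
      rw [if_neg hle] at hstep
      simp [Instr.apply, h4', h5', h10', h11', hI, hσ', hstep]
  · rintro τ ⟨-, hI, -, h5', -⟩
    refine ((Halts.instr ?_).time_le (by simpa [Instr.cost] using hN))
    simpa [Instr.apply, h5'] using hI

/-- The point with the coordinates `x ^ (k ^ (n - 1 - j) mod p)`, where `x` is the list element
`N[12]`, `k = N[11]` and `p = N[10]`, is written to the field cells from `41` on. -/
def pointProg : Prog :=
  .seq (.instr (.natConst 17 1)) (forDown 16 0
    (.seq (.instr (.fldElem 1 12)) (.seq fldPowProg
      (.seq (block [.natAdd 20 16 24, .fldStore 20 0]) mulModProg))))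

theorem pointProg_halts {σ : Store K} {N D p k t : ℕ} (hσ : Ready n N D σ) (hN : 1 ≤ N)
    (hnN : n ≤ N) (hp : σ.nat 10 = p) (hk : σ.nat 11 = k) (ht : σ.nat 12 = t) (hk0 : 0 < k)
    (hkp : k < p) (hpN : p ≤ N) :
    Halts e O pointProg σ (30 * N ^ 2) fun τ =>
      (∀ j : Fin n, τ.fld (41 + j) = e t ^ (k ^ (n - 1 - j) % p)) ∧
      ∀ a, pointProg.keepsNat a = true → τ.nat a = σ.nat a := by
  have hN2 : 1 ≤ N ^ 2 := Nat.one_le_pow _ _ hN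
  refine Halts.frame (Q := fun τ => ∀ j : Fin n, τ.fld (41 + j) = e t ^ (k ^ (n - 1 - j) % p))
    ?_ fun τ h1 h2 _ => ⟨h1, h2⟩
  refine Halts.raise (C := 1 + 25) (r := 2) (Halts.seq_pow ?_) hN (by norm_num) le_rfl
  refine ((Halts.instr ?_).time_le (by simpa [Instr.cost] using hN2))
  refine (Halts.forDown_pow (C := 1 + (6 + (3 + 11))) (r := 1) (v := n)
    (fun j τ => τ.nat 17 = k ^ (n - j) % p ∧ τ.nat 4 = 1 ∧ τ.nat 5 = 0 ∧ τ.nat 10 = p ∧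
      τ.nat 11 = k ∧ τ.nat 12 = t ∧ τ.nat 24 = 40 ∧
      ∀ i, j < i → i ≤ n → τ.fld (40 + i) = e t ^ (k ^ (n - i) % p))
    (by simpa [Instr.apply] using hσ.c0) hN hnN (by simpa [Instr.apply] using hσ.c5)
    ?_ ?_).mono le_rfl ?_
  · have h1p : 1 % p = 1 := Nat.mod_eq_of_lt (by omega)
    simp only [Instr.apply, Store.setNat_nat]
    simp only [hσ.c4, hσ.c5, hp, hk, ht, hσ.c24]
    refine ⟨by simp [h1p], by simp, by simp, by simp, by simp, by simp, by simp, fun i h h' => ?_⟩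
    omega
  · intro j hj1 hjv σ' hσ' ⟨h17, h4, h5, h10, h11, h12, h24, hpt⟩
    refine Halts.seq_pow ((Halts.instr ?_).time_le (by simpa [Instr.cost] using hN))
    have hwN : k ^ (n - j) % p ≤ N := (Nat.mod_lt _ (by omega)).le.trans hpN
    refine Halts.seq_pow ((fldPowProg_halts (x := e t) (by simpa [Instr.apply] using h4)
      (by simpa [Instr.apply] using h5) hN (by simpa [Instr.apply] using h17) hwN
      (by simp [Instr.apply, h12])).mono le_rfl ?_)
    rintro σ₁ ⟨hpow, hn₁, hf₁⟩
    simp only [Instr.apply, Store.setFld_nat] at hn₁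
    have hn16 := hn₁ 16 rfl
    have hn24 := hn₁ 24 rfl
    have hn4 := hn₁ 4 rfl
    have hn5 := hn₁ 5 rfl
    have hn17 := hn₁ 17 rfl
    have hn10 := hn₁ 10 rfl
    have hn11 := hn₁ 11 rfl
    have hn12 := hn₁ 12 rfl
    refine Halts.seq_pow ((Halts.block ?_).time_le (by simp [Instr.cost]; omega))
    refine (mulModProg_halts (w := k ^ (n - j) % p) (p := p) (k := k)
      (by simp [Instr.apply, hn4, h4]) (by simp [Instr.apply, hn5, h5]) hN
      (by simp [Instr.apply, hn17, h17]) hwN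
      (by simp [Instr.apply, hn10, h10]) (by simp [Instr.apply, hn11, h11]) hkp).mono le_rfl ?_
    rintro τ ⟨hτ, hn₂, hf₂⟩
    simp only [List.foldl_cons, List.foldl_nil, Instr.apply, Store.setFld_nat, Store.setNat_nat]
      at hn₂
    refine ⟨?_, ?_, ?_, ?_, ?_, ?_, ?_, ?_, ?_, ?_⟩
    · rw [hn₂ 16 rfl]; simp [hn16, hσ']
    · rw [hn₂ 4 rfl]; simp [hn4, h4]
    · rw [show n - (j - 1) = n - j + 1 by omega, pow_succ]
      simp [hτ]
    · simp [hn₂ 4 rfl, hn4, h4]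
    · simp [hn₂ 5 rfl, hn5, h5]
    · simp [hn₂ 10 rfl, hn10, h10]
    · simp [hn₂ 11 rfl, hn11, h11]
    · simp [hn₂ 12 rfl, hn12, h12]
    · simp [hn₂ 24 rfl, hn24, h24]
    · intro i hi hin
      rw [Store.setNat_fld, hf₂ _ (by simp [mulModProg, Prog.keepsFld, forDown, block])]
      simp only [List.foldl_cons, List.foldl_nil, Instr.apply, Store.setFld_fld, Store.setNat_fld,
        Store.setNat_nat, if_true, hn16, hn24, hσ', h24]
      by_cases hij : i = j
      · subst hij
        rw [if_pos (by omega), hpow]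
      · rw [if_neg (by omega), hf₁ _ (by simp [fldPowProg, Prog.keepsFld, forDown])]
        simp only [Instr.apply, Store.setFld_fld]
        rw [if_neg (by omega)]
        exact hpt i (by omega) hin
  · rintro τ ⟨-, -, -, -, -, -, -, -, hpt⟩ j
    have := hpt (j + 1) (by omega) (by omega)
    rw [show 41 + (j : ℕ) = 40 + (j + 1) by ring, this]
    congr 3
    omega

end FieldRAM

/-! ### Interpolation on a line -/

namespace FieldRAM

variable {K : Type*} [Field K] {n : ℕ} {e : ℕ → K} {O : Bool → (Fin n → K) → K}

/-- The values of a blackbox on the line through `α` in direction of the `i`-th axis, where the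
axes are counted from `1`. -/
def lineValue (O : (Fin n → K) → K) (α : Fin n → K) (i : ℕ) (x : K) : K :=
  O fun j => if (j : ℕ) + 1 = i then x else α j

/-- The point `α` is in the field cells from `41` on, up to its `i`-th coordinate. -/
def PointAt (α : Fin n → K) (i : ℕ) (σ : Store K) : Prop :=
  ∀ j : Fin n, (j : ℕ) + 1 ≠ i → σ.fld (41 + j) = α j

/-- Move the point in memory along the line to the value in the field cell `a`, and query both
blackboxes. -/
def queryProg (a : ℕ) : Prog :=
  block [.fldStore 21 a, .query false 6 25, .query true 7 25]

theorem queryProg_halts {σ : Store K} {N i a : ℕ} {α : Fin n → K}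
    (hnN : n + 1 ≤ N) (h21 : σ.nat 21 = 40 + i) (h25 : σ.nat 25 = 41) (hi : 1 ≤ i)
    (hα : PointAt α i σ) :
    Halts e O (queryProg a) σ (4 * N ^ 1) fun τ =>
      τ.fld 6 = lineValue (O false) α i (σ.fld a) ∧ τ.fld 7 = lineValue (O true) α i (σ.fld a) ∧
      PointAt α i τ ∧ τ.nat = σ.nat ∧ ∀ b, b < 40 → b ≠ 6 → b ≠ 7 → τ.fld b = σ.fld b := by
  have hpt : ∀ j : Fin n, (if 41 + (j : ℕ) = 40 + i then σ.fld a else σ.fld (41 + j)) =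
      if (j : ℕ) + 1 = i then σ.fld a else α j := by
    intro j
    by_cases hj : (j : ℕ) + 1 = i
    · rw [if_pos (by omega), if_pos hj]
    · rw [if_neg (by omega), if_neg hj, hα j hj]
  refine (Halts.block ?_).time_le (by simp [Instr.cost]; omega)
  have hne : ∀ j : Fin n, 41 + (j : ℕ) ≠ 6 := fun j => by omega
  have hne7 : ∀ j : Fin n, 41 + (j : ℕ) ≠ 7 := fun j => by omega
  simp only [List.foldl_cons, List.foldl_nil, Instr.apply, Store.setFld_fld, Store.setFld_nat, h21,
    h25, hne, if_false, hpt]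
  refine ⟨by simp [lineValue], by simp [lineValue], ?_, trivial, ?_⟩
  · intro j hj
    simp [hne, hne7, hpt, hj]
  · intro b hb h6 h7
    rw [if_neg h7, if_neg h6, if_neg (by omega)]

/-- `M[8] := M[8] * ∏ (M[4] - M[9]) / (M[5] - M[9])`, where `M[9]` runs over the nodes different
from `M[5]`. -/
def basisProg : Prog :=
  forDown 23 7 (.seq (block [.natAdd 19 14 23, .fldElem 9 19, .fldSub 10 5 9])
    (.fldBranch 10 .skip (block [.fldSub 9 4 9, .fldDiv 9 9 10, .fldMul 8 8 9])))

theorem prod_Ioc_pred {M : Type*} [CommMonoid M] {j D : ℕ} (hj : 1 ≤ j) (hjD : j ≤ D) (v : ℕ → M) :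
    ∏ x ∈ Finset.Ioc (j - 1) D, v x = (∏ x ∈ Finset.Ioc j D, v x) * v j := by
  have : Finset.Ioc (j - 1) D = insert j (Finset.Ioc j D) := by
    ext x; simp only [Finset.mem_Ioc, Finset.mem_insert]; omega
  rw [this, Finset.prod_insert (by simp), mul_comm]

theorem sum_Ioc_pred {M : Type*} [AddCommMonoid M] {j D : ℕ} (hj : 1 ≤ j) (hjD : j ≤ D)
    (v : ℕ → M) :
    ∑ x ∈ Finset.Ioc (j - 1) D, v x = (∑ x ∈ Finset.Ioc j D, v x) + v j := by
  have : Finset.Ioc (j - 1) D = insert j (Finset.Ioc j D) := by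
    ext x; simp only [Finset.mem_Ioc, Finset.mem_insert]; omega
  rw [this, Finset.sum_insert (by simp), add_comm]

theorem Icc_one_eq_Ioc (D : ℕ) : Finset.Icc 1 D = Finset.Ioc 0 D := by
  ext x; simp only [Finset.mem_Ioc, Finset.mem_Icc]; omega

open Classical in
theorem basisProg_halts {σ : Store K} {N D c : ℕ} {x y z : K} (hN : 1 ≤ N) (hDN : D ≤ N)
    (h4 : σ.nat 4 = 1) (h5 : σ.nat 5 = 0) (h7 : σ.nat 7 = D) (h14 : σ.nat 14 = c)
    (hx : σ.fld 4 = x) (hy : σ.fld 5 = y) (hz : σ.fld 8 = z) :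
    Halts e O basisProg σ (13 * N ^ 1) fun τ =>
      τ.fld 8 = z * ∏ m ∈ Finset.Icc 1 D,
        (if y - e (c + m) = 0 then 1 else (x - e (c + m)) / (y - e (c + m))) ∧
      (∀ a, basisProg.keepsNat a = true → τ.nat a = σ.nat a) ∧
      ∀ a, basisProg.keepsFld a = true → τ.fld a = σ.fld a := by
  rw [Icc_one_eq_Ioc]
  refine Halts.frame (Q := fun τ => τ.fld 8 = z * ∏ m ∈ Finset.Ioc 0 D,
    (if y - e (c + m) = 0 then 1 else (x - e (c + m)) / (y - e (c + m)))) ?_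
    fun τ h1 h2 h3 => ⟨h1, h2, h3⟩
  refine (Halts.forDown_pow (C := 9) (r := 0) (v := D)
    (fun j τ => (τ.fld 8 = z * ∏ m ∈ Finset.Ioc j D,
      (if y - e (c + m) = 0 then 1 else (x - e (c + m)) / (y - e (c + m)))) ∧
      τ.fld 4 = x ∧ τ.fld 5 = y ∧ τ.nat 4 = 1 ∧ τ.nat 14 = c)
    h7 hN hDN h5 ?_ ?_).mono le_rfl ?_
  · simp [h4, h14, hx, hy, hz]
  · intro j hj1 hjv σ' hσ' ⟨hI, h4', h5', hn4, hn14⟩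
    rw [prod_Ioc_pred hj1 hjv, ← mul_assoc, ← hI]
    refine (Halts.seq (T := 4) (T' := 5) ((Halts.block ?_).time_le (by simp [Instr.cost]))).time_le
      (by simp)
    refine Halts.fldBranch (fun h0 => ?_) (fun h0 => ?_)
    · refine ((Halts.skip ?_).time_le (by simp))
      simp [Instr.apply, hn14, hσ', h5'] at h0
      simp [Instr.apply, hn14, hσ', h5', h4', hn4, h0]
    · refine ((Halts.block ?_).time_le (by simp [Instr.cost]))
      simp [Instr.apply, hn14, hσ', h5'] at h0
      simp [Instr.apply, hn14, hσ', h5', h4', hn4, h0]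
  · rintro τ ⟨-, hI, -⟩
    exact hI

/-- `M[3]` becomes the value at `M[4]`, the list element `N[15]`, of the interpolation of the
quotient of the blackboxes, and `M[2]` the product of the values of the first blackbox at the
nodes. -/
def nodesProg : Prog :=
  .seq (block [.natAdd 21 13 24, .fldOne 2, .fldZero 3, .fldElem 4 15])
    (forDown 16 7 (.seq (block [.natAdd 22 14 16, .fldElem 5 22]) (.seq (queryProg 5)
      (.seq (block [.fldMul 2 2 6, .fldDiv 8 7 6]) (.seq basisProg (.instr (.fldAdd 3 3 8)))))))

theorem nodesProg_halts {σ : Store K} {N D i c u : ℕ} {α : Fin n → K} (hσ : Ready n N D σ)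
    (hN : 1 ≤ N) (hDN : D ≤ N) (hnN : n + 1 ≤ N) (hi : σ.nat 13 = i) (hc : σ.nat 14 = c)
    (hu : σ.nat 15 = u) (hi1 : 1 ≤ i) (hα : PointAt α i σ) :
    Halts e O nodesProg σ (40 * N ^ 2) fun τ =>
      τ.fld 2 = ∏ j ∈ Finset.Icc 1 D, lineValue (O false) α i (e (c + j)) ∧
      τ.fld 3 = Polynomial.interpValue e D c
        (fun j => lineValue (O true) α i (e j) / lineValue (O false) α i (e j)) (e u) ∧
      τ.fld 4 = e u ∧ PointAt α i τ ∧ τ.nat 21 = 40 + i ∧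
      ∀ a, nodesProg.keepsNat a = true → τ.nat a = σ.nat a := by
  classical
  have hN2 : N ^ 1 ≤ N ^ 2 := Nat.pow_le_pow_right hN (by norm_num)
  rw [Polynomial.interpValue]
  set φ' := lineValue (O false) α i with hφ
  set ψ' := lineValue (O true) α i with hψ
  set b : ℕ → K := fun j => ψ' (e (c + j)) / φ' (e (c + j)) * ∏ m ∈ Finset.Icc 1 D,
    (if e (c + j) - e (c + m) = 0 then 1 else (e u - e (c + m)) / (e (c + j) - e (c + m))) with hb
  refine Halts.frame (Q := fun τ => τ.fld 2 = ∏ j ∈ Finset.Icc 1 D, φ' (e (c + j)) ∧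
      τ.fld 3 = ∑ j ∈ Finset.Icc 1 D, b j ∧ τ.fld 4 = e u ∧ PointAt α i τ ∧ τ.nat 21 = 40 + i) ?_
    fun τ h1 h2 _ => ⟨h1.1, ?_, h1.2.2.1, h1.2.2.2.1, h1.2.2.2.2, h2⟩
  swap
  · rw [h1.2.1]
  refine Halts.raise (C := 5 + 30) (r := 2) (Halts.seq_pow ?_) hN (by norm_num) le_rfl
  refine ((Halts.block ?_).time_le (by simp [Instr.cost]; nlinarith))
  refine (Halts.forDown_pow (C := 3 + (4 + (3 + (13 + 1)))) (r := 1) (v := D)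
    (fun j τ => τ.fld 2 = ∏ x ∈ Finset.Ioc j D, φ' (e (c + x)) ∧
      τ.fld 3 = ∑ x ∈ Finset.Ioc j D, b x ∧ τ.fld 4 = e u ∧ PointAt α i τ ∧
      τ.nat 21 = 40 + i ∧ τ.nat 4 = 1 ∧ τ.nat 5 = 0 ∧ τ.nat 7 = D ∧ τ.nat 14 = c ∧ τ.nat 25 = 41)
    (by simp [Instr.apply, hσ.c7]) hN hDN (by simp [Instr.apply, hσ.c5]) ?_ ?_).mono
      (Nat.mul_le_mul_right _ (by norm_num)) ?_
  · simp only [List.foldl_cons, List.foldl_nil, Instr.apply, Store.setFld_fld, Store.setFld_nat,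
      Store.setNat_nat, Store.setNat_fld, hi, hσ.c24, hu, hσ.c4, hσ.c5, hσ.c7, hc, hσ.c25]
    refine ⟨by simp, by simp, by simp, ?_, by simp [add_comm], by simp, by simp, by simp, by simp,
      by simp⟩
    intro j hj
    have h2 : 41 + (j : ℕ) ≠ 2 := by omega
    have h3 : 41 + (j : ℕ) ≠ 3 := by omega
    have h4 : 41 + (j : ℕ) ≠ 4 := by omega
    simpa [h2, h3, h4] using hα j hj
  · intro j hj1 hjv σ' hσ' ⟨hI2, hI3, hx, hpt, h21, h4, h5, h7, h14, h25⟩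
    refine Halts.seq_pow ((Halts.block ?_).time_le (by simp [Instr.cost]; omega))
    refine Halts.seq_pow ((queryProg_halts (i := i) (α := α) hnN
      (by simp [Instr.apply, h21]) (by simp [Instr.apply, h25]) hi1 ?_).mono le_rfl ?_)
    · intro j' hj'
      have h5 : 41 + (j' : ℕ) ≠ 5 := by omega
      simpa [Instr.apply, h5] using hpt j' hj'
    rintro σ₁ ⟨hq6, hq7, hpt₁, hn₁, hf₁⟩
    have hf2 := hf₁ 2 (by norm_num) (by norm_num) (by norm_num)
    have hf3 := hf₁ 3 (by norm_num) (by norm_num) (by norm_num)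
    have hf4 := hf₁ 4 (by norm_num) (by norm_num) (by norm_num)
    have hf5 := hf₁ 5 (by norm_num) (by norm_num) (by norm_num)
    simp [Instr.apply, h14, hσ'] at hq6 hq7 hf2 hf3 hf4 hf5
    refine Halts.seq_pow ((Halts.block ?_).time_le (by simp [Instr.cost]; omega))
    refine Halts.seq_pow ((basisProg_halts (D := D) (c := c) (x := e u) (y := e (c + j))
      (z := ψ' (e (c + j)) / φ' (e (c + j))) hN hDN
      (by simp [Instr.apply, hn₁, h4]) (by simp [Instr.apply, hn₁, h5])
      (by simp [Instr.apply, hn₁, h7]) (by simp [Instr.apply, hn₁, h14])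
      (by simp [Instr.apply, hf4, hx]) (by simp [Instr.apply, hf5])
      (by simp [Instr.apply, hq6, hq7, hφ, hψ])).mono le_rfl ?_)
    rintro τ ⟨h8, hn₂, hf₂⟩
    refine ((Halts.instr ?_).time_le (by simpa [Instr.cost] using hN))
    simp only [List.foldl_cons, List.foldl_nil, Instr.apply, Store.setFld_nat, hn₁,
      Store.setNat_nat] at hn₂
    have hf₂' : ∀ a, a ≠ 8 → a ≠ 9 → a ≠ 10 → τ.fld a = if a = 2 then σ₁.fld 2 * σ₁.fld 6 else
        σ₁.fld a := by
      intro a h8 h9 h10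
      rw [hf₂ a (by simp [basisProg, Prog.keepsFld, forDown, block, h8, h9, h10])]
      simp [Instr.apply, h8]
    simp only [Instr.apply, Store.setFld_nat, Store.setFld_fld, Store.setNat_nat,
      Store.setNat_fld]
    rw [prod_Ioc_pred hj1 hjv, sum_Ioc_pred hj1 hjv]
    refine ⟨?_, ?_, ?_, ?_, ?_, ?_, ?_, ?_, ?_, ?_, ?_, ?_⟩
    · rw [hn₂ 16 rfl]; simpa using hσ'
    · rw [hn₂ 4 rfl]; simpa using h4
    · rw [if_neg (by norm_num), hf₂' 2 (by norm_num) (by norm_num) (by norm_num), if_pos rfl, hf2,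
        hI2, hq6]
    · rw [if_pos trivial, hf₂' 3 (by norm_num) (by norm_num) (by norm_num), if_neg (by norm_num),
        hf3, hI3, h8]
    · rw [if_neg (by norm_num), hf₂' 4 (by norm_num) (by norm_num) (by norm_num),
        if_neg (by norm_num), hf4, hx]
    · intro j' hj'
      simp only [Store.setFld_fld, Store.setNat_fld]
      rw [if_neg (by omega), hf₂' _ (by omega) (by omega) (by omega), if_neg (by omega)]
      exact hpt₁ j' hj'
    · rw [if_neg (by norm_num), hn₂ 21 rfl]; simpa using h21
    · rw [if_neg (by norm_num), hn₂ 4 rfl]; simpa using h4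
    · rw [if_neg (by norm_num), hn₂ 5 rfl]; simpa using h5
    · rw [if_neg (by norm_num), hn₂ 7 rfl]; simpa using h7
    · rw [if_neg (by norm_num), hn₂ 14 rfl]; simpa using h14
    · rw [if_neg (by norm_num), hn₂ 25 rfl]; simpa using h25
  · rintro τ ⟨-, h2, h3, hx, hpt, h21, -⟩
    rw [Icc_one_eq_Ioc]
    exact ⟨h2, h3, hx, hpt, h21⟩

end FieldRAM

/-! ### The loops over all tests -/

namespace FieldRAM

variable {K : Type*} {n : ℕ}

/-- The flag in the integer cell `9` is kept if `P` holds, and cleared otherwise. -/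
def Verdict (P : Prop) (σ τ : Store K) : Prop :=
  (P → τ.nat 9 = σ.nat 9) ∧ (¬ P → τ.nat 9 = 0)

theorem Ready.congr {N D : ℕ} {σ τ : Store K} (h : Ready n N D σ)
    (hfr : ∀ a ∈ [0, 4, 5, 6, 7, 8, 24, 25], τ.nat a = σ.nat a) : Ready n N D τ where
  c0 := (hfr _ (by simp)).trans h.c0
  c4 := (hfr _ (by simp)).trans h.c4
  c5 := (hfr _ (by simp)).trans h.c5
  c6 := (hfr _ (by simp)).trans h.c6
  c7 := (hfr _ (by simp)).trans h.c7
  c8 := (hfr _ (by simp)).trans h.c8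
  c24 := (hfr _ (by simp)).trans h.c24
  c25 := (hfr _ (by simp)).trans h.c25

variable [Field K] {e : ℕ → K} {O : Bool → (Fin n → K) → K}

/-- Clear the flag if the blackboxes fail the test at the list element `N[15]`. -/
def checkProg : Prog :=
  .seq (queryProg 4) (.fldBranch 6 (.fldBranch 7 .skip (.instr (.natConst 9 0)))
    (.seq (block [.fldMul 9 3 6, .fldSub 9 9 7, .fldMul 9 9 2])
      (.fldBranch 9 .skip (.instr (.natConst 9 0)))))

/-- The points at which the lines for the tests are based. -/
def gridPoint (n : ℕ) (e : ℕ → K) (p k t : ℕ) : Fin n → K :=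
  fun j => e t ^ (k ^ (n - 1 - j) % p)

/-- The test for the prime candidate `N[10]`, the exponent base `N[11]`, the list element `N[12]`,
the axis `N[13]`, the interpolation window `N[14]` and the list element `N[15]`. -/
def testProg : Prog := .seq pointProg (.seq nodesProg checkProg)

theorem testProg_halts {σ : Store K} {N D p k t i c u : ℕ} (hσ : Ready n N D σ) (hDN : D ≤ N)
    (hnN : n + 1 ≤ N) (hp : σ.nat 10 = p) (hk : σ.nat 11 = k) (ht : σ.nat 12 = t)
    (hi : σ.nat 13 = i) (hc : σ.nat 14 = c) (hu : σ.nat 15 = u) (hk0 : 0 < k) (hkp : k < p)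
    (hpN : p ≤ N) (hi1 : 1 ≤ i) :
    Halts e O testProg σ (100 * N ^ 2) fun τ =>
      Verdict (Polynomial.PassesAt e D (lineValue (O false) (gridPoint n e p k t) i)
        (lineValue (O true) (gridPoint n e p k t) i) c u) σ τ ∧
      ∀ a, testProg.keepsNat a = true → τ.nat a = σ.nat a := by
  have hN : 1 ≤ N := by omega
  have hN2 : N ^ 1 ≤ N ^ 2 := Nat.pow_le_pow_right hN (by norm_num)
  set α := gridPoint n e p k t with hα
  refine Halts.frame (Q := fun τ => Verdict (Polynomial.PassesAt e D (lineValue (O false) α i)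
    (lineValue (O true) α i) c u) σ τ) ?_ fun τ h1 h2 _ => ⟨h1, h2⟩
  refine Halts.raise (C := 30 + (40 + (4 + 10))) (r := 2) ?_ hN (by norm_num) le_rfl
  refine Halts.seq_pow ((pointProg_halts hσ hN (by omega) hp hk ht hk0 hkp hpN).mono le_rfl ?_)
  rintro σ₁ ⟨hpt, hn₁⟩
  refine Halts.seq_pow ((nodesProg_halts (n := n) (D := D) (i := i) (c := c) (u := u) (α := α)
    (hσ.congr fun a ha => hn₁ a ?_) hN hDN hnN (by rw [hn₁ 13 rfl, hi]) (by rw [hn₁ 14 rfl, hc])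
    (by rw [hn₁ 15 rfl, hu]) hi1 (fun j _ => hpt j)).mono le_rfl ?_)
  · fin_cases ha <;> rfl
  rintro σ₂ ⟨h2, h3, h4, hpt₂, h21, hn₂⟩
  have h9 : σ₂.nat 9 = σ.nat 9 := by rw [hn₂ 9 rfl, hn₁ 9 rfl]
  have h25 : σ₂.nat 25 = 41 := by rw [hn₂ 25 rfl, hn₁ 25 rfl, hσ.c25]
  refine Halts.seq_pow (((queryProg_halts (i := i) (α := α) hnN h21 h25 hi1 hpt₂).raise hN le_rfl
    (by norm_num)).mono le_rfl ?_)
  rintro σ₃ ⟨h6, h7, -, hn₃, hf₃⟩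
  rw [h4] at h6 h7
  have g2 := hf₃ 2 (by norm_num) (by norm_num) (by norm_num)
  have g3 := hf₃ 3 (by norm_num) (by norm_num) (by norm_num)
  rw [h2] at g2
  rw [h3] at g3
  have g9 : σ₃.nat 9 = σ.nat 9 := by rw [hn₃, h9]
  refine (Halts.fldBranch (T := 8) (fun h0 => ?_) (fun h0 => ?_)).time_le (by nlinarith)
  · rw [h6] at h0
    refine (Halts.fldBranch (T := 1) (fun h0' => ?_) (fun h0' => ?_)).time_le (by norm_num)
    · rw [h7] at h0'
      exact Halts.skip ⟨fun _ => g9, fun hn => absurd ⟨fun _ => h0', fun h => absurd h0 h⟩ hn⟩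
    · rw [h7] at h0'
      refine (Halts.instr ?_).time_le (by simp [Instr.cost])
      exact ⟨fun h => absurd (h.1 h0) h0', fun _ => by simp [Instr.apply]⟩
  · rw [h6] at h0
    refine (Halts.seq (T := 4) (T' := 2) ((Halts.block ?_).time_le (by simp [Instr.cost]))).time_le
      (by norm_num)
    refine (Halts.fldBranch (T := 1) (fun h0' => ?_) (fun h0' => ?_))
    all_goals simp [Instr.apply, g2, g3, h6, h7, -mul_eq_zero] at h0'
    · exact Halts.skip ⟨fun _ => by simpa [Instr.apply] using g9, fun hn =>
        absurd ⟨fun h => absurd h h0, fun _ => h0'⟩ hn⟩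
    · refine (Halts.instr ?_).time_le (by simp [Instr.cost])
      exact ⟨fun h => absurd (h.2 h0) h0', fun _ => by simp [Instr.apply]⟩

/-- Loops of tests conjoin the verdicts. -/
theorem Halts.forDown_verdict {a b v N C r : ℕ} {body : Prog} {Pre : Store K → Prop} {P : ℕ → Prop}
    (h4 : ∀ σ, Pre σ → σ.nat 4 = 1) (h5 : ∀ σ, Pre σ → σ.nat 5 = 0)
    (hb : ∀ σ, Pre σ → σ.nat b = v) (hset : ∀ σ x, Pre σ → Pre (σ.setNat a x)) (ha : a ≠ 9)
    (hN : 1 ≤ N) (hv : v ≤ N)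
    (hbody : ∀ x, 1 ≤ x → x ≤ v → ∀ σ, Pre σ ∧ σ.nat a = x →
      Halts e O body σ (C * N ^ r) fun τ => (Pre τ ∧ τ.nat a = x) ∧ Verdict (P x) σ τ)
    (σ : Store K) (hσ : Pre σ) :
    Halts e O (FieldRAM.forDown a b body) σ ((C + 4) * N ^ (r + 1)) fun τ =>
      Pre τ ∧ Verdict (∀ x, 1 ≤ x → x ≤ v → P x) σ τ := by
  refine (Halts.forDown_pow (C := C) (r := r) (v := v)
    (fun j τ => Pre τ ∧ Verdict (∀ x, j < x → x ≤ v → P x) σ τ) (hb σ hσ) hN hv (h5 σ hσ) ?_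
    ?_).mono le_rfl ?_
  · refine ⟨hset σ v hσ, fun _ => by simp [ha.symm], fun hn => absurd (fun x h h' => ?_) hn⟩
    omega
  · intro j hj1 hjv σ' hσ' ⟨hpre, hver⟩
    refine (hbody j hj1 hjv σ' ⟨hpre, hσ'⟩).mono le_rfl ?_
    rintro τ ⟨⟨hτ, hτa⟩, hτv⟩
    refine ⟨hτa, h4 τ hτ, hset τ _ hτ, fun hall => ?_, fun hn => ?_⟩
    · rw [Store.setNat_nat, if_neg ha.symm, hτv.1 (hall j (by omega) hjv),
        hver.1 fun x hx hx' => hall x (by omega) hx']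
    · rw [Store.setNat_nat, if_neg ha.symm]
      by_cases hPj : P j
      · rw [hτv.1 hPj]
        refine hver.2 fun hall => hn fun x hx hx' => ?_
        rcases eq_or_lt_of_le (show j ≤ x by omega) with rfl | h
        · exact hPj
        · exact hall x h hx'
      · exact hτv.2 hPj
  · rintro τ ⟨-, hpre, hver⟩
    exact ⟨hpre, hver⟩

/-- All tests: loops over the prime candidate, the exponent base below it, the list element for the
base point, the axis, the interpolation window and the list element for the test. -/
def loopsProg : Prog :=
  forDown 10 6 (forDown 11 6 (.seq (.instr (.natSub 22 10 11)) (.natBranch 22 .skip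
    (forDown 12 6 (forDown 13 8 (forDown 14 6 (forDown 15 6 testProg)))))))

theorem loopsProg_halts {σ : Store K} {N D : ℕ} (hσ : Ready n N D σ) (hDN : D ≤ N)
    (hnN : n + 1 ≤ N) :
    Halts e O loopsProg σ (200 * N ^ 8) fun τ => Ready n N D τ ∧
      Verdict (∀ p, 1 ≤ p → p ≤ N → ∀ k, 1 ≤ k → k ≤ N → k < p → ∀ t, 1 ≤ t → t ≤ N →
        ∀ i, 1 ≤ i → i ≤ n + 1 → ∀ c, 1 ≤ c → c ≤ N → ∀ u, 1 ≤ u → u ≤ N →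
        Polynomial.PassesAt e D (lineValue (O false) (gridPoint n e p k t) i)
          (lineValue (O true) (gridPoint n e p k t) i) c u) σ τ := by
  have hN : 1 ≤ N := by omega
  have hset : ∀ (σ : Store K) a x, a ∉ [0, 4, 5, 6, 7, 8, 24, 25] → Ready n N D σ →
      Ready n N D (σ.setNat a x) := fun σ a x ha h => h.congr fun b hb => by
    rw [Store.setNat_nat, if_neg]
    rintro rfl
    exact ha hb
  refine Halts.raise (C := 100 + 4 + 4 + 4 + 4 + 3 + 4 + 4) (r := 8) ?_ hN (by norm_num) le_rfl
  refine Halts.forDown_verdict (fun σ h => h.c4) (fun σ h => h.c5) (fun σ h => h.c6)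
    (fun σ x h => hset σ _ x (by decide) h) (by decide) hN le_rfl (fun p hp1 hpN => ?_) σ hσ
  refine Halts.forDown_verdict (fun σ h => h.1.c4) (fun σ h => h.1.c5) (fun σ h => h.1.c6)
    (fun σ x h => ⟨hset σ _ x (by decide) h.1, by simpa using h.2⟩) (by decide) hN le_rfl
    (fun k hk1 hkN σ h => ?_)
  obtain ⟨⟨hR, h10⟩, h11⟩ := h
  have hN6 : 1 ≤ N ^ 6 := Nat.one_le_pow _ _ hN
  refine (Halts.seq (T := 1) (T' := (100 + 4 + 4 + 4 + 4) * N ^ 6 + 1) ?_).time_le (by nlinarith)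
  refine Halts.instr ?_
  refine Halts.natBranch (fun h0 => ?_) (fun h0 => ?_)
  · refine (Halts.skip ?_).time_le (by nlinarith)
    simp [Instr.apply, h10, h11] at h0
    refine ⟨⟨⟨hset σ _ _ (by decide) hR, by simpa [Instr.apply] using h10⟩,
      by simpa [Instr.apply] using h11⟩, fun _ => by simp [Instr.apply], fun hn => absurd ?_ hn⟩
    intro hkp; omega
  · simp [Instr.apply, h10, h11] at h0
    have hkp : k < p := by omega
    have hR' : (Ready n N D ((Instr.natSub 22 10 11).apply e O σ) ∧
        ((Instr.natSub 22 10 11).apply e O σ).nat 10 = p) ∧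
        ((Instr.natSub 22 10 11).apply e O σ).nat 11 = k :=
      ⟨⟨hset σ _ _ (by decide) hR, by simpa [Instr.apply] using h10⟩,
        by simpa [Instr.apply] using h11⟩
    refine (Halts.forDown_verdict (N := N) (r := 5) (C := 100 + 4 + 4 + 4)
      (Pre := fun σ => (Ready n N D σ ∧ σ.nat 10 = p) ∧ σ.nat 11 = k)
      (fun σ h => h.1.1.c4) (fun σ h => h.1.1.c5) (fun σ h => h.1.1.c6)
      (fun σ x h => ⟨⟨hset σ _ x (by decide) h.1.1, by simpa using h.1.2⟩, by simpa using h.2⟩)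
      (by decide) hN le_rfl (fun t ht1 htN => ?_) _ hR').mono le_rfl fun τ hτ => ⟨hτ.1,
        fun hkp' => ?_, fun hn => hτ.2.2 fun hall => hn fun _ => hall⟩
    swap
    · rw [hτ.2.1 (hkp' hkp)]; simp [Instr.apply]
    refine Halts.forDown_verdict (v := n + 1)
      (fun σ h => h.1.1.1.c4) (fun σ h => h.1.1.1.c5) (fun σ h => h.1.1.1.c8)
      (fun σ x h => ⟨⟨⟨hset σ _ x (by decide) h.1.1.1, by simpa using h.1.1.2⟩,
        by simpa using h.1.2⟩, by simpa using h.2⟩)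
      (by decide) hN hnN (fun i hi1 hin => ?_)
    refine Halts.forDown_verdict
      (fun σ h => h.1.1.1.1.c4) (fun σ h => h.1.1.1.1.c5) (fun σ h => h.1.1.1.1.c6)
      (fun σ x h => ⟨⟨⟨⟨hset σ _ x (by decide) h.1.1.1.1, by simpa using h.1.1.1.2⟩,
        by simpa using h.1.1.2⟩, by simpa using h.1.2⟩, by simpa using h.2⟩)
      (by decide) hN le_rfl (fun c hc1 hcN => ?_)
    refine Halts.forDown_verdict
      (fun σ h => h.1.1.1.1.1.c4) (fun σ h => h.1.1.1.1.1.c5) (fun σ h => h.1.1.1.1.1.c6)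
      (fun σ x h => ⟨⟨⟨⟨⟨hset σ _ x (by decide) h.1.1.1.1.1, by simpa using h.1.1.1.1.2⟩,
        by simpa using h.1.1.1.2⟩, by simpa using h.1.1.2⟩, by simpa using h.1.2⟩,
        by simpa using h.2⟩)
      (by decide) hN le_rfl (fun u hu1 huN σ h => ?_)
    obtain ⟨⟨⟨⟨⟨⟨hR, h10⟩, h11⟩, h12⟩, h13⟩, h14⟩, h15⟩ := h
    refine (testProg_halts hR hDN hnN h10 h11 h12 h13 h14 h15 hk1 hkp hpN hi1).mono le_rfl ?_
    rintro τ ⟨hv, hfr⟩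
    refine ⟨⟨⟨⟨⟨⟨⟨hR.congr fun a ha => hfr a ?_, ?_⟩, ?_⟩, ?_⟩, ?_⟩, ?_⟩, ?_⟩, hv⟩
    · fin_cases ha <;> rfl
    · rw [hfr 10 rfl, h10]
    · rw [hfr 11 rfl, h11]
    · rw [hfr 12 rfl, h12]
    · rw [hfr 13 rfl, h13]
    · rw [hfr 14 rfl, h14]
    · rw [hfr 15 rfl, h15]

end FieldRAM

/-! ### The decision procedure -/

namespace MvPolynomial

variable {F : Type*} [Field F] {K : Type*} [Field K] [Algebra F K] {n : ℕ}

theorem natDegree_lineRestrict_le (α : Fin n → K) (i : ℕ) {p : MvPolynomial (Fin n) F} {D : ℕ}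
    (hp : ∀ j, p.degreeOf j ≤ D) : (lineRestrict α i p).natDegree ≤ D := by
  by_cases hi : i < n
  · have := map_isolate α ⟨i, hi⟩ p
    rw [← this]
    exact Polynomial.natDegree_map_le.trans ((natDegree_isolate _ p).trans_le (hp _))
  · have h : lineRestrict α i p = algebraMap K (Polynomial K) (aeval α p) := by
      rw [← aeval_algebraMap_apply, lineRestrict]
      congr 2
      funext j
      simp [show (j : ℕ) ≠ i by omega]
    rw [h, Polynomial.algebraMap_apply, Algebra.algebraMap_self_apply, Polynomial.natDegree_C]
    exact Nat.zero_le _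

theorem degreeOf_le_of_dvd_ne_zero {h p : MvPolynomial (Fin n) F} (hp : p ≠ 0) (hd : h ∣ p)
    (i : Fin n) : h.degreeOf i ≤ p.degreeOf i := by
  rw [← natDegree_isolate, ← natDegree_isolate]
  exact Polynomial.natDegree_le_of_dvd (map_dvd _ hd) (by simpa using hp)

theorem degreeOf_le_of_isProductOf {S : Set (MvPolynomial (Fin n) F)} {d l : ℕ}
    {f : MvPolynomial (Fin n) F} (hS : ∀ h ∈ S, ∀ i, h.degreeOf i ≤ d) (hf : IsProductOf S l f)
    (i : Fin n) : f.degreeOf i ≤ l * d := by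
  obtain ⟨h, hh, rfl⟩ := hf
  refine (degreeOf_prod_le i _ _).trans ((Finset.sum_le_card_nsmul _ _ d
    fun j _ => hS _ (hh j) i).trans ?_)
  simp

theorem degreeOf_le_of_mem_sparsePolyFactors {s d : ℕ} :
    ∀ h ∈ SparsePolyFactors F n s d, ∀ i, h.degreeOf i ≤ d := by
  rintro h ⟨p, hp, hp0, hd⟩ i
  exact (degreeOf_le_of_dvd_ne_zero hp0 hd i).trans (hp.2 i)

end MvPolynomial

theorem two_pow_le_two_mul_factorial (m : ℕ) : 2 ^ m ≤ 2 * m ! := by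
  induction m with
  | zero => simp
  | succ m ih =>
    rcases Nat.eq_zero_or_pos m with rfl | hm
    · simp
    · rw [pow_succ, Nat.factorial_succ]
      nlinarith [Nat.factorial_pos m]

theorem factorial_two_mul_le (m : ℕ) : (2 * m)! ≤ 4 ^ m * m ! ^ 2 := by
  have h := Nat.choose_mul_factorial_mul_factorial (n := 2 * m) (k := m) (by omega)
  rw [show 2 * m - m = m by omega, mul_assoc, ← sq] at h
  rw [← h]
  refine Nat.mul_le_mul_right _ ?_
  rw [show (4 : ℕ) = 2 ^ 2 by norm_num, ← pow_mul]
  exact Nat.choose_le_two_pow _ _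

theorem factorial_four_mul_le (m : ℕ) : (4 * m)! ≤ 2 ^ 8 * m ! ^ 12 := by
  calc (4 * m)! = (2 * (2 * m))! := by congr 1; ring
    _ ≤ 4 ^ (2 * m) * (4 ^ m * m ! ^ 2) ^ 2 :=
      (factorial_two_mul_le _).trans (by gcongr; exact factorial_two_mul_le m)
    _ = (2 ^ m) ^ 8 * m ! ^ 4 := by
      rw [show (4 : ℕ) = 2 ^ 2 by norm_num, ← pow_mul, ← pow_mul, ← pow_mul]; ring
    _ ≤ (2 * m !) ^ 8 * m ! ^ 4 := by gcongr; exact two_pow_le_two_mul_factorial m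
    _ = 2 ^ 8 * m ! ^ 12 := by ring

namespace FieldRAM

open MvPolynomial

variable {F : Type*} [Field F] {K : Type*} [Field K] [Algebra F K] {n : ℕ} {e : ℕ → K}

theorem lineValue_blackboxes_false (f g : MvPolynomial (Fin n) F) (α : Fin n → K) (i : ℕ) :
    lineValue (blackboxes f g false) α (i + 1) = fun x => (lineRestrict α i f).eval x := by
  funext x
  simp [lineValue, blackboxes, eval_lineRestrict]

theorem lineValue_blackboxes_true (f g : MvPolynomial (Fin n) F) (α : Fin n → K) (i : ℕ) :
    lineValue (blackboxes f g true) α (i + 1) = fun x => (lineRestrict α i g).eval x := by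
  funext x
  simp [lineValue, blackboxes, eval_lineRestrict]

/-- The univariate tests on the lines through the grid points decide divisibility, because a
common nonroot of a test family is among the grid points. -/
theorem dvd_iff_forall_passesAt {f g : MvPolynomial (Fin n) F} {N D L M Δ m : ℕ}
    (htest : ¬ f ∣ g → HasTestFamily K f g L M Δ) (hf : ∀ i, f.degreeOf i ≤ m)
    (hg : ∀ i, g.degreeOf i ≤ m) (hmD : m < D) (hND : m * D + m + D + 1 ≤ N)
    (hN : L * n * Δ * (2 * (L * M * n + Δ + 1)) + 2 * (L * M * n + Δ + 1) < N)
    (he : Set.InjOn e (Set.Iic (N + D))) :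
    f ∣ g ↔ ∀ p, 1 ≤ p → p ≤ N → ∀ k, 1 ≤ k → k ≤ N → k < p → ∀ t, 1 ≤ t → t ≤ N →
      ∀ i, 1 ≤ i → i ≤ n + 1 → ∀ c, 1 ≤ c → c ≤ N → ∀ u, 1 ≤ u → u ≤ N →
        Polynomial.PassesAt e D (lineValue (blackboxes f g false) (gridPoint n e p k t) i)
          (lineValue (blackboxes f g true) (gridPoint n e p k t) i) c u := by
  constructor
  · intro hfg p _ _ k _ _ _ t _ _ i hi _ c _ hc u _ _
    obtain ⟨i, rfl⟩ := Nat.exists_eq_add_of_le' hi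
    rw [lineValue_blackboxes_false, lineValue_blackboxes_true]
    exact Polynomial.PassesAt.of_dvd (he.mono (Set.Iic_subset_Iic.2 (by omega)))
      (map_dvd _ hfg) ((natDegree_lineRestrict_le _ _ hg).trans_lt hmD) u
  · intro hall
    by_contra hfg
    obtain ⟨i, hi, ι, hι, R, hcard, hR, hbad⟩ := htest hfg
    have hτ : Function.Injective fun j : Fin n => n - 1 - (j : ℕ) := by
      intro a b h
      simp only at h
      exact Fin.ext (by omega)
    obtain ⟨p, k, t, hp, hpN, hk0, hkp, ht0, htN, hne⟩ := exists_common_nonroot hcard hR hτ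
      (fun j => by omega) hN (he.mono (Set.Iic_subset_Iic.2 (by omega)))
    obtain ⟨c, u, hc1, hcN, hu1, huN, hfail⟩ := Polynomial.exists_not_passesAt
      (hbad (gridPoint n e p k t) hne) (natDegree_lineRestrict_le _ i hf)
      (natDegree_lineRestrict_le _ i hg) hmD hND he
    refine hfail ?_
    have := hall p hp.pos hpN k hk0 (by omega) hkp t ht0 htN (i + 1) (by omega) (by omega)
      c hc1 hcN u hu1 huN
    rwa [lineValue_blackboxes_false, lineValue_blackboxes_true] at this

/-- Compute the parameters by `args`, run all tests, and output the flag. -/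
def decideProg (args : Prog) : Prog :=
  .seq (.instr (.natConst 4 1)) (.seq args (.seq setupProg (.seq loopsProg
    (.instr (.natAdd 0 9 5)))))

/-- The cells `26` and `27` hold the arguments `Y` and `Z` from which `setupProg` computes the
ranges of the tests. -/
structure ArgsReady (n s l Y Z : ℕ) (τ : Store K) : Prop where
  c0 : τ.nat 0 = n
  c1 : τ.nat 1 = s
  c3 : τ.nat 3 = l
  c4 : τ.nat 4 = 1
  c5 : τ.nat 5 = 0
  c26 : τ.nat 26 = Y
  c27 : τ.nat 27 = Z

/-- With test families of bounded size, the program decides divisibility in polynomial time. -/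
theorem decidesDvdWithin_decideProg {args : Prog} {s d l L M Δ Y Z X : ℕ}
    {f g : MvPolynomial (Fin n) F} (hX : X = n + Y ! + s ^ Z + l + 2)
    (hargs : Halts e (blackboxes f g) args ((initStore K n s d l).setNat 4 1) (12 * X ^ 64)
      (ArgsReady n s l Y Z))
    (hdX : d ≤ X) (hZX : Z ≤ X ^ 64)
    (htest : ¬ f ∣ g → HasTestFamily K f g L M Δ) (hf : ∀ i, f.degreeOf i ≤ l * d)
    (hg : ∀ i, g.degreeOf i ≤ l * d) (hL : L ≤ X ^ 9) (hM : M ≤ X ^ 28) (hΔ : Δ ≤ X ^ 5)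
    (he : Set.InjOn e (Set.Iio (X ^ 65))) :
    DecidesDvdWithin e (decideProg args) n s d l f g (400 * X ^ 512) := by
  have hY := Nat.factorial_pos Y
  have hX3 : 3 ≤ X := by omega
  have hX2 : X ^ 2 ≤ X ^ 64 := Nat.pow_le_pow_right (by omega) (by norm_num)
  have hXX : X ≤ X ^ 2 := Nat.le_self_pow (by norm_num) X
  have hlX : l + 2 ≤ X := by omega
  have hnX : n ≤ X := by omega
  -- The products have degree less than `X ^ 2`, and the bounds for the hitting set and for the
  -- interpolation test are below `X ^ 64`.
  have hmD : l * d < X ^ 2 := by nlinarith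
  have hND : l * d * X ^ 2 + l * d + X ^ 2 + 1 ≤ X ^ 64 := by
    have h6 : X ^ 6 ≤ X ^ 64 := Nat.pow_le_pow_right (by omega) (by norm_num)
    have h1 : l * d * X ^ 2 ≤ X ^ 2 * X ^ 2 := by gcongr
    have h4 : 9 * (X ^ 2 * X ^ 2) ≤ X ^ 6 := by
      calc 9 * (X ^ 2 * X ^ 2) ≤ X ^ 2 * (X ^ 2 * X ^ 2) := by gcongr; nlinarith
        _ = X ^ 6 := by ring
    nlinarith
  have hN : L * n * Δ * (2 * (L * M * n + Δ + 1)) + 2 * (L * M * n + Δ + 1) < X ^ 64 := by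
    have h1 : L * M * n + Δ + 1 ≤ X ^ 39 := by
      calc L * M * n + Δ + 1 ≤ X ^ 9 * X ^ 28 * X + X ^ 38 + X ^ 38 := by
            gcongr
            · exact hΔ.trans (Nat.pow_le_pow_right (by omega) (by norm_num))
            · exact Nat.one_le_pow _ _ (by omega)
        _ = 3 * X ^ 38 := by ring
        _ ≤ X * X ^ 38 := by gcongr
        _ = X ^ 39 := by ring
    have h2 : L * n * Δ ≤ X ^ 15 := by
      calc L * n * Δ ≤ X ^ 9 * X * X ^ 5 := by gcongr
        _ = X ^ 15 := by ring
    have h3 : 1 ≤ X ^ 15 := Nat.one_le_pow _ _ (by omega)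
    calc L * n * Δ * (2 * (L * M * n + Δ + 1)) + 2 * (L * M * n + Δ + 1)
        ≤ X ^ 15 * (2 * X ^ 39) + X ^ 15 * (2 * X ^ 39) := by
          gcongr ?_ * (2 * ?_) + ?_
          exact le_trans (by omega) (Nat.le_mul_of_pos_left _ h3)
      _ = 4 * X ^ 54 := by ring
      _ ≤ X ^ 2 * X ^ 54 := by gcongr; nlinarith
      _ = X ^ 56 := by ring
      _ < X ^ 64 := Nat.pow_lt_pow_right (by omega) (by norm_num)
  have heN : Set.InjOn e (Set.Iic (X ^ 64 + X ^ 2)) := by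
    refine he.mono fun a ha => ?_
    rw [Set.mem_Iic] at ha
    rw [Set.mem_Iio, pow_succ]
    have : 0 < X ^ 64 := by positivity
    nlinarith
  have hiff := dvd_iff_forall_passesAt htest hf hg hmD hND hN heN
  have key : Halts e (blackboxes f g) (decideProg args) (initStore K n s d l)
      ((1 + (12 + (100 + (200 + 1)))) * (X ^ 64) ^ 8) fun τ =>
        (f ∣ g → τ.nat 0 = 1) ∧ (¬ f ∣ g → τ.nat 0 = 0) := by
    have hN1 : 1 ≤ X ^ 64 := Nat.one_le_pow _ _ (by omega)
    have hN8 : 1 ≤ (X ^ 64) ^ 8 := Nat.one_le_pow _ _ hN1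
    refine Halts.seq_pow ((Halts.instr ?_).time_le (by simpa [Instr.cost] using hN8))
    refine Halts.seq_pow ((hargs.time_le ?_).mono le_rfl ?_)
    · exact Nat.mul_le_mul_left _ (Nat.le_self_pow (by norm_num) _)
    intro σ₁ h₁
    refine Halts.seq_pow (((setupProg_halts hX h₁.c0 h₁.c1 h₁.c3 h₁.c4 h₁.c5 h₁.c26 h₁.c27
      hZX).raise hN1 le_rfl (by norm_num)).mono le_rfl ?_)
    rintro σ₂ ⟨h₂, h9⟩
    refine Halts.seq_pow ((loopsProg_halts h₂ hX2 ?_).mono le_rfl ?_)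
    · nlinarith
    rintro σ₃ ⟨h₃, hv⟩
    refine (Halts.instr ?_).time_le (by simpa [Instr.cost] using hN8)
    rw [← hiff] at hv
    exact ⟨fun h => by simp [Instr.apply, h₃.c5, hv.1 h, h9],
      fun h => by simp [Instr.apply, h₃.c5, hv.2 h]⟩
  obtain ⟨t, τ, ht, hex, hτ⟩ := key
  refine ⟨t, τ, ht.trans ?_, hex, hτ⟩
  rw [← pow_mul, show 64 * 8 = 512 by norm_num]
  exact Nat.mul_le_mul_right _ (by norm_num)

/-- The bound for the number of monomials in the test families is polynomial in the parameters
`Y !` and `s ^ Z`. -/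
theorem sparsity_le {X Y Z s : ℕ} (hY : Y ! ≤ X) (hs : s ^ Z ≤ X) (hX : 2 ≤ X) :
    (4 * Y)! * max s 1 ^ (8 * Z) ≤ X ^ 28 := by
  have hmax : max s 1 ^ Z ≤ X := by
    rcases Nat.eq_zero_or_pos s with rfl | h
    · simp; omega
    · rwa [max_eq_left h]
  calc (4 * Y)! * max s 1 ^ (8 * Z) ≤ 2 ^ 8 * Y ! ^ 12 * (max s 1 ^ Z) ^ 8 := by
        rw [mul_comm 8 Z, pow_mul]; gcongr; exact factorial_four_mul_le Y
    _ ≤ X ^ 8 * X ^ 12 * X ^ 8 := by gcongr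
    _ = X ^ 28 := by ring

theorem eight_mul_sq_le {X Y : ℕ} (hY : Y ≤ X) (hX : 2 ≤ X) : 8 * Y ^ 2 ≤ X ^ 5 := by
  calc 8 * Y ^ 2 = 2 ^ 3 * Y ^ 2 := by norm_num
    _ ≤ X ^ 3 * X ^ 2 := by gcongr
    _ = X ^ 5 := by ring

/-- Prepare the arguments `Y = Z = d`. -/
def linearArgs : Prog := block [.natAdd 26 2 5, .natAdd 27 2 5]

theorem linearArgs_halts {O : Bool → (Fin n → K) → K} {s d l N : ℕ} (hN : 1 ≤ N) :
    Halts e O linearArgs ((initStore K n s d l).setNat 4 1) (12 * N) (ArgsReady n s l d d) := by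
  refine (Halts.block ?_).time_le (by simp [Instr.cost]; omega)
  constructor <;> simp [Instr.apply, initStore]

/-- Prepare the arguments `Y = d ^ 2` and `Z = d ^ 3`. -/
def powerArgs : Prog := .seq (mulProg 26 2 2 19) (mulProg 27 26 2 19)

theorem powerArgs_halts {O : Bool → (Fin n → K) → K} {s d l N : ℕ} (hN : 1 ≤ N) (hd : d ≤ N) :
    Halts e O powerArgs ((initStore K n s d l).setNat 4 1) (12 * N)
      (ArgsReady n s l (d ^ 2) (d ^ 3)) := by
  rw [show 12 * N = (6 + 6) * N ^ 1 by ring]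
  refine Halts.seq_pow ((mulProg_halts (by simp) (by simp [initStore]) (by decide) (by decide) hN
    (by simpa [initStore] using hd)).mono le_rfl ?_)
  rintro σ ⟨h26, hfr⟩
  have h0 := hfr 0 (by decide) (by decide)
  have h1 := hfr 1 (by decide) (by decide)
  have h2 := hfr 2 (by decide) (by decide)
  have h3 := hfr 3 (by decide) (by decide)
  have h4 := hfr 4 (by decide) (by decide)
  have h5 := hfr 5 (by decide) (by decide)
  simp [initStore] at h0 h1 h2 h3 h4 h5 h26
  refine (mulProg_halts h4 h5 (by decide) (by decide) hN (by omega)).mono le_rfl ?_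
  rintro τ ⟨h27, hfr'⟩
  have hτ : ∀ {b v}, σ.nat b = v → b ≠ 27 → b ≠ 19 → τ.nat b = v := fun h hb hb' =>
    (hfr' _ hb hb').trans h
  exact ⟨hτ h0 (by decide) (by decide), hτ h1 (by decide) (by decide),
    hτ h3 (by decide) (by decide), hτ h4 (by decide) (by decide), hτ h5 (by decide) (by decide),
    hτ (h26.trans (sq d).symm) (by decide) (by decide), by rw [h27, h26, h2]; ring⟩

/-- The polynomial in the four parameters in whose powers the time and the number of list elements
are bounded. -/
noncomputable def sizePoly : MvPolynomial (Fin 4) ℕ := X 0 + X 1 + X 2 + X 3 + C 2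

theorem eval_sizePoly (a b c d : ℕ) : eval ![a, b, c, d] sizePoly = a + b + c + d + 2 := by
  simp [sizePoly]

end FieldRAM

open FieldRAM MvPolynomial in
theorem theorem1p15 :
    -- characteristic zero or larger than `2d`, products of factors of sparse polynomials
    (∃ (p : FieldRAM.Prog) (T B : MvPolynomial (Fin 4) ℕ),
      ∀ (F : Type*) [Field F] (K : Type*) [Field K] [Algebra F K] (n s d l : ℕ) (e : ℕ → K),
        (ringChar F = 0 ∨ 2 * d < ringChar F) →
        Set.InjOn e (Set.Iio (MvPolynomial.eval ![n, d !, s ^ d, l] B)) →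
        ∀ f g : MvPolynomial (Fin n) F,
          IsProductOf (SparsePolyFactors F n s d) l f →
          IsProductOf (SparsePolyFactors F n s d) l g →
          FieldRAM.DecidesDvdWithin e p n s d l f g
            (MvPolynomial.eval ![n, d !, s ^ d, l] T)) ∧
    -- arbitrary characteristic, products of sparse polynomials
    (∃ (p : FieldRAM.Prog) (T B : MvPolynomial (Fin 4) ℕ),
      ∀ (F : Type*) [Field F] (K : Type*) [Field K] [Algebra F K] (n s d l : ℕ) (e : ℕ → K),
        Set.InjOn e (Set.Iio (MvPolynomial.eval ![n, (d ^ 2)!, s ^ (d ^ 3), l] B)) →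
        ∀ f g : MvPolynomial (Fin n) F,
          IsProductOf (SparsePoly F n s d) l f →
          IsProductOf (SparsePoly F n s d) l g →
          FieldRAM.DecidesDvdWithin e p n s d l f g
            (MvPolynomial.eval ![n, (d ^ 2)!, s ^ (d ^ 3), l] T)) := by
  constructor
  · refine ⟨decideProg linearArgs, 400 * sizePoly ^ 512, sizePoly ^ 65, ?_⟩
    intro F _ K _ _ n s d l e hchar he f g hf hg
    rw [map_pow, eval_sizePoly] at he
    rw [map_mul, map_pow, eval_sizePoly, map_ofNat]
    obtain ⟨X, hX⟩ : ∃ X, X = n + d ! + s ^ d + l + 2 := ⟨_, rfl⟩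
    rw [← hX] at he ⊢
    have hdX : d ≤ X := (Nat.self_le_factorial d).trans (by omega)
    have hXN : X ≤ X ^ 64 := Nat.le_self_pow (by norm_num) X
    refine decidesDvdWithin_decideProg hX (linearArgs_halts (by omega)) hdX (by omega)
      (hasTestFamily_of_factors hchar hf hg)
      (degreeOf_le_of_isProductOf degreeOf_le_of_mem_sparsePolyFactors hf)
      (degreeOf_le_of_isProductOf degreeOf_le_of_mem_sparsePolyFactors hg) ?_
      (sparsity_le (by omega) (by omega) (by omega)) (eight_mul_sq_le hdX (by omega)) he
    calc 2 * l ≤ X * X := Nat.mul_le_mul (by omega) (by omega)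
      _ = X ^ 2 := by ring
      _ ≤ X ^ 9 := Nat.pow_le_pow_right (by omega) (by norm_num)
  · refine ⟨decideProg powerArgs, 400 * sizePoly ^ 512, sizePoly ^ 65, ?_⟩
    intro F _ K _ _ n s d l e he f g hf hg
    rw [map_pow, eval_sizePoly] at he
    rw [map_mul, map_pow, eval_sizePoly, map_ofNat]
    obtain ⟨X, hX⟩ : ∃ X, X = n + (d ^ 2)! + s ^ (d ^ 3) + l + 2 := ⟨_, rfl⟩
    rw [← hX] at he ⊢
    have hd2 : d ^ 2 + 2 ≤ X := by
      have := Nat.self_le_factorial (d ^ 2)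
      omega
    have hdX : d + 2 ≤ X := (Nat.add_le_add_right (Nat.le_self_pow (by norm_num) d) 2).trans hd2
    have hXN : X ≤ X ^ 64 := Nat.le_self_pow (by norm_num) X
    refine decidesDvdWithin_decideProg hX (powerArgs_halts (by omega) (by omega)) (by omega) ?_
      (hasTestFamily_of_sparse hf hg)
      (degreeOf_le_of_isProductOf (fun h hh => hh.2) hf)
      (degreeOf_le_of_isProductOf (fun h hh => hh.2) hg) ?_
      (sparsity_le (by omega) (by omega) (by omega)) (eight_mul_sq_le (by omega) (by omega)) he
    · calc d ^ 3 ≤ X ^ 3 := by gcongr; omega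
        _ ≤ X ^ 64 := Nat.pow_le_pow_right (by omega) (by norm_num)
    · have h1 : 2 * l ≤ X * X := Nat.mul_le_mul (by omega) (by omega)
      have h2 : 2 * d + 1 ≤ X * X := by nlinarith
      calc 2 * l + (2 * l) ^ 2 * (2 * d + 1) ^ 2 ≤ X * X + (X * X) ^ 2 * (X * X) ^ 2 := by gcongr
        _ = X ^ 2 + X ^ 8 := by ring
        _ ≤ X ^ 8 + X ^ 8 := by gcongr <;> omega
        _ = 2 * X ^ 8 := by ring
        _ ≤ X * X ^ 8 := by gcongr; omega
        _ = X ^ 9 := by ring
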